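/- Let $n\ge 1$, let $(Y,\xi)$ be a smooth contact manifold (without boundary) of dimension $2n+1$, where the contact structure $\xi$ is locally, but not necessarily globally, the kernel of a contact form, and let $\Lambda\subset Y$ be a smoothly embedded $n$-dimensional Legendrian submanifold with nonempty boundary $\partial\Lambda$ (neither compactness nor connectedness is assumed). Let $\mathbb{R}^{2n+1}$ have coordinates $(q_0,\dots,q_{n-1},p_0,\dots,p_{n-1},z)$ and contact structure $\ker(dz-\sum_i p_i\,dq_i)$. For $\rho>0$ let $C\times V_\rho$ be the open box $|q_0|,|p_0|,|z|<\tfrac12$, $|q_i|,|p_i|<\rho$ for $1\le i\le n-1$ (for $n=1$ there is no factor $V_\rho$). Let $\Lambda_{0}\subset C$ be the Legendrian zig-zag (standard stabilised arc) $$q_0=\tfrac{1}{36}(t^3-3t),\qquad p_0=\tfrac1{18}(t^2-1),\qquad z=\tfrac1{648}\left(\tfrac35t^5-2t^3+3t\right),\qquad -3<t<3,$$ and let $Z_\rho=\{p_1=\dots=p_{n-1}=0\}\subset V_\rho$. A Legendrian $\Lambda$ *admits a stabilisation* if for some $\rho>1$ there is a contactomorphism $\varphi$ from $C\times V_\rho$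 onto an open subset $U\subset Y$ with $U\cap\partial\Lambda=\emptyset$ and $U\cap\Lambda=\varphi(\Lambda_0\times Z_\rho)$. If $2n+1\ge 5$, such a pair $(U,U\cap\Lambda)$ is a *loose chart*, and $\Lambda$ is called *loose* if it has a loose chart. Then $\Lambda$ admits a stabilisation. In particular, if $\dim Y=2n+1>3$, then $\Lambda$ is loose. More precisely, for every connected component $\Lambda'$ of $\Lambda$ with $\partial\Lambda'\neq\emptyset$, the chart $U$ can be chosen such that $U\cap\Lambda\subset\Lambda'$. -/

import Mathlib

open scoped Manifold ContDiff

/-! ### Contact structures -/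

/-- `α` is a smooth contact form on the open subset `U` of the odd-dimensional vector space `E`:
it vanishes nowhere, and at every point of `U` its exterior derivative
`dα (v, w) = (D_v α) w - (D_w α) v` is nondegenerate on the hyperplane `ker α`
(equivalently `α ∧ (dα)ⁿ ≠ 0` where `dim E = 2 n + 1`). -/
def IsContactForm {E : Type*} [NormedAddCommGroup E] [NormedSpace ℝ E]
    (U : Set E) (α : E → E →L[ℝ] ℝ) : Prop :=
  ContDiffOn ℝ ∞ α U ∧
  ∀ u ∈ U, α u ≠ 0 ∧
    ∀ v : E, α u v = 0 →
      (∀ w : E, α u w = 0 → fderiv ℝ α u v w - fderiv ℝ α u w v = 0) → v = 0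

/-- A field `ξ` of tangent subspaces on a smooth `(2 n + 1)`-manifold `Y` is a contact structure
if it is locally, in smooth charts, the kernel of a contact form.
(No coorientation, i.e. no global contact form, is required.) -/
def IsContactStructure (n : ℕ) {Y : Type*} [TopologicalSpace Y]
    [ChartedSpace (EuclideanSpace ℝ (Fin (2 * n + 1))) Y]
    (ξ : ∀ y : Y, Submodule ℝ (TangentSpace (𝓡 (2 * n + 1)) y)) : Prop :=
  ∀ y₀ : Y, ∃ e ∈ IsManifold.maximalAtlas (𝓡 (2 * n + 1)) ∞ Y, y₀ ∈ e.source ∧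
    ∃ α : EuclideanSpace ℝ (Fin (2 * n + 1)) → EuclideanSpace ℝ (Fin (2 * n + 1)) →L[ℝ] ℝ,
      IsContactForm e.target α ∧
      ∀ y ∈ e.source, ∀ v : TangentSpace (𝓡 (2 * n + 1)) y,
        v ∈ ξ y ↔
          α (e y) (mfderiv (𝓡 (2 * n + 1)) 𝓘(ℝ, EuclideanSpace ℝ (Fin (2 * n + 1))) e y v) = 0

/-! ### Legendrian submanifolds with boundary -/

/-- `f : L → Y` is a smooth embedding of the `n`-manifold with boundary `L` whose image is
everywhere tangent to `ξ`; so `Set.range f` is a Legendrian submanifold with boundary. -/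
structure IsLegendrianEmbedding {n : ℕ} [NeZero n]
    {Y : Type*} [TopologicalSpace Y] [ChartedSpace (EuclideanSpace ℝ (Fin (2 * n + 1))) Y]
    {L : Type*} [TopologicalSpace L] [ChartedSpace (EuclideanHalfSpace n) L]
    (ξ : ∀ y : Y, Submodule ℝ (TangentSpace (𝓡 (2 * n + 1)) y)) (f : L → Y) : Prop where
  isSmoothEmbedding : Manifold.IsSmoothEmbedding (𝓡∂ n) (𝓡 (2 * n + 1)) ∞ f
  tangent : ∀ (x : L) (v : TangentSpace (𝓡∂ n) x),
    mfderiv (𝓡∂ n) (𝓡 (2 * n + 1)) f x v ∈ ξ (f x)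

/-! ### The standard stabilisation in the standard contact space -/

/-- `ℝ^{2n+1}` with its coordinates `(q, p, z)`. -/
abbrev StdContactSpace (n : ℕ) : Type := (Fin n → ℝ) × (Fin n → ℝ) × ℝ

/-- The standard contact form `dz - ∑ i, p i dq i`. -/
def stdContactForm (n : ℕ) (u : StdContactSpace n) : StdContactSpace n →ₗ[ℝ] ℝ where
  toFun v := v.2.2 - ∑ i, u.2.1 i * v.1 i
  map_add' v w := by
    simp only [Prod.fst_add, Prod.snd_add, Pi.add_apply, mul_add, Finset.sum_add_distrib]
    ring
  map_smul' c v := by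
    simp only [Prod.smul_fst, Prod.smul_snd, Pi.smul_apply, smul_eq_mul, RingHom.id_apply,
      mul_sub, Finset.mul_sum]
    congr 1
    exact Finset.sum_congr rfl fun i _ => by ring

/-- The zig-zag: a Legendrian curve `t ↦ (q, p, z)` in `(ℝ³, dz - p dq)`. Its front `(q, z)` has
exactly two singular points, semicubical cusps at `t = ± 1`, and no crossing; its Lagrangian
projection `(q, p)` is a nodal cubic with a single loop, the double point being at `t = ± √3`.
Its intersection with the open cube of side length `1` is the arc `-3 < t < 3`, whose endpoints
`t = ± 3` lie on the two faces `q = ± 1/2` of the cube. -/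
noncomputable def zigzag (t : ℝ) : ℝ × ℝ × ℝ :=
  ((t ^ 3 - 3 * t) / 36, (t ^ 2 - 1) / 18, (3 * t ^ 5 / 5 - 2 * t ^ 3 + 3 * t) / 648)

/-- The open box `C × V_ρ` in `ℝ^{2n+1} = ℝ³ × T*ℝ^{n-1}`, where `C` is the open cube of side
length `1` in the coordinates `(q 0, p 0, z)`, and `V_ρ` is given by `|q i| < ρ` and `|p i| < ρ`
in the remaining coordinates. For `n = 1` it is just the cube `C`. -/
def stabilisationBox (n : ℕ) [NeZero n] (ρ : ℝ) : Set (StdContactSpace n) :=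
  {u | |u.1 0| < 1 / 2 ∧ |u.2.1 0| < 1 / 2 ∧ |u.2.2| < 1 / 2 ∧
    ∀ i, i ≠ 0 → |u.1 i| < ρ ∧ |u.2.1 i| < ρ}

/-- The product of the zig-zag in `ℝ³` with the zero section of `T*ℝ^{n-1}`. -/
def stabilisedModel (n : ℕ) [NeZero n] : Set (StdContactSpace n) :=
  {u | (∃ t : ℝ, (u.1 0, u.2.1 0, u.2.2) = zigzag t) ∧ ∀ i, i ≠ 0 → u.2.1 i = 0}

/-! ### Stabilised and loose Legendrians -/

section

variable {n : ℕ} [NeZero n]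
  {Y : Type*} [TopologicalSpace Y] [ChartedSpace (EuclideanSpace ℝ (Fin (2 * n + 1))) Y]
  {L : Type*} [TopologicalSpace L] [ChartedSpace (EuclideanHalfSpace n) L]

/-- `φ` is a Darboux chart, i.e. a contactomorphism from the box `C × V_ρ` onto an open subset of
`(Y, ξ)`, in which the Legendrian `Set.range f` is the standard stabilisation; the chart is
disjoint from the boundary of the Legendrian, and meets it only in the part `f '' S`. -/
structure IsStabilisationChart
    (ξ : ∀ y : Y, Submodule ℝ (TangentSpace (𝓡 (2 * n + 1)) y)) (f : L → Y) (S : Set L)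
    (ρ : ℝ) (φ : OpenPartialHomeomorph (StdContactSpace n) Y) : Prop where
  source_eq : φ.source = stabilisationBox n ρ
  contMDiffOn : ContMDiffOn 𝓘(ℝ, StdContactSpace n) (𝓡 (2 * n + 1)) ∞ φ φ.source
  contMDiffOn_symm : ContMDiffOn (𝓡 (2 * n + 1)) 𝓘(ℝ, StdContactSpace n) ∞ φ.symm φ.target
  contact : ∀ u ∈ φ.source, ∀ v : StdContactSpace n,
    mfderiv 𝓘(ℝ, StdContactSpace n) (𝓡 (2 * n + 1)) φ u v ∈ ξ (φ u) ↔ stdContactForm n u v = 0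
  legendrian : φ.target ∩ Set.range f = φ '' (stabilisationBox n ρ ∩ stabilisedModel n)
  disjoint_boundary : ∀ x : L, f x ∈ φ.target → x ∉ (𝓡∂ n).boundary L
  subset : ∀ x : L, f x ∈ φ.target → x ∈ S

/-- The part `f '' S` of the Legendrian `Set.range f` admits a stabilisation: for some `ρ > 1`
there is a Darboux chart `C × V_ρ`, disjoint from the boundary and from the rest of the Legendrian,
in which the Legendrian is the standard stabilisation. If `n = 1` there is no factor `V_ρ`, and
`ρ` plays no role. -/
def AdmitsStabilisationAlong
    (ξ : ∀ y : Y, Submodule ℝ (TangentSpace (𝓡 (2 * n + 1)) y)) (f : L → Y) (S : Set L) : Prop :=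
  ∃ ρ : ℝ, 1 < ρ ∧ ∃ φ : OpenPartialHomeomorph (StdContactSpace n) Y,
    IsStabilisationChart ξ f S ρ φ

/-- The Legendrian `Set.range f` admits a stabilisation. -/
def AdmitsStabilisation
    (ξ : ∀ y : Y, Submodule ℝ (TangentSpace (𝓡 (2 * n + 1)) y)) (f : L → Y) : Prop :=
  AdmitsStabilisationAlong ξ f Set.univ

/-- The part `f '' S` of the Legendrian `Set.range f` is loose: the ambient dimension is at least
`5`, and there is a loose chart meeting the Legendrian only in `f '' S`, that is, a contactomorphism
from `C × V_ρ` with `ρ > 1` onto an open set in which the Legendrian is the product of a zig-zag,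
properly embedded in the cube `C` of side length `1`, with the zero section of `V_ρ`. -/
def IsLooseAlong
    (ξ : ∀ y : Y, Submodule ℝ (TangentSpace (𝓡 (2 * n + 1)) y)) (f : L → Y) (S : Set L) : Prop :=
  5 ≤ 2 * n + 1 ∧ ∃ ρ : ℝ, 1 < ρ ∧ ∃ φ : OpenPartialHomeomorph (StdContactSpace n) Y,
    IsStabilisationChart ξ f S ρ φ

/-- The Legendrian `Set.range f` is loose: it has a loose chart. -/
def IsLoose
    (ξ : ∀ y : Y, Submodule ℝ (TangentSpace (𝓡 (2 * n + 1)) y)) (f : L → Y) : Prop :=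
  IsLooseAlong ξ f Set.univ

end

/-! ### Superposition operators on spaces of continuous maps -/

section Superposition

open Set Filter Topology

universe u v

variable {X : Type u} [TopologicalSpace X] [CompactSpace X]

/-! A zig-zag with a free end can be undone: slide the end back along the arc, past both cusps. What
remains has no cusp, so a half line seen through a suitable contactomorphism already is a zig-zag.
The boundary of the Legendrian supplies the free end, so it is enough to combine this observation
with a normal form at a boundary point.

In dimension three the sliding is explicit. A polynomial contact Hamiltonian generates a field equal
to minus the velocity along the zig-zag (`contactField_zigzagHamiltonian`). Its flow, cut off and
run for time 5, carries the part with parameter `t ≤ 3` onto the part `t ≤ -2`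
(`exists_contactEquiv_zigzagCurve`). There a Legendre transformation exhibits the curve as a 1-jet
graph over a half line, and a shear straightens it (`exists_contactEquiv_zigzag`). If `F` is the
conformal factor of the resulting map of `ℝ³`, then leaving `q i` alone and multiplying `p i` by `F`
for `i ≠ 0` lifts it to any dimension. The contact scaling `(r q, r p, r² z)` preserves the half
space `{q 0 ≥ 0, p = z = 0}` and shrinks the image of the bounded box into any neighbourhood of the
origin. The open box sees only the parameters `|t| < 3`, so stopping the arc at `t = 3` loses
nothing, and its end point stays outside (`exists_contactEquiv_stabilisedModel`). This works for
every `ρ`.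

The normal form at a boundary point is `exists_legendrianChart`: Darboux's theorem by Moser's
method, a linear symplectic map that aligns the tangent space, and an explicit straightening
(`exists_straightening`). A Legendrian with boundary extends past its boundary as a smooth
immersion, but not obviously as a Legendrian one; each of these steps therefore uses tangency on the
half space only.

Both the contact flow and the Moser flow come from `exists_smooth_flow_equiv`, which treats global
fields with Lipschitz constant below 1 by inverting a map on `C([0,1], E)`. Longer times are reached
by iteration in the first case and by a connectedness argument in the second. -/

/-- The pointwise application of a continuous family of operators to a continuous map. -/
noncomputable def ContinuousMap.pointwiseApply (E F : Type v) [NormedAddCommGroup E]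
    [NormedSpace ℝ E] [NormedAddCommGroup F] [NormedSpace ℝ F] :
    C(X, E →L[ℝ] F) →L[ℝ] C(X, E) →L[ℝ] C(X, F) :=
  LinearMap.mkContinuous₂
    (LinearMap.mk₂ ℝ (fun (A : C(X, E →L[ℝ] F)) (η : C(X, E)) =>
      (⟨fun x => A x (η x), A.continuous.clm_apply η.continuous⟩ : C(X, F)))
      (fun _ _ _ => by ext; simp) (fun _ _ _ => by ext; simp)
      (fun _ _ _ => by ext; simp) (fun _ _ _ => by ext; simp)) 1
    (fun A η => by
      rw [one_mul, ContinuousMap.norm_le _ (by positivity)]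
      intro x
      exact (ContinuousLinearMap.le_opNorm _ _).trans
        (mul_le_mul (A.norm_coe_le_norm x) (η.norm_coe_le_norm x) (norm_nonneg _) (norm_nonneg A)))

/-- Postcomposition with `V'` is continuous for the sup norm. For small `η` this bounds the
variation of `V'` on the segments from `γ x` to `γ x + η x` uniformly in `x`, and the mean value
inequality applies pointwise. -/
theorem ContinuousMap.hasFDerivAt_comp_left {E F : Type v} [NormedAddCommGroup E]
    [NormedSpace ℝ E] [NormedAddCommGroup F] [NormedSpace ℝ F] (V : C(E, F)) (V' : C(E, E →L[ℝ] F))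
    (hV : ∀ y, HasFDerivAt V (V' y) y) (γ : C(X, E)) :
    HasFDerivAt (fun γ : C(X, E) => V.comp γ)
      (ContinuousMap.pointwiseApply E F (V'.comp γ)) γ := by
  rw [hasFDerivAt_iff_isLittleO_nhds_zero, Asymptotics.isLittleO_iff]
  intro ε hε
  have hc : Continuous (fun γ : C(X, E) => V'.comp γ) := V'.continuous_postcomp
  have hcγ := hc.continuousAt (x := γ)
  obtain ⟨δ, hδ, h⟩ := (Metric.continuousAt_iff (α := C(X, E)) (β := C(X, E →L[ℝ] F))
    (f := fun γ => V'.comp γ)).1 hcγ ε hε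
  filter_upwards [Metric.ball_mem_nhds (0 : C(X, E)) hδ] with η hη
  rw [mem_ball_zero_iff] at hη
  rw [ContinuousMap.norm_le _ (by positivity)]
  intro x
  have hseg : ∀ y ∈ segment ℝ (γ x) (γ x + η x), ‖V' y - V' (γ x)‖ ≤ ε := by
    intro y hy
    rw [segment_eq_image'] at hy
    obtain ⟨s, hs, rfl⟩ := hy
    have h1 : dist (γ + s • η) γ < δ := by
      rw [dist_eq_norm, add_sub_cancel_left, norm_smul, Real.norm_of_nonneg hs.1]
      exact (mul_le_of_le_one_left (norm_nonneg _) hs.2).trans_lt hη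
    have h2 := (ContinuousMap.dist_apply_le_dist x).trans (h h1).le
    rw [dist_eq_norm] at h2
    simpa using h2
  have := (convex_segment (γ x) (γ x + η x)).norm_image_sub_le_of_norm_hasFDerivWithin_le'
    (f := V) (f' := V') (φ := V' (γ x)) (fun y _ => (hV y).hasFDerivWithinAt) hseg
    (left_mem_segment ℝ _ _) (right_mem_segment ℝ _ _)
  simp only [add_sub_cancel_left] at this
  exact this.trans (mul_le_mul_of_nonneg_left (η.norm_coe_le_norm x) hε.le)

/-- The derivative is again a superposition operator, that of `V'`, followed by a bounded linear
map, so induction on the order applies. The spaces are quantified inside the induction because `F`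
is replaced by `E →L[ℝ] F`. -/
theorem ContinuousMap.contDiff_comp_left_nat (m : ℕ) : ∀ {E F : Type v} [NormedAddCommGroup E]
    [NormedSpace ℝ E] [NormedAddCommGroup F] [NormedSpace ℝ F] (V : C(E, F)),
    ContDiff ℝ ∞ V → ContDiff ℝ m (fun γ : C(X, E) => V.comp γ) := by
  induction m with
  | zero =>
    intro E F _ _ _ _ V _
    exact contDiff_zero.2 V.continuous_postcomp
  | succ m ih =>
    intro E F _ _ _ _ V hV
    have hV' : ContDiff ℝ ∞ (fderiv ℝ V) := hV.fderiv_right (by simp)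
    let V' : C(E, E →L[ℝ] F) := ⟨fderiv ℝ V, hV'.continuous⟩
    refine contDiff_succ_iff_hasFDerivAt.2
      ⟨fun γ => ContinuousMap.pointwiseApply E F (V'.comp γ),
        (ContinuousLinearMap.contDiff _).comp (ih V' hV'), fun γ => ?_⟩
    exact ContinuousMap.hasFDerivAt_comp_left V V'
      (fun y => (hV.differentiable (by simp) y).hasFDerivAt) γ

theorem ContinuousMap.contDiff_comp_left {E F : Type v} [NormedAddCommGroup E]
    [NormedSpace ℝ E] [NormedAddCommGroup F] [NormedSpace ℝ F] (V : C(E, F))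
    (hV : ContDiff ℝ ∞ V) : ContDiff ℝ ∞ (fun γ : C(X, E) => V.comp γ) :=
  contDiff_infty.2 fun m => ContinuousMap.contDiff_comp_left_nat m V hV

end Superposition

/-! ### Smooth flows -/

section Flow

open Set Filter Topology unitInterval

open scoped NNReal

variable {E : Type*} [NormedAddCommGroup E] [NormedSpace ℝ E]

/-- The primitive vanishing at `0` of a continuous map on the unit interval. -/
noncomputable def unitInterval.primitive (E : Type*) [NormedAddCommGroup E] [NormedSpace ℝ E] :
    C(I, E) →L[ℝ] C(I, E) :=
  LinearMap.mkContinuous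
    { toFun := fun γ => ⟨fun s => ∫ r in (0 : ℝ)..s, IccExtend zero_le_one γ r, by
        have : Continuous fun s : ℝ => ∫ r in (0 : ℝ)..s, IccExtend zero_le_one γ r :=
          intervalIntegral.continuous_primitive
            (fun a b => (γ.continuous.Icc_extend' (h := zero_le_one)).intervalIntegrable a b) 0
        exact this.comp continuous_subtype_val⟩
      map_add' := fun γ η => by
        ext s
        exact intervalIntegral.integral_add
          (γ.continuous.Icc_extend' (h := zero_le_one) |>.intervalIntegrable _ _)
          (η.continuous.Icc_extend' (h := zero_le_one) |>.intervalIntegrable _ _)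
      map_smul' := fun c γ => by
        ext s
        exact intervalIntegral.integral_smul _ _ } 1
    (fun γ => by
      rw [one_mul, ContinuousMap.norm_le _ (norm_nonneg _)]
      intro s
      refine (intervalIntegral.norm_integral_le_of_norm_le_const (C := ‖γ‖)
        (fun r _ => γ.norm_coe_le_norm _)).trans ?_
      rw [sub_zero, abs_of_nonneg s.2.1]
      exact mul_le_of_le_one_right (norm_nonneg _) s.2.2)

theorem unitInterval.norm_primitive_le : ‖unitInterval.primitive E‖ ≤ 1 :=
  LinearMap.mkContinuous_norm_le _ zero_le_one _

/-- The primitive of a continuous map on `I`, as a differentiable function on the line. -/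
theorem unitInterval.hasDerivAt_integral [CompleteSpace E] (γ : C(I, E)) (s : I) :
    HasDerivAt (fun t : ℝ => ∫ r in (0 : ℝ)..t, IccExtend zero_le_one γ r) (γ s) s := by
  have h : Continuous (IccExtend zero_le_one γ) := γ.continuous.Icc_extend' (h := zero_le_one)
  have := intervalIntegral.integral_hasDerivAt_right (h.intervalIntegrable 0 s)
    (h.stronglyMeasurableAtFilter _ _) h.continuousAt
  rwa [IccExtend_val] at this

/-- The integral equation `γ - ∫ V ∘ γ = δ` is governed by a smooth self-map of `C(I, E)` that
differs from the identity by a map of Lipschitz constant `K < 1`. Such a map is a homeomorphism with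
invertible derivatives, so its inverse `G` is smooth. Evaluated on constant paths `δ`, it gives the
smooth dependence of integral curves on their starting point. -/
theorem exists_unitInterval_flow_inverse [CompleteSpace E] {V : E → E} (hV : ContDiff ℝ ∞ V) {K : ℝ≥0} (hK : K < 1)
    (hVK : LipschitzWith K V) :
    ∃ G : C(I, E) → C(I, E), ContDiff ℝ ∞ G ∧
      (∀ δ, G δ = δ + unitInterval.primitive E ((⟨V, hV.continuous⟩ : C(E, E)).comp (G δ))) := by
  let Vc : C(E, E) := ⟨V, hV.continuous⟩
  let V' : C(E, E →L[ℝ] E) := ⟨fderiv ℝ V, hV.continuous_fderiv (by simp)⟩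
  let J := unitInterval.primitive E
  let N : C(I, E) → C(I, E) := fun γ => Vc.comp γ
  have hN : ContDiff ℝ ∞ N := ContinuousMap.contDiff_comp_left Vc hV
  let Ψ : C(I, E) → C(I, E) := fun γ => γ - J (N γ)
  have hΨ : ContDiff ℝ ∞ Ψ := contDiff_id.sub (J.contDiff.comp hN)
  have hNd : ∀ γ, HasFDerivAt N (ContinuousMap.pointwiseApply E E (V'.comp γ)) γ := fun γ =>
    ContinuousMap.hasFDerivAt_comp_left Vc V'
      (fun y => (hV.differentiable (by simp) y).hasFDerivAt) γ
  have hNL : ∀ γ η, ‖N γ - N η‖ ≤ K * ‖γ - η‖ := by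
    intro γ η
    rw [ContinuousMap.norm_le _ (by positivity)]
    intro s
    refine (hVK.norm_sub_le (γ s) (η s)).trans ?_
    exact mul_le_mul_of_nonneg_left ((γ - η).norm_coe_le_norm s) K.2
  have happ : ApproximatesLinearOn Ψ
      ((ContinuousLinearEquiv.refl ℝ C(I, E) : C(I, E) ≃L[ℝ] C(I, E)) : C(I, E) →L[ℝ] C(I, E))
      univ K := by
    intro γ _ η _
    have : Ψ γ - Ψ η - (γ - η) = - J (N γ - N η) := by
      simp only [Ψ, map_sub]; abel
    simp only [ContinuousLinearEquiv.coe_refl, ContinuousLinearMap.coe_id', id]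
    rw [this, norm_neg]
    refine (J.le_of_opNorm_le unitInterval.norm_primitive_le _).trans ?_
    rw [one_mul]
    exact hNL γ η
  have hc : Subsingleton C(I, E) ∨
      K < ‖((ContinuousLinearEquiv.refl ℝ C(I, E)).symm : C(I, E) →L[ℝ] C(I, E))‖₊⁻¹ := by
    rcases subsingleton_or_nontrivial C(I, E) with h | h
    · exact Or.inl h
    · right
      have : ‖((ContinuousLinearEquiv.refl ℝ C(I, E)).symm : C(I, E) →L[ℝ] C(I, E))‖₊ = 1 := by
        ext
        simp
      rw [this, inv_one]
      exact hK
  let Ψh : C(I, E) ≃ₜ C(I, E) := happ.toHomeomorph Ψ hc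
  have hΨh : ∀ γ, Ψh γ = Ψ γ := fun γ => rfl
  have hder : ∀ γ, ∃ L : C(I, E) ≃L[ℝ] C(I, E), HasFDerivAt Ψh (L : C(I, E) →L[ℝ] C(I, E)) γ := by
    intro γ
    let T : C(I, E) →L[ℝ] C(I, E) := J ∘L ContinuousMap.pointwiseApply E E (V'.comp γ)
    have hT : ‖T‖ < 1 := by
      refine lt_of_le_of_lt ?_ (show (K : ℝ) < 1 by exact_mod_cast hK)
      refine ContinuousLinearMap.opNorm_le_bound _ K.2 fun η => ?_
      refine (J.le_of_opNorm_le unitInterval.norm_primitive_le _).trans ?_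
      rw [one_mul, ContinuousMap.norm_le _ (by positivity)]
      intro s
      refine (ContinuousLinearMap.le_of_opNorm_le _
        (norm_fderiv_le_of_lipschitz ℝ hVK) _).trans ?_
      exact mul_le_mul_of_nonneg_left (η.norm_coe_le_norm s) K.2
    -- The derivative is `1 - T` with `‖T‖ < 1`, invertible by the Neumann series.
    refine ⟨ContinuousLinearEquiv.unitsEquiv ℝ _ (Units.oneSub T hT), ?_⟩
    exact (hasFDerivAt_id γ).sub (J.hasFDerivAt.comp γ (hNd γ))
  choose L hL using hder
  refine ⟨Ψh.symm, Ψh.contDiff_symm hL hΨ, fun δ => ?_⟩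
  have h : Ψ (Ψh.symm δ) = δ := Ψh.apply_symm_apply δ
  exact sub_eq_iff_eq_add.1 h

/-- Time-one flows of smooth vector fields with a small Lipschitz constant depend smoothly on the
initial condition, and the derivative solves the variational equation. -/
theorem exists_smooth_flow [CompleteSpace E] {V : E → E} (hV : ContDiff ℝ ∞ V) {K : ℝ≥0} (hK : K < 1)
    (hVK : LipschitzWith K V) :
    ∃ Γ : E → ℝ → E, (∀ x, Γ x 0 = x) ∧
      (∀ x, ∀ s ∈ Icc (0 : ℝ) 1, HasDerivAt (Γ x) (V (Γ x s)) s) ∧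
      (∀ s ∈ Icc (0 : ℝ) 1, ContDiff ℝ ∞ fun x => Γ x s) ∧
      ∀ x v, ∀ s ∈ Icc (0 : ℝ) 1, HasDerivWithinAt (fun r => fderiv ℝ (fun x => Γ x r) x v)
        (fderiv ℝ V (Γ x s) (fderiv ℝ (fun x => Γ x s) x v)) (Icc 0 1) s := by
  obtain ⟨G, hG, hGeq⟩ := exists_unitInterval_flow_inverse hV hK hVK
  let Vc : C(E, E) := ⟨V, hV.continuous⟩
  let V' : C(E, E →L[ℝ] E) := ⟨fderiv ℝ V, hV.continuous_fderiv (by simp)⟩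
  let cst : E →L[ℝ] C(I, E) := LinearMap.mkContinuous
    { toFun := fun x => ContinuousMap.const I x
      map_add' := fun _ _ => rfl
      map_smul' := fun _ _ => rfl } 1
    (fun x => by
      rw [one_mul, ContinuousMap.norm_le _ (norm_nonneg _)]
      intro s; exact le_rfl)
  have hcst : ∀ x s, cst x s = x := fun _ _ => rfl
  let g : E → C(I, E) := fun x => G (cst x)
  have hg : ContDiff ℝ ∞ g := hG.comp cst.contDiff
  -- The integrand is extended by constants outside `[0, 1]`, so that `Γ x` has two-sided
  -- derivatives at the end points too.
  let Γ : E → ℝ → E := fun x s => x + ∫ r in (0 : ℝ)..s, IccExtend zero_le_one (Vc.comp (g x)) r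
  have hΓ : ∀ x (s : I), Γ x s = g x s := by
    intro x s
    have := congrArg (fun γ : C(I, E) => γ s) (hGeq (cst x))
    exact this.symm
  have hsm : ∀ s (hs : s ∈ Icc (0 : ℝ) 1), (fun x => Γ x s) = fun x =>
      ContinuousMap.evalCLM ℝ (⟨s, hs⟩ : I) (g x) := by
    intro s hs
    ext x
    exact hΓ x ⟨s, hs⟩
  have hfd : ∀ s (hs : s ∈ Icc (0 : ℝ) 1) x v, fderiv ℝ (fun x => Γ x s) x v =
      fderiv ℝ g x v ⟨s, hs⟩ := by
    intro s hs x v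
    rw [hsm s hs]
    have := ((ContinuousMap.evalCLM ℝ (⟨s, hs⟩ : I)).hasFDerivAt.comp x
      ((hg.differentiable (by simp) x).hasFDerivAt)).fderiv
    exact congrArg (fun L : E →L[ℝ] E => L v) this
  refine ⟨Γ, fun x => by simp [Γ], fun x s hs => ?_, fun s hs => ?_, fun x v s hs => ?_⟩
  · have h := (unitInterval.hasDerivAt_integral (Vc.comp (g x)) ⟨s, hs⟩).const_add x
    have h2 : V (Γ x s) = Vc.comp (g x) ⟨s, hs⟩ := congrArg V (hΓ x ⟨s, hs⟩)
    rw [h2]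
    exact h
  · rw [hsm s hs]
    exact (ContinuousLinearMap.contDiff _).comp hg
  · let A : C(I, E) := ContinuousMap.pointwiseApply E E (V'.comp (g x)) (fderiv ℝ g x v)
    -- Differentiating the fixed point equation in `x` gives the variational equation in integral
    -- form.
    have hdg : fderiv ℝ g x v = cst v + unitInterval.primitive E A := by
      have h1 : HasFDerivAt g (cst + unitInterval.primitive E ∘L
          (ContinuousMap.pointwiseApply E E (V'.comp (g x)) ∘L fderiv ℝ g x)) x := by
        have hgx := (hg.differentiable (by simp) x).hasFDerivAt
        have h2 := (ContinuousMap.hasFDerivAt_comp_left Vc V'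
          (fun y => (hV.differentiable (by simp) y).hasFDerivAt) (g x)).comp x hgx
        have h3 := cst.hasFDerivAt.add ((unitInterval.primitive E).hasFDerivAt.comp x h2)
        refine h3.congr_of_eventuallyEq (Eventually.of_forall fun y => ?_)
        exact hGeq (cst y)
      rw [h1.fderiv]
      rfl
    have h := ((unitInterval.hasDerivAt_integral A ⟨s, hs⟩).const_add v).hasDerivWithinAt
      (s := Icc 0 1)
    have h2 : fderiv ℝ V (Γ x s) (fderiv ℝ (fun x => Γ x s) x v) = A ⟨s, hs⟩ := by
      rw [hfd s hs]
      change _ = fderiv ℝ V (g x ⟨s, hs⟩) _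
      rw [← hΓ]
    rw [h2]
    have hval : ∀ r ∈ Icc (0 : ℝ) 1, fderiv ℝ (fun x => Γ x r) x v =
        v + ∫ r in (0 : ℝ)..r, IccExtend zero_le_one A r := by
      intro r hr
      rw [hfd r hr, hdg]
      rfl
    exact h.congr hval (hval s hs)

/-- Uniqueness of integral curves of a Lipschitz vector field. -/
theorem integralCurve_unique {V : E → E} {K : ℝ≥0} (hVK : LipschitzWith K V) {c d : ℝ → E}
    (hc : ∀ s ∈ Icc (0 : ℝ) 1, HasDerivAt c (V (c s)) s)
    (hd : ∀ s ∈ Icc (0 : ℝ) 1, HasDerivAt d (V (d s)) s) (h0 : c 0 = d 0) :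
    ∀ s ∈ Icc (0 : ℝ) 1, c s = d s := by
  refine ODE_solution_unique (v := fun _ => V) (K := K) (fun _ => hVK)
    (fun s hs => (hc s hs).continuousAt.continuousWithinAt)
    (fun s hs => (hc s (Ico_subset_Icc_self hs)).hasDerivWithinAt)
    (fun s hs => (hd s hs).continuousAt.continuousWithinAt)
    (fun s hs => (hd s (Ico_subset_Icc_self hs)).hasDerivWithinAt) h0

/-- The time-one map of the flow of a smooth vector field with a small Lipschitz constant is a
diffeomorphism. -/
theorem exists_smooth_flow_equiv [CompleteSpace E] {V : E → E} (hV : ContDiff ℝ ∞ V) {K : ℝ≥0} (hK : K < 1)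
    (hVK : LipschitzWith K V) :
    ∃ (Γ : E → ℝ → E) (φ : E ≃ E), (∀ x, Γ x 0 = x) ∧ (∀ x, Γ x 1 = φ x) ∧
      (∀ x, ∀ s ∈ Icc (0 : ℝ) 1, HasDerivAt (Γ x) (V (Γ x s)) s) ∧
      (∀ s ∈ Icc (0 : ℝ) 1, ContDiff ℝ ∞ fun x => Γ x s) ∧
      (∀ x v, ∀ s ∈ Icc (0 : ℝ) 1, HasDerivWithinAt (fun r => fderiv ℝ (fun x => Γ x r) x v)
        (fderiv ℝ V (Γ x s) (fderiv ℝ (fun x => Γ x s) x v)) (Icc 0 1) s) ∧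
      ContDiff ℝ ∞ φ ∧ ContDiff ℝ ∞ φ.symm := by
  obtain ⟨Γ, h0, h1, h2, h3⟩ := exists_smooth_flow hV hK hVK
  have hVK' : LipschitzWith K fun x => - V x := hVK.neg
  obtain ⟨Δ, k0, k1, k2, k3⟩ := exists_smooth_flow hV.neg hK hVK'
  have hone : (1 : ℝ) ∈ Icc (0 : ℝ) 1 := ⟨zero_le_one, le_rfl⟩
  have hrev : ∀ s ∈ Icc (0 : ℝ) 1, (1 - s) ∈ Icc (0 : ℝ) 1 := fun s hs =>
    ⟨by linarith [hs.2], by linarith [hs.1]⟩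
  -- Reversing time turns integral curves of `V` into integral curves of `-V`; by uniqueness the two
  -- time-one maps are mutually inverse.
  have hl : ∀ x, Δ (Γ x 1) 1 = x := by
    intro x
    have := integralCurve_unique hVK' (c := Δ (Γ x 1)) (d := fun s => Γ x (1 - s))
      (k1 _) (fun s hs => by
        have := (h1 x (1 - s) (hrev s hs)).scomp s ((hasDerivAt_id s).const_sub 1)
        simpa [Function.comp_def] using this) (by simp [k0]) 1 hone
    simpa [h0] using this
  have hr : ∀ x, Γ (Δ x 1) 1 = x := by
    intro x
    have := integralCurve_unique hVK (c := Γ (Δ x 1)) (d := fun s => Δ x (1 - s))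
      (h1 _) (fun s hs => by
        have := (k1 x (1 - s) (hrev s hs)).scomp s ((hasDerivAt_id s).const_sub 1)
        simpa [Function.comp_def] using this) (by simp [h0]) 1 hone
    simpa [k0] using this
  exact ⟨Γ, ⟨fun x => Γ x 1, fun x => Δ x 1, hl, hr⟩, h0, fun _ => rfl, h1, h2, h3,
    h2 1 hone, k2 1 hone⟩

/-- A solution of `g' = μ g` is multiplied by a positive factor that depends only on `μ`. -/
theorem exists_pos_factor_of_hasDerivWithinAt {μ : ℝ → ℝ} (hμ : ContinuousOn μ (Icc 0 1)) :
    ∃ c : ℝ, 0 < c ∧ ∀ g : ℝ → ℝ,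
      (∀ s ∈ Icc (0 : ℝ) 1, HasDerivWithinAt g (μ s * g s) (Icc 0 1) s) → g 1 = c * g 0 := by
  let m : C(I, ℝ) := ⟨fun s => μ s, continuousOn_iff_continuous_domRestrict.1 hμ⟩
  let M : ℝ → ℝ := fun t => ∫ r in (0 : ℝ)..t, IccExtend zero_le_one m r
  have hM : ∀ s ∈ Icc (0 : ℝ) 1, HasDerivAt M (μ s) s := fun s hs =>
    unitInterval.hasDerivAt_integral m ⟨s, hs⟩
  refine ⟨Real.exp (M 1), Real.exp_pos _, fun g hg => ?_⟩
  -- Integrating factor: `exp (-∫ μ) g` is constant.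
  have hder : ∀ s ∈ Icc (0 : ℝ) 1,
      HasDerivWithinAt (fun s => Real.exp (-M s) * g s) 0 (Icc 0 1) s := by
    intro s hs
    have h := ((hM s hs).neg.exp.hasDerivWithinAt (s := Icc 0 1)).mul (hg s hs)
    have h0 : Real.exp ((-M) s) * -μ s * g s + Real.exp ((-M) s) * (μ s * g s) = 0 := by ring
    rw [h0] at h
    exact h
  have := constant_of_derivWithin_zero (f := fun s => Real.exp (-M s) * g s) (a := 0) (b := 1)
    (fun s hs => (hder s hs).differentiableWithinAt)
    (fun s hs => (hder s (Ico_subset_Icc_self hs)).derivWithin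
      ((uniqueDiffOn_Icc zero_lt_one) s (Ico_subset_Icc_self hs))) 1 ⟨zero_le_one, le_rfl⟩
  have hM0 : M 0 = 0 := by simp [M]
  simp only [hM0, neg_zero, Real.exp_zero, one_mul] at this
  rw [← this, ← mul_assoc, ← Real.exp_add]
  simp

end Flow

/-! ### Contact equivalences -/

section ContactEquiv

variable {E F G : Type*} [NormedAddCommGroup E] [NormedSpace ℝ E] [NormedAddCommGroup F]
  [NormedSpace ℝ F] [NormedAddCommGroup G] [NormedSpace ℝ G]

/-- A diffeomorphism between vector spaces that matches two `1`-forms up to a nowhere vanishing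
conformal factor. -/
structure IsContactEquiv (α : E → E →L[ℝ] ℝ) (β : F → F →L[ℝ] ℝ) (φ : E ≃ F) : Prop where
  contDiff : ContDiff ℝ ∞ φ
  contDiff_symm : ContDiff ℝ ∞ φ.symm
  conformal : ∀ x, ∃ c : ℝ, c ≠ 0 ∧ ∀ v, β (φ x) (fderiv ℝ φ x v) = c * α x v

theorem IsContactEquiv.trans {α : E → E →L[ℝ] ℝ} {β : F → F →L[ℝ] ℝ} {δ : G → G →L[ℝ] ℝ}
    {φ : E ≃ F} {ψ : F ≃ G} (hφ : IsContactEquiv α β φ) (hψ : IsContactEquiv β δ ψ) :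
    IsContactEquiv α δ (φ.trans ψ) where
  contDiff := hψ.contDiff.comp hφ.contDiff
  contDiff_symm := hφ.contDiff_symm.comp hψ.contDiff_symm
  conformal x := by
    obtain ⟨c, hc, h⟩ := hφ.conformal x
    obtain ⟨d, hd, k⟩ := hψ.conformal (φ x)
    refine ⟨d * c, mul_ne_zero hd hc, fun v => ?_⟩
    have : fderiv ℝ (φ.trans ψ) x = (fderiv ℝ ψ (φ x)).comp (fderiv ℝ φ x) :=
      fderiv_comp x (hψ.contDiff.differentiable (by simp) _) (hφ.contDiff.differentiable (by simp) _)
    rw [this, mul_assoc, ← h]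
    exact k _

theorem IsContactEquiv.pow {α : E → E →L[ℝ] ℝ} {φ : Equiv.Perm E} (hφ : IsContactEquiv α α φ)
    (k : ℕ) : IsContactEquiv α α (φ ^ k : Equiv.Perm E) := by
  induction k with
  | zero => exact ⟨contDiff_id, contDiff_id, fun x => ⟨1, one_ne_zero, fun v => by
      change α x (fderiv ℝ id x v) = _; simp⟩⟩
  | succ k ih =>
    rw [pow_succ]
    exact hφ.trans ih

end ContactEquiv

/-! ### Contact Hamiltonian flows in dimension three -/

section ContactField

open Set

open scoped NNReal

/-- The form `dz - p dq` on `ℝ³`. -/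
noncomputable def stdForm3 (x : ℝ × ℝ × ℝ) : ℝ × ℝ × ℝ →L[ℝ] ℝ :=
  (ContinuousLinearMap.snd ℝ ℝ ℝ).comp (ContinuousLinearMap.snd ℝ ℝ (ℝ × ℝ)) -
    x.2.1 • ContinuousLinearMap.fst ℝ ℝ (ℝ × ℝ)

theorem stdForm3_apply (x v : ℝ × ℝ × ℝ) : stdForm3 x v = v.2.2 - x.2.1 * v.1 := by
  simp [stdForm3]

/-- The contact vector field of the contact Hamiltonian `h`. -/
noncomputable def contactField (h : ℝ × ℝ × ℝ → ℝ) (x : ℝ × ℝ × ℝ) : ℝ × ℝ × ℝ :=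
  (-fderiv ℝ h x (0, 1, 0), fderiv ℝ h x (1, 0, 0) + x.2.1 * fderiv ℝ h x (0, 0, 1),
    h x - x.2.1 * fderiv ℝ h x (0, 1, 0))

theorem contDiff_fderiv_apply_const {E F : Type*} [NormedAddCommGroup E] [NormedSpace ℝ E]
    [NormedAddCommGroup F] [NormedSpace ℝ F] {h : E → F} (hh : ContDiff ℝ ∞ h) (v : E) :
    ContDiff ℝ ∞ fun x => fderiv ℝ h x v :=
  (hh.fderiv_right (by simp)).clm_apply contDiff_const

theorem contDiff_contactField {h : ℝ × ℝ × ℝ → ℝ} (hh : ContDiff ℝ ∞ h) :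
    ContDiff ℝ ∞ (contactField h) := by
  have hp : ContDiff ℝ ∞ fun x : ℝ × ℝ × ℝ => x.2.1 := contDiff_fst.comp contDiff_snd
  have hd := contDiff_fderiv_apply_const hh
  exact (hd _).neg.prodMk (((hd _).add (hp.mul (hd _))).prodMk (hh.sub (hp.mul (hd _))))

theorem contactField_const_mul {h : ℝ × ℝ × ℝ → ℝ} (hh : ContDiff ℝ ∞ h) (c : ℝ) :
    contactField (fun x => c * h x) = fun x => c • contactField h x := by
  ext x : 1
  have : fderiv ℝ (fun x => c * h x) x = c • fderiv ℝ h x :=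
    fderiv_const_mul (hh.differentiable (by simp) x) c
  simp only [contactField, this, _root_.smul_apply, smul_eq_mul, Prod.smul_mk]
  ext <;> simp <;> ring

/-- This is the infinitesimal contact condition: the Lie derivative of `dz - p dq` along the contact
field of `h` is `∂h/∂z` times the form. Integrated along the flow, it makes the time-one map
conformal. -/
theorem stdForm3_fderiv_contactField {h : ℝ × ℝ × ℝ → ℝ} (hh : ContDiff ℝ ∞ h)
    (x w : ℝ × ℝ × ℝ) :
    stdForm3 x (fderiv ℝ (contactField h) x w) - (contactField h x).2.1 * w.1 =
      fderiv ℝ h x (0, 0, 1) * stdForm3 x w := by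
  have hd : ∀ v, HasFDerivAt (fun x => fderiv ℝ h x v) (fderiv ℝ (fun x => fderiv ℝ h x v) x) x :=
    fun v => ((contDiff_fderiv_apply_const hh v).differentiable (by simp) x).hasFDerivAt
  have hp : HasFDerivAt (fun x : ℝ × ℝ × ℝ => x.2.1) ((ContinuousLinearMap.fst ℝ ℝ ℝ).comp
      (ContinuousLinearMap.snd ℝ ℝ (ℝ × ℝ))) x :=
    ContinuousLinearMap.hasFDerivAt ((ContinuousLinearMap.fst ℝ ℝ ℝ).comp
      (ContinuousLinearMap.snd ℝ ℝ (ℝ × ℝ)))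
  have h0 : HasFDerivAt h (fderiv ℝ h x) x := (hh.differentiable (by simp) x).hasFDerivAt
  have hV : HasFDerivAt (contactField h) _ x :=
    (hd (0, 1, 0)).neg.prodMk (((hd (1, 0, 0)).add (hp.mul (hd (0, 0, 1)))).prodMk
      (h0.sub (hp.mul (hd (0, 1, 0)))))
  have hw : w = w.1 • ((1 : ℝ), (0 : ℝ), (0 : ℝ)) + w.2.1 • ((0 : ℝ), (1 : ℝ), (0 : ℝ)) +
      w.2.2 • ((0 : ℝ), (0 : ℝ), (1 : ℝ)) := by ext <;> simp
  have hhw : fderiv ℝ h x w = w.1 * fderiv ℝ h x (1, 0, 0) + w.2.1 * fderiv ℝ h x (0, 1, 0) +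
      w.2.2 * fderiv ℝ h x (0, 0, 1) := by
    conv_lhs => rw [hw]
    simp only [map_add, map_smul, smul_eq_mul]
  rw [hV.fderiv]
  simp only [stdForm3_apply, contactField, ContinuousLinearMap.prod_apply,
    _root_.sub_apply, _root_.add_apply, _root_.neg_apply,
    _root_.smul_apply, smul_eq_mul, ContinuousLinearMap.comp_apply,
    ContinuousLinearMap.coe_fst', ContinuousLinearMap.coe_snd', hhw]
  ring

/-- The time-one map of a contact vector field with a small Lipschitz constant. -/
theorem exists_contactEquiv_of_contactField {h : ℝ × ℝ × ℝ → ℝ} (hh : ContDiff ℝ ∞ h) {K : ℝ≥0}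
    (hK : K < 1) (hVK : LipschitzWith K (contactField h)) :
    ∃ φ : Equiv.Perm (ℝ × ℝ × ℝ), IsContactEquiv stdForm3 stdForm3 φ ∧
      ∀ c : ℝ → ℝ × ℝ × ℝ, (∀ s ∈ Icc (0 : ℝ) 1, HasDerivAt c (contactField h (c s)) s) →
        φ (c 0) = c 1 := by
  obtain ⟨Γ, φ, h0, h1, hΓ, -, hvar, hφ, hφs⟩ :=
    exists_smooth_flow_equiv (contDiff_contactField hh) hK hVK
  have hone : (1 : ℝ) ∈ Icc (0 : ℝ) 1 := ⟨zero_le_one, le_rfl⟩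
  refine ⟨φ, ⟨hφ, hφs, fun x => ?_⟩, fun c hc => ?_⟩
  · have hμ : ContinuousOn (fun s => fderiv ℝ h (Γ x s) (0, 0, 1)) (Icc 0 1) :=
      (contDiff_fderiv_apply_const hh (0, 0, 1)).continuous.comp_continuousOn
        fun s hs => (hΓ x s hs).continuousAt.continuousWithinAt
    -- The form evaluated on a vector transported by the flow solves `g' = (∂h/∂z) g`; the resulting
    -- factor `c` does not depend on the vector.
    obtain ⟨c, hc, hg⟩ := exists_pos_factor_of_hasDerivWithinAt hμ
    refine ⟨c, hc.ne', fun v => ?_⟩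
    have := hg (fun s => stdForm3 (Γ x s) (fderiv ℝ (fun y => Γ y s) x v)) fun s hs => by
      have e1 : HasDerivWithinAt (Γ x) (contactField h (Γ x s)) (Icc 0 1) s :=
        (hΓ x s hs).hasDerivWithinAt
      have e2 := hvar x v s hs
      have hq : ∀ {c : ℝ → ℝ × ℝ × ℝ} {c'}, HasDerivWithinAt c c' (Icc 0 1) s →
          HasDerivWithinAt (fun r => (c r).1) c'.1 (Icc 0 1) s := fun h =>
        (ContinuousLinearMap.fst ℝ ℝ (ℝ × ℝ)).hasFDerivAt.comp_hasDerivWithinAt s h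
      have hp : ∀ {c : ℝ → ℝ × ℝ × ℝ} {c'}, HasDerivWithinAt c c' (Icc 0 1) s →
          HasDerivWithinAt (fun r => (c r).2.1) c'.2.1 (Icc 0 1) s := fun h =>
        ((ContinuousLinearMap.fst ℝ ℝ ℝ).comp
          (ContinuousLinearMap.snd ℝ ℝ (ℝ × ℝ))).hasFDerivAt.comp_hasDerivWithinAt s h
      have hz : ∀ {c : ℝ → ℝ × ℝ × ℝ} {c'}, HasDerivWithinAt c c' (Icc 0 1) s →
          HasDerivWithinAt (fun r => (c r).2.2) c'.2.2 (Icc 0 1) s := fun h =>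
        ((ContinuousLinearMap.snd ℝ ℝ ℝ).comp
          (ContinuousLinearMap.snd ℝ ℝ (ℝ × ℝ))).hasFDerivAt.comp_hasDerivWithinAt s h
      have e3 := (hz e2).sub ((hp e1).mul (hq e2))
      simp only [stdForm3_apply]
      refine e3.congr_deriv ?_
      have := stdForm3_fderiv_contactField hh (Γ x s) (fderiv ℝ (fun y => Γ y s) x v)
      simp only [stdForm3_apply] at this
      linarith
    have e0 : (fun y => Γ y 0) = id := funext h0
    have e1 : (fun y => Γ y 1) = φ := funext h1
    simpa [e0, e1, h0, h1] using this
  · have := integralCurve_unique hVK (hΓ (c 0)) hc (h0 _) 1 hone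
    rw [← h1, this]

end ContactField

/-! ### Pushing the end of the zig-zag along itself -/

section Zigzag

open Set

open scoped NNReal

/-- The zig-zag in coordinates that are rescaled so as to clear denominators. -/
noncomputable def zigzagCurve (t : ℝ) : ℝ × ℝ × ℝ :=
  (t ^ 3 - 3 * t, t ^ 2 - 1, 3 * t ^ 5 / 5 - 2 * t ^ 3 + 3 * t)

/-- A polynomial function on `ℝ³` that restricts to the parameter on the zig-zag. -/
noncomputable def zigzagParam (x : ℝ × ℝ × ℝ) : ℝ :=
  5 / 12 * (x.2.2 - (3 / 5 * x.2.1 + 2 / 5) * x.1)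

/-- A contact Hamiltonian whose contact vector field is the negative velocity along the zig-zag. -/
noncomputable def zigzagHamiltonian (x : ℝ × ℝ × ℝ) : ℝ :=
  3 * x.2.1 * zigzagParam x ^ 2 - 3 * x.2.1 - zigzagParam x ^ 4 - 3 - 2 * zigzagParam x * x.1

theorem zigzagParam_zigzagCurve (t : ℝ) : zigzagParam (zigzagCurve t) = t := by
  simp only [zigzagParam, zigzagCurve]; ring

theorem zigzagHamiltonian_zigzagCurve (t : ℝ) : zigzagHamiltonian (zigzagCurve t) = 0 := by
  rw [zigzagHamiltonian, zigzagParam_zigzagCurve]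
  simp only [zigzagCurve]
  ring

theorem contDiff_zigzagParam : ContDiff ℝ ∞ zigzagParam := by
  unfold zigzagParam; fun_prop

theorem contDiff_zigzagHamiltonian : ContDiff ℝ ∞ zigzagHamiltonian := by
  have := contDiff_zigzagParam
  unfold zigzagHamiltonian; fun_prop

theorem hasDerivAt_zigzagCurve (t : ℝ) :
    HasDerivAt zigzagCurve (3 * (t ^ 2 - 1), 2 * t, 3 * (t ^ 2 - 1) ^ 2) t := by
  have h1 : HasDerivAt (fun t : ℝ => t ^ 3 - 3 * t) (3 * (t ^ 2 - 1)) t := by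
    refine (((hasDerivAt_id t).pow 3).sub ((hasDerivAt_id t).const_mul 3)).congr_deriv ?_
    simp; ring
  have h2 : HasDerivAt (fun t : ℝ => t ^ 2 - 1) (2 * t) t := by
    refine (((hasDerivAt_id t).pow 2).sub_const 1).congr_deriv ?_
    simp
  have h3 : HasDerivAt (fun t : ℝ => 3 * t ^ 5 / 5 - 2 * t ^ 3 + 3 * t) (3 * (t ^ 2 - 1) ^ 2) t := by
    refine ((((((hasDerivAt_id t).pow 5).const_mul 3).div_const 5).sub
      (((hasDerivAt_id t).pow 3).const_mul 2)).add ((hasDerivAt_id t).const_mul 3)).congr_deriv ?_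
    simp; ring
  exact h1.prodMk (h2.prodMk h3)

theorem contDiff_zigzagCurve : ContDiff ℝ ∞ zigzagCurve := by
  unfold zigzagCurve; fun_prop

/-- With `τ` for `zigzagParam`, and `q(τ)`, `p(τ)` the coordinates of the curve at parameter `τ`,
the Hamiltonian equals `3(τ² - 1)(p - p(τ)) - 2τ(q - q(τ))`. On the curve both brackets vanish. So
does the derivative in `τ`, because `q' = 3(τ² - 1)` and `p' = 2τ`. Only the explicit partial
derivatives `∂/∂p = 3(t² - 1)` and `∂/∂q = -2t` survive there, and they give minus the velocity. -/
theorem contactField_zigzagHamiltonian (t : ℝ) :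
    contactField zigzagHamiltonian (zigzagCurve t) =
      -(3 * (t ^ 2 - 1), 2 * t, 3 * (t ^ 2 - 1) ^ 2) := by
  set x := zigzagCurve t with hx
  have hq : HasFDerivAt (fun x : ℝ × ℝ × ℝ => x.1) (ContinuousLinearMap.fst ℝ ℝ (ℝ × ℝ)) x :=
    ContinuousLinearMap.hasFDerivAt (ContinuousLinearMap.fst ℝ ℝ (ℝ × ℝ))
  have hp : HasFDerivAt (fun x : ℝ × ℝ × ℝ => x.2.1) ((ContinuousLinearMap.fst ℝ ℝ ℝ).comp
      (ContinuousLinearMap.snd ℝ ℝ (ℝ × ℝ))) x :=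
    ContinuousLinearMap.hasFDerivAt ((ContinuousLinearMap.fst ℝ ℝ ℝ).comp
      (ContinuousLinearMap.snd ℝ ℝ (ℝ × ℝ)))
  have hz : HasFDerivAt (fun x : ℝ × ℝ × ℝ => x.2.2) ((ContinuousLinearMap.snd ℝ ℝ ℝ).comp
      (ContinuousLinearMap.snd ℝ ℝ (ℝ × ℝ))) x :=
    ContinuousLinearMap.hasFDerivAt ((ContinuousLinearMap.snd ℝ ℝ ℝ).comp
      (ContinuousLinearMap.snd ℝ ℝ (ℝ × ℝ)))
  have hτ : HasFDerivAt zigzagParam _ x :=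
    (hz.sub (((hp.const_mul (3 / 5)).add_const (2 / 5)).mul hq)).const_mul (5 / 12)
  have hh : HasFDerivAt zigzagHamiltonian _ x :=
    (((((hp.const_mul 3).mul (hτ.pow 2)).sub (hp.const_mul 3)).sub (hτ.pow 4)).sub_const 3).sub
      ((hτ.const_mul 2).mul hq)
  have hτx : zigzagParam x = t := zigzagParam_zigzagCurve t
  have h0 : zigzagHamiltonian x = 0 := zigzagHamiltonian_zigzagCurve t
  have e1 : x.1 = t ^ 3 - 3 * t := rfl
  have e2 : x.2.1 = t ^ 2 - 1 := rfl
  simp only [contactField, hh.fderiv, h0, hτx, e1, e2,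
    ContinuousLinearMap.comp_apply, _root_.sub_apply, _root_.add_apply, _root_.smul_apply,
    smul_eq_mul, ContinuousLinearMap.coe_fst', ContinuousLinearMap.coe_snd']
  simp only [Prod.neg_mk, Prod.mk.injEq]
  refine ⟨by simp; ring, by simp; ring, by simp; ring⟩

/-- There is a contact equivalence of `ℝ³` that preserves the zig-zag and moves the points with
parameter at most `3` to the points with parameter at most `-2`, where there is no cusp. -/
theorem exists_contactEquiv_zigzagCurve :
    ∃ Φ : Equiv.Perm (ℝ × ℝ × ℝ), IsContactEquiv stdForm3 stdForm3 Φ ∧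
      Φ (zigzagCurve 3) = zigzagCurve (-2) ∧
      ∀ x, (∃ t ≤ -2, Φ x = zigzagCurve t) ↔ ∃ t ≤ 3, x = zigzagCurve t := by
  -- For `|t| ≤ 5` the coordinates of the curve are at most 2140 in absolute value, so the cut-off
  -- equals 1 there.
  let χ : ContDiffBump (0 : ℝ × ℝ × ℝ) := ⟨3000, 3001, by norm_num, by norm_num⟩
  let h : ℝ × ℝ × ℝ → ℝ := fun x => χ x * zigzagHamiltonian x
  have hχ : ContDiff ℝ ∞ χ := χ.contDiff
  have hh : ContDiff ℝ ∞ h := hχ.mul contDiff_zigzagHamiltonian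
  have hhγ : ∀ t, contactField h (zigzagCurve t) =
      (-χ (zigzagCurve t)) • (3 * (t ^ 2 - 1), 2 * t, 3 * (t ^ 2 - 1) ^ 2) := by
    intro t
    -- The Hamiltonian vanishes on the curve, so the derivative of the cut-off does not contribute
    -- and the cut-off field remains tangent to the curve.
    have hd : fderiv ℝ h (zigzagCurve t) = χ (zigzagCurve t) •
        fderiv ℝ zigzagHamiltonian (zigzagCurve t) := by
      have := fderiv_mul (hχ.differentiable (by simp) (zigzagCurve t))
        (contDiff_zigzagHamiltonian.differentiable (by simp) (zigzagCurve t))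
      rw [zigzagHamiltonian_zigzagCurve, zero_smul, add_zero] at this
      exact this
    have h2 : contactField h (zigzagCurve t) =
        χ (zigzagCurve t) • contactField zigzagHamiltonian (zigzagCurve t) := by
      simp only [contactField, hd, h, zigzagHamiltonian_zigzagCurve, _root_.smul_apply, smul_eq_mul,
        Prod.smul_mk]
      refine Prod.ext ?_ (Prod.ext ?_ ?_) <;> simp <;> ring
    rw [h2, contactField_zigzagHamiltonian, smul_neg, neg_smul]
  let b : ℝ → ℝ := fun t => -χ (zigzagCurve t)
  have hb : ContDiff ℝ ∞ b := (hχ.comp contDiff_zigzagCurve).neg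
  have hbc : HasCompactSupport b := by
    refine HasCompactSupport.intro (isCompact_Icc (a := (-60 : ℝ)) (b := 60)) fun t ht => ?_
    have : χ (zigzagCurve t) = 0 := by
      refine χ.zero_of_le_dist ?_
      rw [dist_zero_right]
      have h1 : |t ^ 2 - 1| ≤ ‖zigzagCurve t‖ :=
        (norm_fst_le (zigzagCurve t).2).trans (norm_snd_le (zigzagCurve t))
      have h2 : 3001 ≤ t ^ 2 - 1 := by
        rw [mem_Icc, not_and_or, not_le, not_le] at ht
        rcases ht with ht | ht <;> nlinarith
      exact (h2.trans (le_abs_self _)).trans h1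
    simp [b, this]
  have hbone : ∀ t, |t| ≤ 5 → b t = -1 := by
    intro t ht
    have : χ (zigzagCurve t) = 1 := by
      refine χ.one_of_mem_closedBall ?_
      rw [mem_closedBall_zero_iff]
      have h1 : |t| ^ 2 ≤ 5 ^ 2 := by gcongr
      have h2 : |t| ^ 3 ≤ 5 ^ 3 := by gcongr
      have h3 : |t| ^ 5 ≤ 5 ^ 5 := by gcongr
      rw [← abs_pow] at h1 h2 h3
      rw [abs_le] at h1 h2 h3 ht
      have hn : ∀ a : ℝ, |a| ≤ 3000 → ‖a‖ ≤ 3000 := fun a h => h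
      refine norm_prod_le_iff.2 ⟨hn _ (abs_le.2 ?_), norm_prod_le_iff.2
        ⟨hn _ (abs_le.2 ?_), hn _ (abs_le.2 ?_)⟩⟩
      · constructor <;> simp only [zigzagCurve] <;> linarith
      · constructor <;> simp only [zigzagCurve] <;> linarith
      · constructor <;> simp only [zigzagCurve] <;> linarith
    simp [b, this]
  obtain ⟨K₁, hK₁⟩ : ∃ K : ℝ≥0, LipschitzWith K (contactField h) := by
    refine ContDiff.lipschitzWith_of_hasCompactSupport ?_ (contDiff_contactField hh)
      (n := ∞) (by simp)
    have h1 : HasCompactSupport h := χ.hasCompactSupport.mul_right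
    refine HasCompactSupport.intro' h1.isCompact (isClosed_tsupport h) fun x hx => ?_
    have e1 : h x = 0 := image_eq_zero_of_notMem_tsupport hx
    have e2 : fderiv ℝ h x = 0 :=
      image_eq_zero_of_notMem_tsupport (fun hx' => hx (tsupport_fderiv_subset ℝ hx'))
    simp [contactField, e1, e2]
  obtain ⟨K₂, hK₂⟩ : ∃ K : ℝ≥0, LipschitzWith K b :=
    ContDiff.lipschitzWith_of_hasCompactSupport hbc hb (n := ∞) (by simp)
  -- The total time 5, the distance from `3` to `-2`, is split into `N` steps of length `ε = 5 / N`.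
  -- The bound makes the Lipschitz constants of both rescaled fields less than 1; the summand `1`
  -- gives `ε < 1`, so a step starting in `[-4, 4]` stays in `[-5, 5]`, where the parameter has
  -- speed `-1`.
  obtain ⟨N, hN⟩ := exists_nat_gt (5 * (K₁ + K₂ + 1))
  have hN0 : 0 < N := by
    rcases Nat.eq_zero_or_pos N with h0 | h0
    · simp [h0] at hN
    · exact h0
  have hNr : (0 : ℝ≥0) < N := by exact_mod_cast hN0
  let ε : ℝ≥0 := 5 / N
  have hε : (N : ℝ) * ε = 5 := by
    have : (N : ℝ) ≠ 0 := by exact_mod_cast hN0.ne'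
    simp only [ε, NNReal.coe_div, NNReal.coe_natCast, NNReal.coe_ofNat]
    field_simp
  have hε0 : (0 : ℝ) < ε := by
    have : (0 : ℝ≥0) < ε := by positivity
    exact_mod_cast this
  have hεK : ε * (K₁ + K₂ + 1) < 1 := by
    rw [div_mul_eq_mul_div, div_lt_one hNr]; exact hN
  have hε1 : ε < 1 := lt_of_le_of_lt (le_mul_of_one_le_right' (by simp)) hεK
  have hε1' : (ε : ℝ) < 1 := by exact_mod_cast hε1
  have hL₁ : ε * K₁ < 1 := lt_of_le_of_lt (by gcongr; rw [add_assoc]; exact le_self_add) hεK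
  have hL₂ : ε * K₂ < 1 := lt_of_le_of_lt (by gcongr; rw [add_right_comm]; exact le_add_self) hεK
  have hlip : ∀ {F : Type} [NormedAddCommGroup F] [NormedSpace ℝ F] (g : F → F) (K : ℝ≥0),
      LipschitzWith K g → LipschitzWith (ε * K) fun x => (ε : ℝ) • g x := by
    intro F _ _ g K hg
    refine LipschitzWith.of_dist_le_mul fun x y => ?_
    have hn : ‖(ε : ℝ)‖ = ε := Real.norm_of_nonneg hε0.le
    rw [dist_smul₀, NNReal.coe_mul, mul_assoc, hn]
    exact mul_le_mul_of_nonneg_left (hg.dist_le_mul x y) ε.2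
  have hV : LipschitzWith (ε * K₁) (contactField fun x => (ε : ℝ) * h x) := by
    rw [contactField_const_mul hh]
    exact hlip _ _ hK₁
  obtain ⟨φ, hφ, hφc⟩ := exists_contactEquiv_of_contactField (contDiff_const.mul hh) hL₁ hV
  have hεb : ContDiff ℝ ∞ fun t => (ε : ℝ) • b t := (contDiff_const (c := (ε : ℝ))).smul hb
  obtain ⟨Γ, σ, Γ0, Γ1, hΓ, -, -, hσ, -⟩ :=
    exists_smooth_flow_equiv hεb hL₂ (hlip b K₂ hK₂)
  -- The curve is invariant under the flow, which acts on its parameter by the one-dimensional flow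
  -- of `ε b`.
  have hφσ : ∀ t, φ (zigzagCurve t) = zigzagCurve (σ t) := by
    intro t
    have := hφc (fun s => zigzagCurve (Γ t s)) fun s hs => by
      have := (hasDerivAt_zigzagCurve (Γ t s)).scomp s (hΓ t s hs)
      refine this.congr_deriv ?_
      rw [contactField_const_mul hh]
      simp only [hhγ, smul_smul, smul_eq_mul, b]
    rwa [Γ0, Γ1] at this
  have hσt : ∀ t, t ≤ 4 → -4 ≤ t → σ t = t - ε := by
    intro t h4 h4'
    have := integralCurve_unique (hlip b K₂ hK₂) (c := Γ t) (d := fun s => t - s * ε) (hΓ t)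
      (fun s hs => by
        have h1 : b (t - s * ε) = -1 := by
          refine hbone _ (abs_le.2 ⟨?_, ?_⟩) <;> nlinarith [hs.1, hs.2]
        simp only [h1]
        refine (((hasDerivAt_id s).mul_const (ε : ℝ)).const_sub t).congr_deriv ?_
        simp) (by simp [Γ0]) 1 ⟨zero_le_one, le_rfl⟩
    rw [Γ1] at this
    simpa using this
  -- A continuous injection of the line is strictly monotone, and `σ` is a translation near `[0,
  -- 1]`. Monotonicity ensures that exactly the parameters `t ≤ 3` end up in `t ≤ -2`.
  have hσm : StrictMono σ := by
    rcases hσ.continuous.strictMono_of_inj σ.injective with h | h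
    · exact h
    · have := h (show (0 : ℝ) < 1 by norm_num)
      rw [hσt 0 (by norm_num) (by norm_num), hσt 1 (by norm_num) (by norm_num)] at this
      linarith
  have hpow : ∀ k : ℕ, ∀ t, (φ ^ k) (zigzagCurve t) = zigzagCurve ((σ ^ k) t) := by
    intro k
    induction k with
    | zero => intro t; rfl
    | succ k ih => intro t; rw [pow_succ, pow_succ, Equiv.Perm.mul_apply, hφσ, ih]; rfl
  have hmono : ∀ k : ℕ, StrictMono (σ ^ k : Equiv.Perm ℝ) := by
    intro k
    induction k with
    | zero => exact strictMono_id
    | succ k ih => rw [pow_succ]; exact ih.comp hσm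
  have hthree : ∀ k : ℕ, k ≤ N → (σ ^ k) 3 = 3 - k * ε := by
    intro k
    induction k with
    | zero => intro _; simp
    | succ k ih =>
      intro hk
      have hk' : ((k : ℝ) + 1) * ε ≤ 5 := by
        rw [← hε]; gcongr; exact_mod_cast hk
      rw [pow_succ', Equiv.Perm.mul_apply, ih (by omega), hσt]
      · push_cast; ring
      · nlinarith [mul_nonneg (Nat.cast_nonneg (α := ℝ) k) hε0.le]
      · nlinarith
  have hend : (σ ^ N) 3 = -2 := by rw [hthree N le_rfl, hε]; norm_num
  refine ⟨φ ^ N, hφ.pow N, by rw [hpow, hend], fun x => ⟨?_, ?_⟩⟩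
  · rintro ⟨t, ht, hx⟩
    obtain ⟨t', rfl⟩ := (σ ^ N).surjective t
    rw [← hpow] at hx
    refine ⟨t', ?_, (φ ^ N).injective hx⟩
    rw [← hend] at ht
    exact (hmono N).le_iff_le.1 ht
  · rintro ⟨t, ht, rfl⟩
    refine ⟨(σ ^ N) t, ?_, hpow N t⟩
    rw [← hend]
    exact (hmono N).monotone ht

end Zigzag

/-! ### Elementary contact equivalences of `ℝ³` -/

section ElementaryContactEquiv

/-- The Legendre transformation. -/
def legendreEquiv : Equiv.Perm (ℝ × ℝ × ℝ) where
  toFun x := (x.2.1, -x.1, x.2.2 - x.2.1 * x.1)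
  invFun y := (-y.2.1, y.1, y.2.2 - y.1 * y.2.1)
  left_inv x := by ext <;> simp
  right_inv y := by ext <;> simp

/-- The rescaling that relates the zig-zag to its normalised form. -/
noncomputable def zigzagScaling : Equiv.Perm (ℝ × ℝ × ℝ) where
  toFun x := (36 * x.1, 18 * x.2.1, 648 * x.2.2)
  invFun y := (y.1 / 36, y.2.1 / 18, y.2.2 / 648)
  left_inv x := by ext <;> simp
  right_inv y := by ext <;> simp <;> ring

/-- The shear by the `1`-jet of `S`, followed by a translation in the `q`-direction. -/
noncomputable def jetShear (S : ℝ → ℝ) (a : ℝ) : Equiv.Perm (ℝ × ℝ × ℝ) where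
  toFun x := (x.1 - a, x.2.1 - deriv S x.1, x.2.2 - S x.1)
  invFun y := (y.1 + a, y.2.1 + deriv S (y.1 + a), y.2.2 + S (y.1 + a))
  left_inv x := by ext <;> simp
  right_inv y := by ext <;> simp

theorem hasFDerivAt_coords3 (x : ℝ × ℝ × ℝ) :
    HasFDerivAt (fun x : ℝ × ℝ × ℝ => x.1) (ContinuousLinearMap.fst ℝ ℝ (ℝ × ℝ)) x ∧
    HasFDerivAt (fun x : ℝ × ℝ × ℝ => x.2.1) ((ContinuousLinearMap.fst ℝ ℝ ℝ).comp
      (ContinuousLinearMap.snd ℝ ℝ (ℝ × ℝ))) x ∧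
    HasFDerivAt (fun x : ℝ × ℝ × ℝ => x.2.2) ((ContinuousLinearMap.snd ℝ ℝ ℝ).comp
      (ContinuousLinearMap.snd ℝ ℝ (ℝ × ℝ))) x :=
  ⟨ContinuousLinearMap.hasFDerivAt (ContinuousLinearMap.fst ℝ ℝ (ℝ × ℝ)),
    ContinuousLinearMap.hasFDerivAt ((ContinuousLinearMap.fst ℝ ℝ ℝ).comp
      (ContinuousLinearMap.snd ℝ ℝ (ℝ × ℝ))),
    ContinuousLinearMap.hasFDerivAt ((ContinuousLinearMap.snd ℝ ℝ ℝ).comp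
      (ContinuousLinearMap.snd ℝ ℝ (ℝ × ℝ)))⟩

theorem isContactEquiv_legendreEquiv : IsContactEquiv stdForm3 stdForm3 legendreEquiv where
  contDiff := by
    change ContDiff ℝ ∞ fun x : ℝ × ℝ × ℝ => (x.2.1, -x.1, x.2.2 - x.2.1 * x.1)
    fun_prop
  contDiff_symm := by
    change ContDiff ℝ ∞ fun y : ℝ × ℝ × ℝ => (-y.2.1, y.1, y.2.2 - y.1 * y.2.1)
    fun_prop
  conformal x := by
    refine ⟨1, one_ne_zero, fun v => ?_⟩
    obtain ⟨hq, hp, hz⟩ := hasFDerivAt_coords3 x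
    have h : HasFDerivAt legendreEquiv _ x := hp.prodMk (hq.neg.prodMk (hz.sub (hp.mul hq)))
    rw [h.fderiv]
    simp [stdForm3_apply, legendreEquiv]
    ring

theorem isContactEquiv_zigzagScaling : IsContactEquiv stdForm3 stdForm3 zigzagScaling where
  contDiff := by
    change ContDiff ℝ ∞ fun x : ℝ × ℝ × ℝ => (36 * x.1, 18 * x.2.1, 648 * x.2.2)
    fun_prop
  contDiff_symm := by
    change ContDiff ℝ ∞ fun y : ℝ × ℝ × ℝ => (y.1 / 36, y.2.1 / 18, y.2.2 / 648)
    fun_prop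
  conformal x := by
    refine ⟨648, by norm_num, fun v => ?_⟩
    obtain ⟨hq, hp, hz⟩ := hasFDerivAt_coords3 x
    have h : HasFDerivAt zigzagScaling _ x :=
      (hq.const_mul 36).prodMk ((hp.const_mul 18).prodMk (hz.const_mul 648))
    rw [h.fderiv]
    simp [stdForm3_apply, zigzagScaling]
    ring

theorem isContactEquiv_jetShear {S : ℝ → ℝ} (hS : ContDiff ℝ ∞ S) (a : ℝ) :
    IsContactEquiv stdForm3 stdForm3 (jetShear S a) := by
  have hS' : ContDiff ℝ ∞ (deriv S) := (contDiff_infty_iff_deriv.1 hS).2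
  refine ⟨?_, ?_, fun x => ⟨1, one_ne_zero, fun v => ?_⟩⟩
  · change ContDiff ℝ ∞ fun x : ℝ × ℝ × ℝ => (x.1 - a, x.2.1 - deriv S x.1, x.2.2 - S x.1)
    fun_prop
  · change ContDiff ℝ ∞ fun y : ℝ × ℝ × ℝ =>
      (y.1 + a, y.2.1 + deriv S (y.1 + a), y.2.2 + S (y.1 + a))
    fun_prop
  · obtain ⟨hq, hp, hz⟩ := hasFDerivAt_coords3 x
    have h1 := (hS.differentiable (by simp) x.1).hasDerivAt.comp_hasFDerivAt x hq
    have h2 := (hS'.differentiable (by simp) x.1).hasDerivAt.comp_hasFDerivAt x hq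
    have h : HasFDerivAt (jetShear S a) _ x :=
      (hq.sub_const a).prodMk ((hp.sub h2).prodMk (hz.sub h1))
    rw [h.fderiv]
    simp [stdForm3_apply, jetShear]
    ring

/-- A smooth function on the line that is `√(Q + 1)` for `1 ≤ Q`. -/
noncomputable def smoothSqrt (Q : ℝ) : ℝ := √(1 + Q * Real.smoothTransition Q)

theorem smoothSqrt_arg_pos (Q : ℝ) : 0 < 1 + Q * Real.smoothTransition Q := by
  rcases le_total Q 0 with h | h
  · rw [Real.smoothTransition.zero_of_nonpos h]; norm_num
  · have := mul_nonneg h (Real.smoothTransition.nonneg Q); linarith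

theorem contDiff_smoothSqrt : ContDiff ℝ ∞ smoothSqrt :=
  (contDiff_const.add (contDiff_id.mul Real.smoothTransition.contDiff)).sqrt
    fun Q => (smoothSqrt_arg_pos Q).ne'

theorem smoothSqrt_of_one_le {Q : ℝ} (hQ : 1 ≤ Q) : smoothSqrt Q = √(Q + 1) := by
  rw [smoothSqrt, Real.smoothTransition.one_of_one_le hQ, mul_one, add_comm]

/-- The generating function of the part of the zig-zag left of the cusps, seen after a Legendre
transformation. -/
noncomputable def zigzagTail (Q : ℝ) : ℝ := 2 * smoothSqrt Q ^ 5 / 5 - 2 * smoothSqrt Q ^ 3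

theorem contDiff_zigzagTail : ContDiff ℝ ∞ zigzagTail := by
  have := contDiff_smoothSqrt
  unfold zigzagTail; fun_prop

theorem deriv_zigzagTail {Q : ℝ} (hQ : 1 < Q) : deriv zigzagTail Q = √(Q + 1) ^ 3 - 3 * √(Q + 1) := by
  have h1 : zigzagTail =ᶠ[nhds Q] fun Q => 2 * √(Q + 1) ^ 5 / 5 - 2 * √(Q + 1) ^ 3 := by
    filter_upwards [lt_mem_nhds hQ] with R hR
    rw [zigzagTail, smoothSqrt_of_one_le hR.le]
  rw [h1.deriv_eq]
  have h0 : √(Q + 1) ≠ 0 := (Real.sqrt_pos.2 (by linarith)).ne'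
  have h2 := (Real.hasDerivAt_sqrt (show Q + 1 ≠ 0 by linarith)).comp Q
    ((hasDerivAt_id Q).add_const 1)
  have h3 := (((h2.pow 5).const_mul 2).div_const 5).sub ((h2.pow 3).const_mul 2)
  refine Eq.trans h3.deriv ?_
  simp only [Function.comp_apply, id, mul_one]
  field_simp
  push_cast
  ring

/-- After the Legendre transformation, the part of the zig-zag left of the cusps is straightened by
a shear. -/
theorem jetShear_legendreEquiv_iff (x : ℝ × ℝ × ℝ) :
    (0 ≤ (jetShear zigzagTail 3 (legendreEquiv x)).1 ∧
      (jetShear zigzagTail 3 (legendreEquiv x)).2 = 0) ↔ ∃ t ≤ -2, x = zigzagCurve t := by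
  -- The Legendre transformation makes `p = t² - 1` the base coordinate. For `t ≤ -2` the parameter
  -- is then explicit, `t = -√(p + 1)`, whereas a graph over `q` would require solving a cubic. The
  -- end `t = -2` lies over `p = 3`, hence the translation by 3.
  obtain ⟨q, p, z⟩ := x
  simp only [jetShear, legendreEquiv, Equiv.coe_fn_mk, Prod.mk_eq_zero, sub_nonneg, sub_eq_zero,
    zigzagCurve, Prod.mk.injEq]
  constructor
  · rintro ⟨h3, h4, h5⟩
    rw [deriv_zigzagTail (by linarith)] at h4
    rw [zigzagTail, smoothSqrt_of_one_le (by linarith)] at h5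
    set m := √(p + 1) with hm
    have hm2 : m ^ 2 = p + 1 := Real.sq_sqrt (by linarith)
    have hm0 : 2 ≤ m := Real.le_sqrt_of_sq_le (by linarith)
    have hp : p = m ^ 2 - 1 := by linarith
    have hq : q = -m ^ 3 + 3 * m := by linarith
    refine ⟨-m, by linarith, by rw [hq]; ring, by rw [hp]; ring, ?_⟩
    rw [sub_eq_iff_eq_add] at h5
    rw [h5, hp, hq]
    ring
  · rintro ⟨t, ht, rfl, rfl, rfl⟩
    have h3 : (3 : ℝ) ≤ t ^ 2 - 1 := by nlinarith
    have hm : √(t ^ 2 - 1 + 1) = -t := by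
      rw [sub_add_cancel, ← neg_sq, Real.sqrt_sq (by linarith)]
    rw [deriv_zigzagTail (by linarith), zigzagTail, smoothSqrt_of_one_le (by linarith), hm]
    exact ⟨h3, by ring, by ring⟩

/-- A contact equivalence of `ℝ³` that straightens the part of the zig-zag with parameter at most
`3` to the half line `{q ≥ 0, p = z = 0}`. -/
theorem exists_contactEquiv_zigzag :
    ∃ Θ : Equiv.Perm (ℝ × ℝ × ℝ), IsContactEquiv stdForm3 stdForm3 Θ ∧ Θ (zigzag 3) = 0 ∧
      ∀ x, (0 ≤ (Θ x).1 ∧ (Θ x).2 = 0) ↔ ∃ t ≤ 3, x = zigzag t := by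
  obtain ⟨Φ, hΦ, hΦ3, hΦt⟩ := exists_contactEquiv_zigzagCurve
  have hs : ∀ x t, zigzagScaling x = zigzagCurve t ↔ x = zigzag t := by
    intro x t
    rw [← Equiv.eq_symm_apply]
    have : zigzagScaling.symm (zigzagCurve t) = zigzag t := rfl
    rw [this]
  refine ⟨((zigzagScaling.trans Φ).trans legendreEquiv).trans (jetShear zigzagTail 3),
    ((isContactEquiv_zigzagScaling.trans hΦ).trans isContactEquiv_legendreEquiv).trans
      (isContactEquiv_jetShear contDiff_zigzagTail 3), ?_, fun x => ?_⟩
  · have h1 := (jetShear_legendreEquiv_iff (zigzagCurve (-2))).2 ⟨-2, le_rfl, rfl⟩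
    simp only [Equiv.trans_apply, (hs _ 3).2 rfl, hΦ3]
    refine Prod.ext ?_ h1.2
    simp [jetShear, legendreEquiv, zigzagCurve]
    norm_num
  · simp only [Equiv.trans_apply]
    rw [jetShear_legendreEquiv_iff, hΦt]
    simp only [hs]

end ElementaryContactEquiv

/-! ### Contact equivalences of the standard contact space -/

section StdContactEquiv

open Set

variable {n : ℕ}

/-- The coordinate `z` of the standard contact space. -/
noncomputable def zCoord (n : ℕ) : StdContactSpace n →L[ℝ] ℝ :=
  (ContinuousLinearMap.snd ℝ (Fin n → ℝ) ℝ).comp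
    (ContinuousLinearMap.snd ℝ (Fin n → ℝ) ((Fin n → ℝ) × ℝ))

/-- The coordinate `q i` of the standard contact space. -/
noncomputable def qCoord (n : ℕ) (i : Fin n) : StdContactSpace n →L[ℝ] ℝ :=
  (ContinuousLinearMap.proj i).comp (ContinuousLinearMap.fst ℝ (Fin n → ℝ) ((Fin n → ℝ) × ℝ))

/-- The coordinate `p i` of the standard contact space. -/
noncomputable def pCoord (n : ℕ) (i : Fin n) : StdContactSpace n →L[ℝ] ℝ :=
  ((ContinuousLinearMap.proj i).comp (ContinuousLinearMap.fst ℝ (Fin n → ℝ) ℝ)).comp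
    (ContinuousLinearMap.snd ℝ (Fin n → ℝ) ((Fin n → ℝ) × ℝ))

@[simp] theorem zCoord_apply (u : StdContactSpace n) : zCoord n u = u.2.2 := rfl

@[simp] theorem qCoord_apply (i : Fin n) (u : StdContactSpace n) : qCoord n i u = u.1 i := rfl

@[simp] theorem pCoord_apply (i : Fin n) (u : StdContactSpace n) : pCoord n i u = u.2.1 i := rfl

/-- The standard contact form as a field of continuous linear forms. -/
noncomputable def stdForm (n : ℕ) (u : StdContactSpace n) : StdContactSpace n →L[ℝ] ℝ :=
  zCoord n - ∑ i, u.2.1 i • qCoord n i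

theorem stdForm_apply (u v : StdContactSpace n) :
    stdForm n u v = v.2.2 - ∑ i, u.2.1 i * v.1 i := by
  simp [stdForm]

theorem stdForm_eq (u v : StdContactSpace n) : stdForm n u v = stdContactForm n u v :=
  stdForm_apply u v

/-- The derivative of a coordinate of a map is the coordinate of the derivative. -/
theorem clm_fderiv_apply {E F : Type*} [NormedAddCommGroup E] [NormedSpace ℝ E]
    [NormedAddCommGroup F] [NormedSpace ℝ F] {φ : E → F} {x : E} (hφ : DifferentiableAt ℝ φ x)
    (L : F →L[ℝ] ℝ) (v : E) : L (fderiv ℝ φ x v) = fderiv ℝ (fun y => L (φ y)) x v := by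
  have := (L.hasFDerivAt.comp x hφ.hasFDerivAt).fderiv
  exact (congrArg (fun A : E →L[ℝ] ℝ => A v) this).symm

/-- The contact scaling of the standard contact space. -/
noncomputable def contactScaling (n : ℕ) (r : ℝ) (hr : r ≠ 0) : Equiv.Perm (StdContactSpace n) where
  toFun u := (r • u.1, r • u.2.1, r ^ 2 * u.2.2)
  invFun u := (r⁻¹ • u.1, r⁻¹ • u.2.1, (r ^ 2)⁻¹ * u.2.2)
  left_inv u := by ext <;> simp [hr]
  right_inv u := by ext <;> simp [hr]

theorem isContactEquiv_contactScaling (r : ℝ) (hr : r ≠ 0) :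
    IsContactEquiv (stdForm n) (stdForm n) (contactScaling n r hr) where
  contDiff := by
    change ContDiff ℝ ∞ fun u : StdContactSpace n => (r • u.1, r • u.2.1, r ^ 2 * u.2.2)
    fun_prop
  contDiff_symm := by
    change ContDiff ℝ ∞ fun u : StdContactSpace n => (r⁻¹ • u.1, r⁻¹ • u.2.1, (r ^ 2)⁻¹ * u.2.2)
    fun_prop
  conformal u := by
    refine ⟨r ^ 2, pow_ne_zero 2 hr, fun v => ?_⟩
    let A : StdContactSpace n →L[ℝ] StdContactSpace n :=
      (r • ContinuousLinearMap.fst ℝ (Fin n → ℝ) ((Fin n → ℝ) × ℝ)).prod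
        ((r • (ContinuousLinearMap.fst ℝ (Fin n → ℝ) ℝ).comp
          (ContinuousLinearMap.snd ℝ (Fin n → ℝ) ((Fin n → ℝ) × ℝ))).prod (r ^ 2 • zCoord n))
    have h : HasFDerivAt (contactScaling n r hr) A u := A.hasFDerivAt
    rw [h.fderiv, stdForm_apply, stdForm_apply, mul_sub, Finset.mul_sum]
    simp only [contactScaling, A, Equiv.coe_fn_mk, ContinuousLinearMap.prod_apply,
      _root_.smul_apply, ContinuousLinearMap.comp_apply, ContinuousLinearMap.coe_fst',
      ContinuousLinearMap.coe_snd', zCoord_apply, Pi.smul_apply, smul_eq_mul]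
    congr 1
    refine Finset.sum_congr rfl fun i _ => by ring

variable [NeZero n]

/-- The projection to the coordinates `q 0`, `p 0`, `z`. -/
noncomputable def coords3 (n : ℕ) [NeZero n] : StdContactSpace n →L[ℝ] ℝ × ℝ × ℝ :=
  (qCoord n 0).prod ((pCoord n 0).prod (zCoord n))

@[simp] theorem coords3_apply (u : StdContactSpace n) :
    coords3 n u = (u.1 0, u.2.1 0, u.2.2) := rfl

/-- The map of the standard contact space induced by a map `Θ` of `ℝ³` with conformal
factor `F`. -/
noncomputable def contactLiftFun (n : ℕ) [NeZero n] (Θ : ℝ × ℝ × ℝ → ℝ × ℝ × ℝ)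
    (F : ℝ × ℝ × ℝ → ℝ) (u : StdContactSpace n) : StdContactSpace n :=
  (fun i => if i = 0 then (Θ (coords3 n u)).1 else u.1 i,
    fun i => if i = 0 then (Θ (coords3 n u)).2.1 else F (coords3 n u) * u.2.1 i,
    (Θ (coords3 n u)).2.2)

theorem coords3_contactLiftFun (Θ : ℝ × ℝ × ℝ → ℝ × ℝ × ℝ) (F : ℝ × ℝ × ℝ → ℝ)
    (u : StdContactSpace n) : coords3 n (contactLiftFun n Θ F u) = Θ (coords3 n u) := by
  simp [contactLiftFun]

theorem contDiff_contactLiftFun {Θ : ℝ × ℝ × ℝ → ℝ × ℝ × ℝ} {F : ℝ × ℝ × ℝ → ℝ}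
    (hΘ : ContDiff ℝ ∞ Θ) (hF : ContDiff ℝ ∞ F) : ContDiff ℝ ∞ (contactLiftFun n Θ F) := by
  have hX := (coords3 n).contDiff (n := ∞)
  have hΘX := hΘ.comp hX
  refine (contDiff_pi.2 fun i => ?_).prodMk ((contDiff_pi.2 fun i => ?_).prodMk
    (contDiff_snd.comp (contDiff_snd.comp hΘX)))
  · split_ifs
    · exact contDiff_fst.comp hΘX
    · exact (qCoord n i).contDiff
  · split_ifs
    · exact contDiff_fst.comp (contDiff_snd.comp hΘX)
    · exact (hF.comp hX).mul (pCoord n i).contDiff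

theorem contactLiftFun_leftInverse {Θ Θ' : ℝ × ℝ × ℝ → ℝ × ℝ × ℝ} {F F' : ℝ × ℝ × ℝ → ℝ}
    (hΘ : Function.LeftInverse Θ' Θ) (hF : ∀ x, F' (Θ x) * F x = 1) :
    Function.LeftInverse (contactLiftFun n Θ' F') (contactLiftFun n Θ F) := by
  intro u
  have h := coords3_contactLiftFun (n := n) Θ F u
  have hx := hΘ (coords3 n u)
  refine Prod.ext (funext fun i => ?_) (Prod.ext (funext fun i => ?_) ?_)
  · simp only [contactLiftFun] at h ⊢
    rw [h, hx]
    split_ifs with hi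
    · rw [hi]; rfl
    · rfl
  · simp only [contactLiftFun] at h ⊢
    rw [h, hx]
    split_ifs with hi
    · rw [hi]; rfl
    · rw [← mul_assoc, hF, one_mul]
  · simp only [contactLiftFun] at h ⊢
    rw [h, hx]
    rfl

/-- A contact equivalence of `ℝ³` lifts to the standard contact space of any dimension. -/
theorem IsContactEquiv.exists_lift {Θ : Equiv.Perm (ℝ × ℝ × ℝ)}
    (hΘ : IsContactEquiv stdForm3 stdForm3 Θ) :
    ∃ (F : ℝ × ℝ × ℝ → ℝ) (e : Equiv.Perm (StdContactSpace n)), (∀ x, F x ≠ 0) ∧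
      (∀ u, e u = contactLiftFun n Θ F u) ∧ IsContactEquiv (stdForm n) (stdForm n) e := by
  -- The conformal constants are given pointwise, without regularity. Evaluating on `∂/∂z`, where
  -- the form is 1, shows that they are a smooth function.
  let F : ℝ × ℝ × ℝ → ℝ := fun x => stdForm3 (Θ x) (fderiv ℝ Θ x (0, 0, 1))
  have hFc : ∀ x, F x ≠ 0 ∧ ∀ v, stdForm3 (Θ x) (fderiv ℝ Θ x v) = F x * stdForm3 x v := by
    intro x
    obtain ⟨c, hc, h⟩ := hΘ.conformal x
    have : F x = c := by simp only [F, h]; simp [stdForm3_apply]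
    rw [this]
    exact ⟨hc, h⟩
  have hF : ContDiff ℝ ∞ F := by
    have h1 := contDiff_fderiv_apply_const hΘ.contDiff ((0 : ℝ), (0 : ℝ), (1 : ℝ))
    have h2 := hΘ.contDiff
    simp only [F, stdForm3_apply]
    fun_prop
  let F' : ℝ × ℝ × ℝ → ℝ := fun y => (F (Θ.symm y))⁻¹
  have hF' : ContDiff ℝ ∞ F' := (hF.comp hΘ.contDiff_symm).inv fun y => (hFc _).1
  let e : Equiv.Perm (StdContactSpace n) :=
    { toFun := contactLiftFun n Θ F
      invFun := contactLiftFun n Θ.symm F'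
      left_inv := contactLiftFun_leftInverse Θ.left_inv fun x => by
        simp only [F', Equiv.symm_apply_apply]
        exact inv_mul_cancel₀ (hFc x).1
      right_inv := contactLiftFun_leftInverse Θ.right_inv fun x => mul_inv_cancel₀ (hFc _).1 }
  have he : ContDiff ℝ ∞ e := contDiff_contactLiftFun hΘ.contDiff hF
  refine ⟨F, e, fun x => (hFc x).1, fun _ => rfl, he,
    contDiff_contactLiftFun hΘ.contDiff_symm hF', fun u => ⟨F (coords3 n u), (hFc _).1, fun v => ?_⟩⟩
  have hd : DifferentiableAt ℝ e u := he.differentiable (by simp) u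
  have hΘX : HasFDerivAt (fun u => Θ (coords3 n u)) ((fderiv ℝ Θ (coords3 n u)).comp (coords3 n)) u :=
    (hΘ.contDiff.differentiable (by simp) _).hasFDerivAt.comp u (coords3 n).hasFDerivAt
  have h3 : coords3 n (fderiv ℝ e u v) = fderiv ℝ Θ (coords3 n u) (coords3 n v) := by
    have h1 := (coords3 n).hasFDerivAt.comp u hd.hasFDerivAt
    have h2 : (coords3 n) ∘ e = fun u => Θ (coords3 n u) :=
      funext fun u => coords3_contactLiftFun Θ F u
    rw [h2] at h1
    exact congrArg (fun A : StdContactSpace n →L[ℝ] ℝ × ℝ × ℝ => A v) (h1.unique hΘX)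
  have hi : ∀ i, i ≠ 0 → (fderiv ℝ e u v).1 i = v.1 i := by
    intro i hi
    have h1 := clm_fderiv_apply hd (qCoord n i) v
    have h2 : (fun y => qCoord n i (e y)) = qCoord n i := by
      ext y; simp [e, contactLiftFun, hi]
    rw [h2, ContinuousLinearMap.fderiv] at h1
    exact h1
  have hc := (hFc (coords3 n u)).2 (coords3 n v)
  rw [← h3, stdForm3_apply, stdForm3_apply] at hc
  rw [stdForm_apply, stdForm_apply, Fintype.sum_eq_add_sum_subtype_ne _ (0 : Fin n),
    Fintype.sum_eq_add_sum_subtype_ne _ (0 : Fin n)]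
  -- For `i ≠ 0` the lift fixes `q i` and multiplies `p i` by `F`, so this sum acquires the same
  -- factor as the three-dimensional form.
  have hsum : ∑ i : {i : Fin n // i ≠ 0}, (e u).2.1 i * (fderiv ℝ e u v).1 i =
      F (coords3 n u) * ∑ i : {i : Fin n // i ≠ 0}, u.2.1 i * v.1 i := by
    rw [Finset.mul_sum]
    refine Finset.sum_congr rfl fun i _ => ?_
    rw [hi i i.2]
    simp only [e, Equiv.coe_fn_mk, contactLiftFun, if_neg i.2]
    ring
  rw [hsum]
  have h0 : (e u).2.1 0 = (Θ (coords3 n u)).2.1 := by simp [e, contactLiftFun]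
  rw [h0]
  simp only [coords3_apply] at hc ⊢
  linarith

/-- The half space `{q 0 ≥ 0, p = z = 0}`, the standard Legendrian with boundary. -/
def stdHalfLegendrian (n : ℕ) [NeZero n] : Set (StdContactSpace n) := {u | 0 ≤ u.1 0 ∧ u.2 = 0}

theorem isBounded_stabilisationBox (ρ : ℝ) : Bornology.IsBounded (stabilisationBox n ρ) := by
  refine (Metric.isBounded_closedBall (x := (0 : StdContactSpace n)) (r := max ρ 1)).subset ?_
  rintro u ⟨h1, h2, h3, h4⟩
  rw [mem_closedBall_zero_iff]
  have hle : (1 / 2 : ℝ) ≤ max ρ 1 := le_max_of_le_right (by norm_num)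
  have h0 : (0 : ℝ) ≤ max ρ 1 := le_max_of_le_right (by norm_num)
  refine norm_prod_le_iff.2 ⟨(pi_norm_le_iff_of_nonneg h0).2 fun i => ?_, norm_prod_le_iff.2
    ⟨(pi_norm_le_iff_of_nonneg h0).2 fun i => ?_, h3.le.trans hle⟩⟩
  · by_cases hi : i = 0
    · rw [hi]; exact h1.le.trans hle
    · exact (h4 i hi).1.le.trans (le_max_left _ _)
  · by_cases hi : i = 0
    · rw [hi]; exact h2.le.trans hle
    · exact (h4 i hi).2.le.trans (le_max_left _ _)

theorem isOpen_stabilisationBox (ρ : ℝ) : IsOpen (stabilisationBox n ρ) := by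
  have : stabilisationBox n ρ = {u | |u.1 0| < 1 / 2} ∩ ({u | |u.2.1 0| < 1 / 2} ∩
      ({u | |u.2.2| < 1 / 2} ∩ ⋂ i : Fin n, ⋂ (_ : i ≠ 0), ({u | |u.1 i| < ρ} ∩
        {u | |u.2.1 i| < ρ}))) := by
    ext u; simp [stabilisationBox]
  rw [this]
  refine (isOpen_lt (by fun_prop) continuous_const).inter
    ((isOpen_lt (by fun_prop) continuous_const).inter
    ((isOpen_lt (by fun_prop) continuous_const).inter ?_))
  exact isOpen_iInter_of_finite fun i => isOpen_iInter_of_finite fun _ =>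
    (isOpen_lt (by fun_prop) continuous_const).inter (isOpen_lt (by fun_prop) continuous_const)

/-- The polynomial `t³ - 3t` is at least 18 for `t ≥ 3` and at most -18 for `t ≤ -3`. -/
theorem abs_lt_three_of_zigzag {t : ℝ} (ht : |(zigzag t).1| < 1 / 2) : |t| < 3 := by
  rw [zigzag, abs_lt] at ht
  obtain ⟨h1, h2⟩ := ht
  simp only at h1 h2
  rw [abs_lt]
  constructor
  · by_contra! h
    nlinarith [mul_nonneg (sub_nonneg.2 h) (sq_nonneg t), mul_nonneg (sub_nonneg.2 h) (sub_nonneg.2 h)]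
  · by_contra! h
    nlinarith [mul_nonneg (sub_nonneg.2 h) (sq_nonneg t), mul_nonneg (sub_nonneg.2 h) (sub_nonneg.2 h)]

/-- The stabilised model is contact equivalent, over the whole box, to an open part of the standard
Legendrian with boundary, which may be chosen arbitrarily close to the origin. -/
theorem exists_contactEquiv_stabilisedModel (ρ : ℝ) {U : Set (StdContactSpace n)}
    (hU : U ∈ nhds 0) :
    ∃ e : Equiv.Perm (StdContactSpace n), IsContactEquiv (stdForm n) (stdForm n) e ∧
      MapsTo e (stabilisationBox n ρ) U ∧
      ∀ u ∈ stabilisationBox n ρ, (e u ∈ stdHalfLegendrian n ↔ u ∈ stabilisedModel n) ∧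
        (e u ∈ stdHalfLegendrian n → (e u).1 0 ≠ 0) := by
  obtain ⟨Θ, hΘ, hΘ3, hΘt⟩ := exists_contactEquiv_zigzag
  obtain ⟨F, e, hF, he, hce⟩ := hΘ.exists_lift (n := n)
  have hmem : ∀ u, e u ∈ stdHalfLegendrian n ↔
      (∃ t ≤ 3, coords3 n u = zigzag t) ∧ ∀ i, i ≠ 0 → u.2.1 i = 0 := by
    intro u
    rw [← hΘt, he]
    constructor
    · rintro ⟨h1, h2⟩
      have h3 := congrFun (congrArg Prod.fst h2)
      have h4 := congrArg Prod.snd h2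
      refine ⟨⟨by simpa [contactLiftFun] using h1, Prod.ext ?_ h4⟩, fun i hi => ?_⟩
      · simpa [contactLiftFun] using h3 0
      · simpa [contactLiftFun, hi, hF] using h3 i
    · rintro ⟨⟨h1, h2⟩, h3⟩
      refine ⟨by simpa [contactLiftFun] using h1, Prod.ext (funext fun i => ?_) ?_⟩
      · by_cases hi : i = 0
        · simp only [contactLiftFun, if_pos hi]; rw [h2]; rfl
        · simp [contactLiftFun, hi, h3 i hi]
      · simp only [contactLiftFun]; rw [h2]; rfl
  have hbox : ∀ u ∈ stabilisationBox n ρ, (e u ∈ stdHalfLegendrian n ↔ u ∈ stabilisedModel n) ∧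
        (e u ∈ stdHalfLegendrian n → (e u).1 0 ≠ 0) := by
    intro u hu
    have ht : ∀ t, coords3 n u = zigzag t → |t| < 3 := fun t ht => by
      refine abs_lt_three_of_zigzag ?_
      rw [← ht]; exact hu.1
    refine ⟨⟨fun h => ?_, fun h => ?_⟩, fun h h0 => ?_⟩
    · obtain ⟨⟨t, -, h1⟩, h2⟩ := (hmem u).1 h
      exact ⟨⟨t, h1⟩, h2⟩
    · obtain ⟨⟨t, h1⟩, h2⟩ := h
      exact (hmem u).2 ⟨⟨t, (abs_lt.1 (ht t h1)).2.le, h1⟩, h2⟩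
    -- A boundary point of the half space in the image of the box would come from `zigzag 3`, which
    -- lies on a face of the cube and not in the open box.
    · have h1 : Θ (coords3 n u) = 0 := by
        have h2 := coords3_contactLiftFun (n := n) Θ F u
        rw [← he] at h2
        rw [← h2, coords3_apply, h0, h.2]
        rfl
      rw [← hΘ3] at h1
      have := ht 3 (Θ.injective h1)
      norm_num at this
  obtain ⟨R, hR⟩ := ((isBounded_stabilisationBox (n := n) ρ).isCompact_closure.image
    hce.contDiff.continuous).isBounded.exists_norm_le
  obtain ⟨δ, hδ, hδU⟩ := Metric.mem_nhds_iff.1 hU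
  -- The bound `r ≤ 1` gives `r² ≤ r`, so the whole scaling contracts norms by `r`.
  let r : ℝ := min 1 (δ / (2 * (|R| + 1)))
  have hR0 : 0 < 2 * (|R| + 1) := by positivity
  have hr : 0 < r := lt_min one_pos (div_pos hδ hR0)
  have hr1 : r ≤ 1 := min_le_left _ _
  refine ⟨e.trans (contactScaling n r hr.ne'), hce.trans (isContactEquiv_contactScaling r hr.ne'),
    fun u hu => hδU ?_, fun u hu => ?_⟩
  · have h1 : ‖e u‖ ≤ |R| := (hR _ (mem_image_of_mem e (subset_closure hu))).trans (le_abs_self R)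
    have h2 : ‖contactScaling n r hr.ne' (e u)‖ ≤ r * ‖e u‖ := by
      have h0 : 0 ≤ r * ‖e u‖ := by positivity
      refine norm_prod_le_iff.2 ⟨?_, norm_prod_le_iff.2 ⟨?_, ?_⟩⟩
      · exact (norm_smul_le _ _).trans (by
          rw [Real.norm_of_nonneg hr.le]
          exact mul_le_mul_of_nonneg_left (norm_fst_le _) hr.le)
      · exact (norm_smul_le _ _).trans (by
          rw [Real.norm_of_nonneg hr.le]
          exact mul_le_mul_of_nonneg_left ((norm_fst_le _).trans (norm_snd_le _)) hr.le)
      · exact (norm_mul_le _ _).trans (by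
          rw [Real.norm_of_nonneg (sq_nonneg r)]
          exact mul_le_mul (by nlinarith) ((norm_snd_le _).trans (norm_snd_le _)) (norm_nonneg _)
            hr.le)
    rw [mem_ball_zero_iff]
    refine h2.trans_lt ?_
    have h3 : r * (2 * (|R| + 1)) ≤ δ := by
      rw [← le_div_iff₀ hR0]; exact min_le_right _ _
    nlinarith [abs_nonneg R, norm_nonneg (e u), mul_le_mul_of_nonneg_left h1 hr.le]
  · have h1 : ∀ w : StdContactSpace n, contactScaling n r hr.ne' w ∈ stdHalfLegendrian n ↔
        w ∈ stdHalfLegendrian n := by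
      intro w
      have h2 : contactScaling n r hr.ne' w = (r • w.1, r • w.2.1, r ^ 2 * w.2.2) := rfl
      rw [h2]
      simp [stdHalfLegendrian, hr.ne', mul_nonneg_iff_of_pos_left hr, Prod.ext_iff]
    have h3 : ((contactScaling n r hr.ne') (e u)).1 0 = r * (e u).1 0 := rfl
    simp only [Equiv.trans_apply, h1, h3, ne_eq, mul_eq_zero, hr.ne', false_or]
    exact hbox u hu

end StdContactEquiv

/-! ### Local contact charts -/

section ContactChart

open Set Filter Topology

variable {E F G : Type*} [NormedAddCommGroup E] [NormedSpace ℝ E] [NormedAddCommGroup F]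
  [NormedSpace ℝ F] [NormedAddCommGroup G] [NormedSpace ℝ G]

/-- A local diffeomorphism that matches the kernels of two `1`-forms. -/
structure IsContactChart (α : E → E →L[ℝ] ℝ) (β : F → F →L[ℝ] ℝ)
    (ψ : OpenPartialHomeomorph E F) : Prop where
  contDiffOn : ContDiffOn ℝ ∞ ψ ψ.source
  contDiffOn_symm : ContDiffOn ℝ ∞ ψ.symm ψ.target
  kernel : ∀ x ∈ ψ.source, ∀ v, β (ψ x) (fderiv ℝ ψ x v) = 0 ↔ α x v = 0

namespace IsContactChart

variable {α : E → E →L[ℝ] ℝ} {β : F → F →L[ℝ] ℝ} {δ : G → G →L[ℝ] ℝ}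
  {ψ : OpenPartialHomeomorph E F} {χ : OpenPartialHomeomorph F G}

theorem differentiableAt (h : IsContactChart α β ψ) {x : E} (hx : x ∈ ψ.source) :
    DifferentiableAt ℝ ψ x :=
  (h.contDiffOn.contDiffAt (ψ.open_source.mem_nhds hx)).differentiableAt (by simp)

theorem differentiableAt_symm (h : IsContactChart α β ψ) {y : F} (hy : y ∈ ψ.target) :
    DifferentiableAt ℝ ψ.symm y :=
  (h.contDiffOn_symm.contDiffAt (ψ.open_target.mem_nhds hy)).differentiableAt (by simp)

theorem fderiv_fderiv_symm (h : IsContactChart α β ψ) {y : F} (hy : y ∈ ψ.target) (w : F) :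
    fderiv ℝ ψ (ψ.symm y) (fderiv ℝ ψ.symm y w) = w := by
  have h1 := (h.differentiableAt (ψ.map_target hy)).hasFDerivAt.comp y
    (h.differentiableAt_symm hy).hasFDerivAt
  have h2 : HasFDerivAt (ψ ∘ ψ.symm) (ContinuousLinearMap.id ℝ F) y :=
    (hasFDerivAt_id y).congr_of_eventuallyEq (ψ.eventually_right_inverse hy)
  exact congrArg (fun A : F →L[ℝ] F => A w) (h1.unique h2)

theorem fderiv_symm_fderiv (h : IsContactChart α β ψ) {x : E} (hx : x ∈ ψ.source) (v : E) :
    fderiv ℝ ψ.symm (ψ x) (fderiv ℝ ψ x v) = v := by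
  have h1 := (h.differentiableAt_symm (ψ.map_source hx)).hasFDerivAt.comp x
    (h.differentiableAt hx).hasFDerivAt
  have h2 : HasFDerivAt (ψ.symm ∘ ψ) (ContinuousLinearMap.id ℝ E) x :=
    (hasFDerivAt_id x).congr_of_eventuallyEq (ψ.eventually_left_inverse hx)
  exact congrArg (fun A : E →L[ℝ] E => A v) (h1.unique h2)

theorem symm (h : IsContactChart α β ψ) : IsContactChart β α ψ.symm where
  contDiffOn := h.contDiffOn_symm
  contDiffOn_symm := h.contDiffOn
  kernel y hy w := by
    rw [← h.kernel _ (ψ.map_target hy), h.fderiv_fderiv_symm hy, ψ.right_inv hy]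

theorem trans (h : IsContactChart α β ψ) (k : IsContactChart β δ χ) :
    IsContactChart α δ (ψ.trans χ) where
  contDiffOn := by
    rw [OpenPartialHomeomorph.trans_source]
    exact k.contDiffOn.comp (h.contDiffOn.mono inter_subset_left) inter_subset_right
  contDiffOn_symm := by
    rw [OpenPartialHomeomorph.trans_target]
    exact h.contDiffOn_symm.comp (k.contDiffOn_symm.mono inter_subset_left) inter_subset_right
  kernel x hx v := by
    rw [OpenPartialHomeomorph.trans_source] at hx
    have : fderiv ℝ (ψ.trans χ) x = (fderiv ℝ χ (ψ x)).comp (fderiv ℝ ψ x) :=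
      fderiv_comp x (k.differentiableAt hx.2) (h.differentiableAt hx.1)
    rw [this, ← h.kernel x hx.1, ← k.kernel _ hx.2]
    rfl

end IsContactChart

theorem IsContactEquiv.exists_isContactChart {α : E → E →L[ℝ] ℝ} {β : F → F →L[ℝ] ℝ} {φ : E ≃ F}
    (h : IsContactEquiv α β φ) :
    ∃ Ψ : OpenPartialHomeomorph E F, Ψ.source = univ ∧ Ψ.target = univ ∧ (∀ x, Ψ x = φ x) ∧
      (∀ y, Ψ.symm y = φ.symm y) ∧ IsContactChart α β Ψ := by
  refine ⟨(Homeomorph.mk φ h.contDiff.continuous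
    h.contDiff_symm.continuous).toOpenPartialHomeomorph, rfl, rfl, fun _ => rfl, fun _ => rfl,
    h.contDiff.contDiffOn, h.contDiff_symm.contDiffOn, fun x _ v => ?_⟩
  obtain ⟨c, hc, hv⟩ := h.conformal x
  exact (show β (φ x) (fderiv ℝ φ x v) = 0 ↔ α x v = 0 by rw [hv]; simp [hc])

/-- The inverse function theorem for maps that match the kernels of two `1`-forms. -/
theorem exists_isContactChart [CompleteSpace E] {α : E → E →L[ℝ] ℝ} {β : F → F →L[ℝ] ℝ}
    {ψ : E → F} {U : Set E} (hU : IsOpen U) (hψ : ContDiffOn ℝ ∞ ψ U) {a : E} (ha : a ∈ U)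
    {ψ' : E ≃L[ℝ] F} (hψ' : HasFDerivAt ψ (ψ' : E →L[ℝ] F) a)
    (hker : ∀ x ∈ U, ∀ v, β (ψ x) (fderiv ℝ ψ x v) = 0 ↔ α x v = 0) :
    ∃ Ψ : OpenPartialHomeomorph E F, a ∈ Ψ.source ∧ Ψ.source ⊆ U ∧ (∀ x, Ψ x = ψ x) ∧
      IsContactChart α β Ψ := by
  have hψa : ContDiffAt ℝ ∞ ψ a := hψ.contDiffAt (hU.mem_nhds ha)
  let Ψ₀ := hψa.toOpenPartialHomeomorph ψ hψ' (by simp)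
  have hΨ₀ : ∀ x, Ψ₀ x = ψ x := fun x => rfl
  have hcont : ContinuousOn (fderiv ℝ ψ) U := hψ.continuousOn_fderiv_of_isOpen hU (by simp)
  -- Shrinking to the open set where the derivative is invertible makes the inverse smooth on the
  -- whole target, not just at the image of `a`.
  let W : Set E := U ∩ fderiv ℝ ψ ⁻¹' range ((↑) : (E ≃L[ℝ] F) → E →L[ℝ] F)
  have hW : IsOpen W := hcont.isOpen_inter_preimage hU ContinuousLinearEquiv.isOpen
  have haW : a ∈ W := ⟨ha, ⟨ψ', hψ'.fderiv.symm⟩⟩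
  refine ⟨Ψ₀.restrOpen W hW, ?_, ?_, fun x => rfl, ?_, ?_, ?_⟩
  · exact ⟨hψa.mem_toOpenPartialHomeomorph_source hψ' (by simp), haW⟩
  · exact fun x hx => hx.2.1
  · exact hψ.mono fun x hx => hx.2.1
  · intro y hy
    have hy' := (Ψ₀.restrOpen W hW).map_target hy
    obtain ⟨e, he⟩ := hy'.2.2
    refine ContDiffAt.contDiffWithinAt
      ((Ψ₀.restrOpen W hW).contDiffAt_symm hy (f₀' := e) ?_ ?_)
    · rw [he]
      exact ((hψ.contDiffAt (hU.mem_nhds hy'.2.1)).differentiableAt (by simp)).hasFDerivAt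
    · exact hψ.contDiffAt (hU.mem_nhds hy'.2.1)
  · exact fun x hx v => hker x hx.2.1 v

/-- Two `1`-forms whose kernels are matched by a local diffeomorphism fixing the origin. -/
def ContactGermEquiv (α β : E → E →L[ℝ] ℝ) : Prop :=
  ∃ ψ : OpenPartialHomeomorph E E, 0 ∈ ψ.source ∧ ψ 0 = 0 ∧ IsContactChart α β ψ

theorem ContactGermEquiv.refl (α : E → E →L[ℝ] ℝ) : ContactGermEquiv α α :=
  ⟨OpenPartialHomeomorph.refl E, mem_univ _, rfl, contDiffOn_id, contDiffOn_id, fun x _ v => by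
    change α x (fderiv ℝ id x v) = 0 ↔ _
    simp⟩

theorem ContactGermEquiv.symm {α β : E → E →L[ℝ] ℝ} (h : ContactGermEquiv α β) :
    ContactGermEquiv β α := by
  obtain ⟨ψ, h0, h1, h2⟩ := h
  refine ⟨ψ.symm, ?_, ?_, h2.symm⟩
  · rw [← h1]; exact ψ.map_source h0
  · nth_rw 1 [← h1]; exact ψ.left_inv h0

theorem ContactGermEquiv.trans {α β δ : E → E →L[ℝ] ℝ} (h : ContactGermEquiv α β)
    (k : ContactGermEquiv β δ) : ContactGermEquiv α δ := by
  obtain ⟨ψ, h0, h1, h2⟩ := h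
  obtain ⟨χ, k0, k1, k2⟩ := k
  refine ⟨ψ.trans χ, ?_, ?_, h2.trans k2⟩
  · rw [OpenPartialHomeomorph.trans_source]
    exact ⟨h0, by rw [mem_preimage, h1]; exact k0⟩
  · rw [OpenPartialHomeomorph.coe_trans, Function.comp_apply, h1, k1]

end ContactChart

/-! ### Moser's method -/

section Moser

open Set Filter Topology

open scoped NNReal

variable {E F : Type*} [NormedAddCommGroup E] [NormedSpace ℝ E] [FiniteDimensional ℝ E]
  [NormedAddCommGroup F] [NormedSpace ℝ F]

/-- A map that is smooth near a point agrees near that point with a globally smooth map of compact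
support. -/
theorem exists_contDiff_hasCompactSupport_eqOn_ball {f : E → F} {G : Set E} (hG : IsOpen G)
    (hf : ContDiffOn ℝ ∞ f G) {a : E} (ha : a ∈ G) :
    ∃ (V : E → F) (r : ℝ), 0 < r ∧ ContDiff ℝ ∞ V ∧ HasCompactSupport V ∧
      Metric.ball a r ⊆ G ∧ EqOn V f (Metric.ball a r) := by
  obtain ⟨R, hR, hRG⟩ := Metric.mem_nhds_iff.1 (hG.mem_nhds ha)
  let χ : ContDiffBump a := ⟨R / 3, R / 2, by positivity, by linarith⟩
  refine ⟨fun x => χ x • f x, R / 3, by positivity, contDiff_iff_contDiffAt.2 fun x => ?_,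
    χ.hasCompactSupport.smul_right, (Metric.ball_subset_ball (by linarith)).trans hRG,
    fun x hx => ?_⟩
  · by_cases hx : x ∈ tsupport χ
    · have hxG : x ∈ G := by
        rw [χ.tsupport_eq] at hx
        exact hRG (Metric.closedBall_subset_ball (by simp only [χ]; linarith) hx)
      exact χ.contDiffAt.smul (hf.contDiffAt (hG.mem_nhds hxG))
    · have h0 : (fun x => χ x • f x) =ᶠ[𝓝 x] fun _ => 0 := by
        filter_upwards [(isClosed_tsupport χ).isOpen_compl.mem_nhds hx] with y hy
        rw [image_eq_zero_of_notMem_tsupport hy, zero_smul]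
      exact contDiffAt_const.congr_of_eventuallyEq h0
  · have : χ x = 1 := χ.one_of_mem_closedBall (Metric.ball_subset_closedBall hx)
    simp [this]

/-- The flow of a Moser field `(1, X)` matches the kernels of a family of `1`-forms. -/
theorem eventually_contactGermEquiv_of_moserField {A : ℝ × E → E →L[ℝ] ℝ} {X : ℝ × E → E}
    {μ : ℝ × E → ℝ} {G : Set (ℝ × E)} (hG : IsOpen G) {t₀ : ℝ} (ht₀ : (t₀, (0 : E)) ∈ G)
    (hA : ContDiffOn ℝ ∞ A G) (hX : ContDiffOn ℝ ∞ X G) (hμ : ContinuousOn μ G)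
    (hX0 : ∀ t, (t, (0 : E)) ∈ G → X (t, 0) = 0)
    (hlie : ∀ y ∈ G, ∀ w, fderiv ℝ A y (1, X y) w + A y (fderiv ℝ X y (0, w)) = μ y * A y w) :
    ∀ᶠ ε in 𝓝 (0 : ℝ), ContactGermEquiv (fun x => A (t₀, x)) (fun x => A (t₀ + ε, x)) := by
  -- The time-dependent field `X` becomes the autonomous field `(1, X)` on `ℝ × E`, cut off to
  -- compact support. Multiplying it by `ε` makes the time-one flow advance the path parameter by
  -- `ε`.
  obtain ⟨V, r, hr, hV, hVc, hrG, hVX⟩ := exists_contDiff_hasCompactSupport_eqOn_ball hG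
    ((contDiffOn_const (c := (1 : ℝ))).prodMk hX) ht₀
  obtain ⟨K, hK⟩ := hV.lipschitzWith_of_hasCompactSupport hVc (by simp)
  obtain ⟨C, hC⟩ := hVc.exists_bound_of_continuous hV.continuous
  have e1 : ∀ᶠ ε : ℝ in 𝓝 0, |ε| * K < 1 := by
    have : Tendsto (fun ε : ℝ => |ε| * K) (𝓝 0) (𝓝 (|0| * K)) := by
      apply Continuous.tendsto; fun_prop
    rw [abs_zero, zero_mul] at this
    exact this.eventually_lt_const one_pos
  have e2 : ∀ᶠ ε : ℝ in 𝓝 0, |ε| * (|C| + 1) < r / 2 := by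
    have : Tendsto (fun ε : ℝ => |ε| * (|C| + 1)) (𝓝 0) (𝓝 (|0| * (|C| + 1))) := by
      apply Continuous.tendsto; fun_prop
    rw [abs_zero, zero_mul] at this
    exact this.eventually_lt_const (half_pos hr)
  filter_upwards [e1, e2] with ε hεK hεC
  have hεV : ContDiff ℝ ∞ fun y => ε • V y := (contDiff_const (c := ε)).smul hV
  have hL : LipschitzWith (‖ε‖₊ * K) fun y => ε • V y := by
    refine LipschitzWith.of_dist_le_mul fun x y => ?_
    rw [dist_smul₀, NNReal.coe_mul, mul_assoc]
    exact mul_le_mul_of_nonneg_left (hK.dist_le_mul x y) (norm_nonneg _)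
  have hL1 : ‖ε‖₊ * K < 1 := by
    rw [← NNReal.coe_lt_coe]; exact hεK
  obtain ⟨Γ, Φ, Γ0, Γ1, hΓ, hΓs, hvar, hΦ, hΦs⟩ := exists_smooth_flow_equiv hεV hL1 hL
  have hzero : (0 : ℝ) ∈ Icc (0 : ℝ) 1 := ⟨le_rfl, zero_le_one⟩
  have hone : (1 : ℝ) ∈ Icc (0 : ℝ) 1 := ⟨zero_le_one, le_rfl⟩
  have hball : ∀ x ∈ Metric.ball (0 : E) (r / 2), ∀ s ∈ Icc (0 : ℝ) 1,
      Γ (t₀, x) s ∈ Metric.ball (t₀, (0 : E)) r := by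
    intro x hx s hs
    have h1 := norm_image_sub_le_of_norm_deriv_le_segment' (f := Γ (t₀, x)) (a := 0) (b := 1)
      (C := |ε| * |C|) (fun s hs => (hΓ (t₀, x) s hs).hasDerivWithinAt) (fun s _ => by
        rw [norm_smul]
        exact mul_le_mul_of_nonneg_left ((hC _).trans (le_abs_self C)) (norm_nonneg _)) s hs
    rw [Γ0, sub_zero] at h1
    have h2 : |ε| * |C| * s ≤ |ε| * (|C| + 1) := by
      have : |ε| * |C| * s ≤ |ε| * |C| * 1 :=
        mul_le_mul_of_nonneg_left hs.2 (by positivity)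
      nlinarith [abs_nonneg ε]
    have h3 : dist ((t₀, x) : ℝ × E) (t₀, 0) < r / 2 := by
      rw [Prod.dist_eq, dist_self]
      exact max_lt (half_pos hr) hx
    rw [Metric.mem_ball]
    calc dist (Γ (t₀, x) s) (t₀, 0) ≤ dist (Γ (t₀, x) s) (t₀, x) + dist ((t₀, x) : ℝ × E) (t₀, 0) :=
          dist_triangle _ _ _
      _ < r / 2 + r / 2 := by
          refine add_lt_add ?_ h3
          rw [dist_eq_norm]
          linarith
      _ = r := by ring
  have htime : ∀ x ∈ Metric.ball (0 : E) (r / 2), ∀ s ∈ Icc (0 : ℝ) 1,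
      (Γ (t₀, x) s).1 = t₀ + s * ε := by
    intro x hx s hs
    have hd : ∀ s ∈ Icc (0 : ℝ) 1,
        HasDerivWithinAt (fun s => (Γ (t₀, x) s).1 - s * ε) 0 (Icc 0 1) s := by
      intro s hs
      have h1 : HasDerivAt (fun s => (Γ (t₀, x) s).1) (ε • V (Γ (t₀, x) s)).1 s :=
        (ContinuousLinearMap.fst ℝ ℝ E).hasFDerivAt.comp_hasDerivAt s (hΓ (t₀, x) s hs)
      rw [hVX (hball x hx s hs)] at h1
      have h2 := h1.sub ((hasDerivAt_id s).mul_const ε)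
      refine HasDerivAt.hasDerivWithinAt (h2.congr_deriv ?_)
      simp
    have := constant_of_derivWithin_zero (fun s hs => (hd s hs).differentiableWithinAt)
      (fun s hs => (hd s (Ico_subset_Icc_self hs)).derivWithin
        ((uniqueDiffOn_Icc zero_lt_one) s (Ico_subset_Icc_self hs))) s hs
    rw [Γ0] at this
    simp only [zero_mul, sub_zero] at this
    linarith
  have hι : ∀ x : E, HasFDerivAt (fun x : E => (t₀, x)) (ContinuousLinearMap.inr ℝ ℝ E) x :=
    fun x => hasFDerivAt_prodMk_right t₀ x
  have hΓd : ∀ s ∈ Icc (0 : ℝ) 1, ∀ x, HasFDerivAt (fun x => Γ (t₀, x) s)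
      ((fderiv ℝ (fun y => Γ y s) (t₀, x)).comp (ContinuousLinearMap.inr ℝ ℝ E)) x :=
    fun s hs x => (((hΓs s hs).differentiable (by simp) (t₀, x)).hasFDerivAt).comp x (hι x)
  have hη1 : ∀ x ∈ Metric.ball (0 : E) (r / 2), ∀ s ∈ Icc (0 : ℝ) 1, ∀ v : E,
      (fderiv ℝ (fun y => Γ y s) (t₀, x) (0, v)).1 = 0 := by
    intro x hx s hs v
    have h1 := (ContinuousLinearMap.fst ℝ ℝ E).hasFDerivAt.comp x (hΓd s hs x)
    have h2 : HasFDerivAt ((ContinuousLinearMap.fst ℝ ℝ E) ∘ fun x => Γ (t₀, x) s)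
        (0 : E →L[ℝ] ℝ) x := by
      refine (hasFDerivAt_const (t₀ + s * ε) x).congr_of_eventuallyEq ?_
      filter_upwards [Metric.isOpen_ball.mem_nhds hx] with x' hx'
      exact htime x' hx' s hs
    exact congrArg (fun A : E →L[ℝ] ℝ => A v) (h1.unique h2)
  let ψ : E → E := fun x => (Γ (t₀, x) 1).2
  have hψ : ContDiff ℝ ∞ ψ := by
    have : ContDiff ℝ ∞ fun x : E => (t₀, x) := contDiff_const.prodMk contDiff_id
    exact contDiff_snd.comp ((hΓs 1 hone).comp this)
  have hψd : ∀ x v, fderiv ℝ ψ x v = (fderiv ℝ (fun y => Γ y 1) (t₀, x) (0, v)).2 := by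
    intro x v
    have h1 := (ContinuousLinearMap.snd ℝ ℝ E).hasFDerivAt.comp x (hΓd 1 hone x)
    exact congrArg (fun A : E →L[ℝ] E => A v) h1.fderiv
  have h0ball : (0 : E) ∈ Metric.ball (0 : E) (r / 2) := Metric.mem_ball_self (half_pos hr)
  have hψ0 : ψ 0 = 0 := by
    have hmem : ∀ s ∈ Icc (0 : ℝ) 1, (t₀ + s * ε, (0 : E)) ∈ Metric.ball (t₀, (0 : E)) r := by
      intro s hs
      rw [Metric.mem_ball, Prod.dist_eq, dist_self, Real.dist_eq, add_sub_cancel_left, abs_mul,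
        abs_of_nonneg hs.1]
      refine max_lt ?_ hr
      nlinarith [abs_nonneg ε, abs_nonneg C, hs.1, hs.2, mul_nonneg (abs_nonneg ε) (abs_nonneg C)]
    have := integralCurve_unique hL (c := Γ (t₀, 0)) (d := fun s => (t₀ + s * ε, 0)) (hΓ _)
      (fun s hs => by
        have h1 : HasDerivAt (fun s : ℝ => (t₀ + s * ε, (0 : E))) (1 * ε, 0) s :=
          (((hasDerivAt_id s).mul_const ε).const_add t₀).prodMk (hasDerivAt_const s 0)
        refine h1.congr_deriv ?_
        rw [hVX (hmem s hs)]
        simp [hX0 _ (hrG (hmem s hs))]) (by simp [Γ0]) 1 hone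
    simp only [ψ, this]
  -- The derivative of the diffeomorphism `Φ` at `(t₀, 0)` sends vectors `(0, v)` to vectors without
  -- time component, so their spatial component determines `v`.
  have hinj : Function.Injective (fderiv ℝ ψ 0) := by
    rw [injective_iff_map_eq_zero]
    intro v hv
    have e1 : (fun y => Γ y 1) = Φ := funext Γ1
    have h1 : fderiv ℝ Φ (t₀, 0) (0, v) = 0 := by
      refine Prod.ext ?_ ?_
      · rw [← e1]; exact hη1 0 h0ball 1 hone v
      · rw [← e1, ← hψd]; exact hv
    have h2 := (hΦs.differentiable (by simp) (Φ (t₀, 0))).hasFDerivAt.comp (t₀, (0 : E))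
      (hΦ.differentiable (by simp) _).hasFDerivAt
    have h3 : (Φ.symm ∘ Φ) = id := funext fun y => Φ.symm_apply_apply y
    rw [h3] at h2
    have h4 := congrArg (fun A : ℝ × E →L[ℝ] ℝ × E => A (0, v)) (h2.unique (hasFDerivAt_id _))
    simp only [ContinuousLinearMap.comp_apply, h1, map_zero, ContinuousLinearMap.coe_id', id] at h4
    exact (congrArg Prod.snd h4).symm
  let ψ' : E ≃L[ℝ] E :=
    (LinearEquiv.ofInjectiveEndo (fderiv ℝ ψ 0 : E →ₗ[ℝ] E) hinj).toContinuousLinearEquiv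
  have hψ' : HasFDerivAt ψ (ψ' : E →L[ℝ] E) 0 := by
    have h1 := (hψ.differentiable (by simp) 0).hasFDerivAt
    have h2 : (ψ' : E →L[ℝ] E) = fderiv ℝ ψ 0 := by ext v; rfl
    rwa [h2]
  obtain ⟨Ψ, hΨ0, -, hΨ, hΨc⟩ := exists_isContactChart (α := fun x => A (t₀, x))
    (β := fun x => A (t₀ + ε, x)) Metric.isOpen_ball hψ.contDiffOn h0ball hψ' (fun x hx v => by
      have hμs : ContinuousOn (fun s => ε * μ (Γ (t₀, x) s)) (Icc 0 1) :=
        continuousOn_const.mul (hμ.comp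
          (fun s hs => (hΓ (t₀, x) s hs).continuousAt.continuousWithinAt)
          fun s hs => hrG (hball x hx s hs))
      -- By `hlie`, the form evaluated on a transported spatial vector solves `g' = ε μ g`, which
      -- preserves vanishing in both directions.
      obtain ⟨c, hc, hg⟩ := exists_pos_factor_of_hasDerivWithinAt hμs
      have h1 := hg (fun s => A (Γ (t₀, x) s) (fderiv ℝ (fun y => Γ y s) (t₀, x) (0, v)).2)
        fun s hs => by
          set y := Γ (t₀, x) s with hy
          set η := fderiv ℝ (fun y => Γ y s) (t₀, x) (0, v) with hη
          have hyB := hball x hx s hs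
          have hyG := hrG hyB
          have hAy := ((hA.contDiffAt (hG.mem_nhds hyG)).differentiableAt (by simp)).hasFDerivAt
          have hXy := ((hX.contDiffAt (hG.mem_nhds hyG)).differentiableAt (by simp)).hasFDerivAt
          have hVy : HasFDerivAt V ((0 : ℝ × E →L[ℝ] ℝ).prod (fderiv ℝ X y)) y := by
            refine ((hasFDerivAt_const (1 : ℝ) y).prodMk hXy).congr_of_eventuallyEq ?_
            filter_upwards [Metric.isOpen_ball.mem_nhds hyB] with z hz
            exact hVX hz
          have hεVy : fderiv ℝ (fun y => ε • V y) y =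
              ε • (0 : ℝ × E →L[ℝ] ℝ).prod (fderiv ℝ X y) := (hVy.const_smul ε).fderiv
          have d1 := hvar (t₀, x) (0, v) s hs
          rw [← hy, ← hη, hεVy] at d1
          have d2 : HasDerivWithinAt (fun s => (fderiv ℝ (fun y => Γ y s) (t₀, x) (0, v)).2)
              (ε • fderiv ℝ X y η) (Icc 0 1) s :=
            (ContinuousLinearMap.snd ℝ ℝ E).hasFDerivAt.comp_hasDerivWithinAt s d1
          have d3 : HasDerivWithinAt (fun s => A (Γ (t₀, x) s)) (fderiv ℝ A y (ε • V y))
              (Icc 0 1) s :=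
            hAy.comp_hasDerivWithinAt s (hΓ (t₀, x) s hs).hasDerivWithinAt
          refine (d3.clm_apply d2).congr_deriv ?_
          have hη0 : η = (0, η.2) := Prod.ext (hη1 x hx s hs v) rfl
          rw [hVX hyB]
          have := hlie y hyG η.2
          rw [← hη0] at this
          simp only [map_smul, _root_.smul_apply, smul_eq_mul]
          rw [mul_assoc, ← this]
          ring
      simp only [Γ0] at h1
      rw [← hψd] at h1
      have e1 : Γ (t₀, x) 1 = (t₀ + ε, ψ x) := by
        refine Prod.ext ?_ rfl
        rw [htime x hx 1 hone, one_mul]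
      rw [e1] at h1
      rw [h1]
      simp [hc.ne'])
  exact ⟨Ψ, hΨ0, (hΨ 0).trans hψ0, hΨc⟩

end Moser

/-! ### Solving Moser's equation along a linear path of forms. -/

section MoserField

open Set Filter Topology

variable {E : Type*} [NormedAddCommGroup E] [NormedSpace ℝ E]

theorem contDiffOn_smul_bilinear {X : Type*} [NormedAddCommGroup X] [NormedSpace ℝ X] {W : Set X}
    {f : X → ℝ} {g : X → E →L[ℝ] E →L[ℝ] ℝ} (hf : ContDiffOn ℝ ∞ f W) (hg : ContDiffOn ℝ ∞ g W) :
    ContDiffOn ℝ ∞ (fun x => f x • g x) W := by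
  have h : ContDiffOn ℝ ∞ (fun x => (g x).comp (f x • ContinuousLinearMap.id ℝ E)) W :=
    hg.clm_comp (hf.smul contDiffOn_const)
  refine h.congr fun x _ => ?_
  ext v w
  simp

theorem contDiff_bilinear_flip : ContDiff ℝ ∞ (fun f : E →L[ℝ] E →L[ℝ] ℝ => f.flip) :=
  IsBoundedLinearMap.contDiff ⟨⟨fun _ _ => rfl, fun _ _ => rfl⟩, 1, one_pos, fun f => by
    rw [f.opNorm_flip, one_mul]⟩

/-- The exterior derivative of a `1`-form. -/
noncomputable def dForm (α : E → E →L[ℝ] ℝ) (x : E) : E →L[ℝ] E →L[ℝ] ℝ :=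
  fderiv ℝ α x - (fderiv ℝ α x).flip

theorem dForm_apply (α : E → E →L[ℝ] ℝ) (x v w : E) :
    dForm α x v w = fderiv ℝ α x v w - fderiv ℝ α x w v := rfl

theorem dForm_swap (α : E → E →L[ℝ] ℝ) (x v w : E) : dForm α x v w = -dForm α x w v := by
  simp [dForm_apply]

theorem contDiffOn_dForm {α : E → E →L[ℝ] ℝ} {U : Set E} (hU : IsOpen U)
    (hα : ContDiffOn ℝ ∞ α U) : ContDiffOn ℝ ∞ (dForm α) U := by
  have h1 : ContDiffOn ℝ ∞ (fderiv ℝ α) U := hα.fderiv_of_isOpen hU (by simp)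
  exact h1.sub (contDiff_bilinear_flip.comp_contDiffOn h1)

variable [CompleteSpace E]

/-- The field that solves Moser's equation for the linear path between two `1`-forms. -/
theorem exists_moserField {α β : E → E →L[ℝ] ℝ} {U : Set E} (hU : IsOpen U) (hU0 : (0 : E) ∈ U)
    (hα : ContDiffOn ℝ ∞ α U) (hβ : ContDiffOn ℝ ∞ β U) (h0 : α 0 = β 0)
    (hd : dForm α 0 = dForm β 0) (M₀ : E ≃L[ℝ] (E →L[ℝ] ℝ))
    (hM₀ : ∀ v w, M₀ v w = dForm α 0 v w + α 0 v * α 0 w) {R₀ : E} (hR₀ : α 0 R₀ = 1)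
    (hR₀' : dForm α 0 R₀ = 0) (t₀ : ℝ) :
    ∃ (X : ℝ × E → E) (μ : ℝ × E → ℝ) (G : Set (ℝ × E)), IsOpen G ∧ (t₀, (0 : E)) ∈ G ∧
      ContDiffOn ℝ ∞ (fun y : ℝ × E => α y.2 + y.1 • (β y.2 - α y.2)) G ∧ ContDiffOn ℝ ∞ X G ∧
      ContinuousOn μ G ∧ (∀ t, X (t, 0) = 0) ∧
      ∀ y ∈ G, ∀ w, fderiv ℝ (fun y : ℝ × E => α y.2 + y.1 • (β y.2 - α y.2)) y (1, X y) w +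
        (α y.2 + y.1 • (β y.2 - α y.2)) (fderiv ℝ X y (0, w)) =
          μ y * (α y.2 + y.1 • (β y.2 - α y.2)) w := by
  let A : ℝ × E → E →L[ℝ] ℝ := fun y => α y.2 + y.1 • (β y.2 - α y.2)
  let D : ℝ × E → E →L[ℝ] E →L[ℝ] ℝ := fun y => dForm α y.2 + y.1 • (dForm β y.2 - dForm α y.2)
  -- Here `A` is the path of forms and `D` its spatial exterior derivative. Adding `A ⊗ A` makes the
  -- contact condition plain invertibility: `M⁻¹ A` is the Reeb vector `R`, and for `μ = δ(R)` the
  -- vector `X = M⁻¹(-δ + μ A)` satisfies both `A(X) = 0` and `D(X, ·) = -δ + μ A`.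
  let M : ℝ × E → E →L[ℝ] E →L[ℝ] ℝ := fun y => D y + (A y).smulRight (A y)
  let δ : ℝ × E → E →L[ℝ] ℝ := fun y => β y.2 - α y.2
  let W : Set (ℝ × E) := Prod.snd ⁻¹' U
  have hW : IsOpen W := hU.preimage continuous_snd
  have hsnd : ContDiffOn ℝ ∞ (Prod.snd : ℝ × E → E) W := contDiff_snd.contDiffOn
  have hfst : ContDiffOn ℝ ∞ (Prod.fst : ℝ × E → ℝ) W := contDiff_fst.contDiffOn
  have hmaps : MapsTo (Prod.snd : ℝ × E → E) W U := fun _ h => h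
  have hα' := hα.comp hsnd hmaps
  have hβ' := hβ.comp hsnd hmaps
  have hδ : ContDiffOn ℝ ∞ δ W := hβ'.sub hα'
  have hA : ContDiffOn ℝ ∞ A W := hα'.add (hfst.smul hδ)
  have hdα := (contDiffOn_dForm hU hα).comp hsnd hmaps
  have hdβ := (contDiffOn_dForm hU hβ).comp hsnd hmaps
  have hD : ContDiffOn ℝ ∞ D W := hdα.add (contDiffOn_smul_bilinear hfst (hdβ.sub hdα))
  have hM : ContDiffOn ℝ ∞ M W := hD.add (hA.smulRight hA)
  let G₁ : Set (ℝ × E) := W ∩ M ⁻¹' range ((↑) : (E ≃L[ℝ] (E →L[ℝ] ℝ)) → E →L[ℝ] E →L[ℝ] ℝ)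
  have hG₁ : IsOpen G₁ := hM.continuousOn.isOpen_inter_preimage hW ContinuousLinearEquiv.isOpen
  let N : ℝ × E → (E →L[ℝ] ℝ) →L[ℝ] E := fun y => (M y).inverse
  have hN : ContDiffOn ℝ ∞ N G₁ := by
    intro y hy
    obtain ⟨e, he⟩ := hy.2
    have h1 : ContDiffAt ℝ ∞ ContinuousLinearMap.inverse (M y) := by
      rw [← he]; exact contDiffAt_map_inverse e
    exact (h1.comp y (hM.contDiffAt (hW.mem_nhds hy.1))).contDiffWithinAt
  have hMN : ∀ y ∈ G₁, ∀ l, M y (N y l) = l := by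
    intro y hy l
    obtain ⟨e, he⟩ := hy.2
    simp only [N]
    rw [← he, ContinuousLinearMap.inverse_equiv]
    exact e.apply_symm_apply l
  have hNM : ∀ y ∈ G₁, ∀ v, N y (M y v) = v := by
    intro y hy v
    obtain ⟨e, he⟩ := hy.2
    simp only [N]
    rw [← he, ContinuousLinearMap.inverse_equiv]
    exact e.symm_apply_apply v
  let R : ℝ × E → E := fun y => N y (A y)
  have hAG₁ : ContDiffOn ℝ ∞ A G₁ := hA.mono inter_subset_left
  have hδG₁ : ContDiffOn ℝ ∞ δ G₁ := hδ.mono inter_subset_left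
  have hR : ContDiffOn ℝ ∞ R G₁ := hN.clm_apply hAG₁
  have hAR : ContDiffOn ℝ ∞ (fun y => A y (R y)) G₁ := hAG₁.clm_apply hR
  -- Evaluating `M R = A` on `R` gives `A(R)² = A(R)`, so excluding the zero value forces `A(R) =
  -- 1`.
  let G : Set (ℝ × E) := G₁ ∩ (fun y => A y (R y)) ⁻¹' {0}ᶜ
  have hG : IsOpen G := hAR.continuousOn.isOpen_inter_preimage hG₁ isOpen_compl_singleton
  let μ : ℝ × E → ℝ := fun y => δ y (R y)
  let X : ℝ × E → E := fun y => N y (-δ y + μ y • A y)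
  have hμ : ContDiffOn ℝ ∞ μ G₁ := hδG₁.clm_apply hR
  have hX : ContDiffOn ℝ ∞ X G₁ := hN.clm_apply (hδG₁.neg.add (hμ.smul hAG₁))
  have hA0 : ∀ t, A (t, 0) = α 0 := fun t => by simp [A, h0]
  have hM0 : ∀ t, M (t, 0) = M₀ := fun t => by
    ext v w
    simp [M, hA0, D, ← hd, hM₀]
  have hG₁0 : ∀ t, (t, (0 : E)) ∈ G₁ := fun t => ⟨hU0, ⟨M₀, (hM0 t).symm⟩⟩
  have hR0 : ∀ t, R (t, 0) = R₀ := fun t => by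
    have h1 : M (t, 0) R₀ = A (t, 0) := by
      ext w
      rw [hM0, hA0]
      simp [hM₀, hR₀, hR₀']
    simp only [R]
    rw [← h1, hNM _ (hG₁0 t)]
  have hDswap : ∀ y v w, D y v w = -D y w v := by
    intro y v w
    simp only [D, _root_.add_apply, _root_.smul_apply, _root_.sub_apply, smul_eq_mul,
      dForm_swap α y.2 v w, dForm_swap β y.2 v w]
    ring
  have hMapp : ∀ y v w, M y v w = D y v w + A y v * A y w := fun y v w => by simp [M]
  refine ⟨X, μ, G, hG, ⟨hG₁0 t₀, ?_⟩, hAG₁.mono inter_subset_left, hX.mono inter_subset_left,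
    hμ.continuousOn.mono inter_subset_left, fun t => ?_, fun y hy w => ?_⟩
  · simp only [mem_preimage, mem_compl_iff, mem_singleton_iff, hA0, hR0, hR₀]
    exact one_ne_zero
  · have h1 : δ (t, 0) = 0 := by simp [δ, h0]
    simp [X, μ, h1]
  · change fderiv ℝ A y (1, X y) w + A y (fderiv ℝ X y (0, w)) = μ y * A y w
    have hARX : ∀ z ∈ G, A z (R z) = 1 ∧ (∀ w, D z (R z) w = 0) ∧ A z (X z) = 0 ∧
        ∀ w, D z (X z) w = -δ z w + μ z * A z w := by
      intro z hz
      have m1 : ∀ w, D z (R z) w + A z (R z) * A z w = A z w := fun w => by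
        rw [← hMapp]; exact congrArg (fun l : E →L[ℝ] ℝ => l w) (hMN z hz.1 (A z))
      have hRR : D z (R z) (R z) = 0 := by linarith [hDswap z (R z) (R z)]
      have hAR1 : A z (R z) = 1 := by
        have h1 := m1 (R z)
        rw [hRR, zero_add] at h1
        exact mul_left_cancel₀ hz.2 (by rw [h1, mul_one])
      have hDR : ∀ w, D z (R z) w = 0 := fun w => by
        have := m1 w; rw [hAR1] at this; linarith
      have m2 : ∀ w, D z (X z) w + A z (X z) * A z w = -δ z w + μ z * A z w := fun w => by
        rw [← hMapp]
        exact congrArg (fun l : E →L[ℝ] ℝ => l w) (hMN z hz.1 (-δ z + μ z • A z))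
      have hAX : A z (X z) = 0 := by
        have h1 := m2 (R z)
        rw [hDswap, hDR, hAR1] at h1
        have h2 : μ z = δ z (R z) := rfl
        linarith
      refine ⟨hAR1, hDR, hAX, fun w => ?_⟩
      have := m2 w
      rw [hAX] at this
      linarith
    obtain ⟨-, -, -, hDX⟩ := hARX y hy
    have hyW : y ∈ W := hy.1.1
    have hXd : HasFDerivAt X (fderiv ℝ X y) y :=
      ((hX.contDiffAt (hG₁.mem_nhds hy.1)).differentiableAt (by simp)).hasFDerivAt
    have hAd : HasFDerivAt A (fderiv ℝ A y) y :=
      ((hA.contDiffAt (hW.mem_nhds hyW)).differentiableAt (by simp)).hasFDerivAt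
    -- Cartan's formula in coordinates: differentiating `A(X) = 0` trades the term with the
    -- derivative of `X` for the missing half of `D(X, w)`.
    have hAX0 : fderiv ℝ A y (0, w) (X y) + A y (fderiv ℝ X y (0, w)) = 0 := by
      have h1 : HasFDerivAt (fun z => A z (X z)) (0 : ℝ × E →L[ℝ] ℝ) y := by
        refine (hasFDerivAt_const (0 : ℝ) y).congr_of_eventuallyEq ?_
        filter_upwards [hG.mem_nhds hy] with z hz
        exact (hARX z hz).2.2.1
      have h2 := congrArg (fun l : ℝ × E →L[ℝ] ℝ => l (0, w)) ((hAd.clm_apply hXd).unique h1)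
      simp only [_root_.add_apply, ContinuousLinearMap.comp_apply, ContinuousLinearMap.flip_apply,
        _root_.zero_apply] at h2
      linarith
    have hαy := ((hα.contDiffAt (hU.mem_nhds hyW)).differentiableAt (by simp)).hasFDerivAt
    have hβy := ((hβ.contDiffAt (hU.mem_nhds hyW)).differentiableAt (by simp)).hasFDerivAt
    have hα2 : HasFDerivAt (fun z : ℝ × E => α z.2) _ y := hαy.comp y hasFDerivAt_snd
    have hβ2 : HasFDerivAt (fun z : ℝ × E => β z.2) _ y := hβy.comp y hasFDerivAt_snd
    have hAy : HasFDerivAt A _ y := hα2.add (hasFDerivAt_fst.smul (hβ2.sub hα2))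
    have hAapp : ∀ τ v u, fderiv ℝ A y (τ, v) u = fderiv ℝ α y.2 v u +
        y.1 * (fderiv ℝ β y.2 v u - fderiv ℝ α y.2 v u) + τ * δ y u := by
      intro τ v u
      rw [hAy.fderiv]
      simp [δ]
      ring
    have hDXw := hDX w
    simp only [D, _root_.add_apply, _root_.smul_apply, _root_.sub_apply, smul_eq_mul,
      dForm_apply] at hDXw
    rw [hAapp] at hAX0 ⊢
    linarith

/-- Darboux's theorem by Moser's method: two `1`-forms whose values and exterior derivatives agree
at the origin, where they satisfy the contact condition, have equivalent germs. -/
theorem contactGermEquiv_of_dForm_eq [FiniteDimensional ℝ E] {α β : E → E →L[ℝ] ℝ} {U : Set E}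
    (hU : IsOpen U) (hU0 : (0 : E) ∈ U)
    (hα : ContDiffOn ℝ ∞ α U) (hβ : ContDiffOn ℝ ∞ β U) (h0 : α 0 = β 0)
    (hd : dForm α 0 = dForm β 0) (M₀ : E ≃L[ℝ] (E →L[ℝ] ℝ))
    (hM₀ : ∀ v w, M₀ v w = dForm α 0 v w + α 0 v * α 0 w) {R₀ : E} (hR₀ : α 0 R₀ = 1)
    (hR₀' : dForm α 0 R₀ = 0) : ContactGermEquiv α β := by
  let A : ℝ → E → E →L[ℝ] ℝ := fun t x => α x + t • (β x - α x)
  -- The flow is available only for short times. Every form of the path has the same value and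
  -- exterior derivative at the origin, so this works near each `t₀`; since germ equivalence is an
  -- equivalence relation, the class of `A 0` is open and closed in `ℝ`.
  have hloc : ∀ t₀, ∀ᶠ t in 𝓝 t₀, ContactGermEquiv (A t₀) (A t) := by
    intro t₀
    obtain ⟨X, μ, G, hG, hG0, hA, hX, hμ, hX0, hlie⟩ :=
      exists_moserField hU hU0 hα hβ h0 hd M₀ hM₀ hR₀ hR₀' t₀
    have h1 := eventually_contactGermEquiv_of_moserField hG hG0 hA hX hμ (fun t _ => hX0 t) hlie
    have h2 : Tendsto (fun t : ℝ => t - t₀) (𝓝 t₀) (𝓝 0) := by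
      have : Tendsto (fun t : ℝ => t - t₀) (𝓝 t₀) (𝓝 (t₀ - t₀)) := by
        apply Continuous.tendsto; fun_prop
      rwa [sub_self] at this
    filter_upwards [h2.eventually h1] with t ht
    simpa using ht
  have hopen : IsOpen {t | ContactGermEquiv (A 0) (A t)} := isOpen_iff_mem_nhds.2 fun t ht => by
    filter_upwards [hloc t] with s hs
    exact ContactGermEquiv.trans ht hs
  have hclosed : IsClosed {t | ContactGermEquiv (A 0) (A t)} := by
    rw [← isOpen_compl_iff]
    refine isOpen_iff_mem_nhds.2 fun t ht => ?_
    filter_upwards [hloc t] with s hs hs'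
    exact ht (ContactGermEquiv.trans hs' hs.symm)
  have huniv := IsClopen.eq_univ ⟨hclosed, hopen⟩ ⟨0, ContactGermEquiv.refl _⟩
  have h1 : ContactGermEquiv (A 0) (A 1) := by
    have : (1 : ℝ) ∈ {t | ContactGermEquiv (A 0) (A t)} := by rw [huniv]; trivial
    exact this
  have e0 : A 0 = α := by ext x : 1; simp [A]
  have e1 : A 1 = β := by ext x : 1; simp [A]
  rwa [e0, e1] at h1

end MoserField

/-! ### Darboux's theorem -/

section Darboux

open Set Filter Topology

variable {n : ℕ} {E : Type*} [NormedAddCommGroup E] [NormedSpace ℝ E]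

/-- A Reeb vector of a contact form at a point. -/
theorem exists_reebVector [FiniteDimensional ℝ E] {θ : E →L[ℝ] ℝ} {η : E →L[ℝ] E →L[ℝ] ℝ}
    (hη : ∀ v w, η v w = -η w v) (hθ : θ ≠ 0)
    (hnd : ∀ v, θ v = 0 → (∀ w, θ w = 0 → η v w = 0) → v = 0) :
    ∃ R, θ R = 1 ∧ η R = 0 := by
  obtain ⟨R₀, hR₀⟩ : ∃ R₀, θ R₀ = 1 := by
    obtain ⟨v, hv⟩ := DFunLike.ne_iff.1 hθ
    exact ⟨(θ v)⁻¹ • v, by simpa using inv_mul_cancel₀ hv⟩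
  let H : Submodule ℝ E := LinearMap.ker (θ : E →ₗ[ℝ] ℝ)
  let B : H →ₗ[ℝ] Module.Dual ℝ H :=
    LinearMap.mk₂ ℝ (fun v w : H => η v w) (by simp) (by simp) (by simp) (by simp)
  have hB : Function.Injective B := by
    rw [injective_iff_map_eq_zero]
    intro v hv
    refine Subtype.ext (hnd v v.2 fun w hw => ?_)
    exact congrArg (fun l : Module.Dual ℝ H => l ⟨w, hw⟩) hv
  have hBs : Function.Surjective B :=
    (LinearMap.injective_iff_surjective_of_finrank_eq_finrank
      (Subspace.dual_finrank_eq (K := ℝ) (V := H)).symm).1 hB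
  -- Nondegeneracy on the hyperplane provides a correction `k` in it that cancels `η R₀` there.
  obtain ⟨k, hk⟩ := hBs ((-η R₀ : E →L[ℝ] ℝ).toLinearMap.domRestrict H)
  have hk' : ∀ w, θ w = 0 → η k w = -η R₀ w := fun w hw =>
    congrArg (fun l : Module.Dual ℝ H => l ⟨w, hw⟩) hk
  have hkθ : θ k = 0 := k.2
  refine ⟨R₀ + k, by rw [map_add, hR₀, hkθ, add_zero], ?_⟩
  have hker : ∀ w, θ w = 0 → η (R₀ + k) w = 0 := fun w hw => by
    rw [map_add, _root_.add_apply, hk' w hw, add_neg_cancel]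
  ext w
  have h1 : w = (w - θ w • (R₀ + k)) + θ w • (R₀ + k) := by abel
  have h2 : θ (w - θ w • (R₀ + (k : E))) = 0 := by simp [hR₀, hkθ]
  have h3 : η (R₀ + k) (R₀ + k) = 0 := by linarith [hη (R₀ + k) (R₀ + k)]
  rw [h1, map_add, hker _ h2, map_smul, h3]
  simp

/-- A linear frame in which a contact form, its exterior derivative and a given Lagrangian
subspace are standard. -/
theorem exists_adaptedFrame [FiniteDimensional ℝ E] (hE : Module.finrank ℝ E = 2 * n + 1)
    {θ : E →L[ℝ] ℝ} {η : E →L[ℝ] E →L[ℝ] ℝ} (hη : ∀ v w, η v w = -η w v)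
    (hnd : ∀ v, θ v = 0 → (∀ w, θ w = 0 → η v w = 0) → v = 0)
    {ι : (Fin n → ℝ) →L[ℝ] E} (hι : Function.Injective ι) (hθι : ∀ a, θ (ι a) = 0)
    (hηι : ∀ a b, η (ι a) (ι b) = 0) {R : E} (hR : θ R = 1) :
    ∃ M : StdContactSpace n ≃L[ℝ] E, (∀ a, M (a, 0, 0) = ι a) ∧ (∀ c, M (0, 0, c) = c • R) ∧
      (∀ u, θ (M u) = u.2.2) ∧ ∀ u v, u.2.2 = 0 → v.2.2 = 0 →
        η (M u) (M v) = ∑ i, (u.1 i * v.2.1 i - u.2.1 i * v.1 i) := by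
  let H : Submodule ℝ E := LinearMap.ker (θ : E →ₗ[ℝ] ℝ)
  let B : (Fin n → ℝ) →ₗ[ℝ] H →ₗ[ℝ] ℝ :=
    LinearMap.mk₂ ℝ (fun a (w : H) => η (ι a) w) (by simp) (by simp) (by simp) (by simp)
  have hB : Function.Injective B := by
    rw [injective_iff_map_eq_zero]
    intro a ha
    refine (map_eq_zero_iff ι hι).1 (hnd _ (hθι a) fun w hw => ?_)
    exact congrArg (fun l : H →ₗ[ℝ] ℝ => l ⟨w, hw⟩) ha
  have hBs : Function.Surjective B.flip := LinearMap.flip_surjective_iff₁.2 hB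
  choose f hf using fun j : Fin n => hBs (LinearMap.proj j)
  have hf' : ∀ a j, η (ι a) (f j) = a j := fun a j =>
    congrArg (fun l : (Fin n → ℝ) →ₗ[ℝ] ℝ => l a) (hf j)
  have hfθ : ∀ j, θ (f j) = 0 := fun j => (f j).2
  -- The vectors `f j` are dual to `ι` but may pair nontrivially with each other. Moving each along
  -- `ι` by half of these pairings cancels them by antisymmetry and keeps the duality.
  let c : Fin n → Fin n → ℝ := fun j k => 1 / 2 * η (f k) (f j)
  let g : Fin n → E := fun j => f j + ι (c j)
  have hgθ : ∀ j, θ (g j) = 0 := fun j => by simp [g, hfθ, hθι]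
  have hιg : ∀ a j, η (ι a) (g j) = a j := fun a j => by simp [g, hf', hηι]
  have hgι : ∀ a j, η (g j) (ι a) = -a j := fun a j => by rw [hη, hιg]
  have hgg : ∀ i j, η (g i) (g j) = 0 := fun i j => by
    have h1 : η (g i) (g j) = η (f i) (f j) + η (f i) (ι (c j)) + (η (ι (c i)) (g j)) := by
      simp only [g, map_add, _root_.add_apply]; ring
    rw [h1, hιg, hη (f i) (ι (c j)), hf']
    simp only [c]
    rw [hη (f j) (f i)]
    ring
  let L : StdContactSpace n →ₗ[ℝ] E :=
    { toFun := fun u => ι u.1 + ∑ j, u.2.1 j • g j + u.2.2 • R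
      map_add' := fun u v => by
        simp only [Prod.fst_add, Prod.snd_add, Pi.add_apply, map_add, add_smul,
          Finset.sum_add_distrib]
        abel
      map_smul' := fun r u => by
        simp only [Prod.smul_fst, Prod.smul_snd, Pi.smul_apply, map_smul, smul_add, Finset.smul_sum,
          smul_smul, smul_eq_mul, RingHom.id_apply] }
  have hL : ∀ u, L u = ι u.1 + ∑ j, u.2.1 j • g j + u.2.2 • R := fun _ => rfl
  have hLθ : ∀ u, θ (L u) = u.2.2 := fun u => by simp [hL, hθι, hgθ, hR]
  have hLη : ∀ u v, u.2.2 = 0 → v.2.2 = 0 →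
      η (L u) (L v) = ∑ i, (u.1 i * v.2.1 i - u.2.1 i * v.1 i) := by
    intro u v hu hv
    have hg1 : ∀ i, η (g i) (∑ j, v.2.1 j • g j) = 0 := fun i => by simp [hgg]
    have h1 : η (ι u.1) (∑ j, v.2.1 j • g j) = ∑ i, u.1 i * v.2.1 i := by
      simp [hιg, mul_comm]
    have h2 : η (∑ j, u.2.1 j • g j) (ι v.1) = -∑ i, u.2.1 i * v.1 i := by
      simp [hgι]
    have h3 : η (∑ j, u.2.1 j • g j) (∑ j, v.2.1 j • g j) = 0 := by
      rw [map_sum]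
      refine Finset.sum_eq_zero fun i _ => ?_
      have h4 : η (∑ j, u.2.1 j • g j) (g i) = 0 := by
        rw [hη, map_sum, Finset.sum_eq_zero fun j _ => by rw [map_smul, hgg, smul_zero], neg_zero]
      rw [map_smul, h4, smul_zero]
    rw [hL, hL, hu, hv, zero_smul, add_zero, add_zero]
    simp only [map_add, _root_.add_apply]
    rw [hηι, h1, h2, h3, Finset.sum_sub_distrib]
    ring
  have hLinj : Function.Injective L := by
    rw [injective_iff_map_eq_zero]
    intro u hu
    have hz : u.2.2 = 0 := by rw [← hLθ, hu, map_zero]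
    have hq : ∀ i, u.1 i = 0 := fun i => by
      have := hLη u (0, Pi.single i 1, 0) hz rfl
      rw [hu] at this
      simpa [Pi.single_apply] using this.symm
    have hp : ∀ i, u.2.1 i = 0 := fun i => by
      have := hLη u (Pi.single i 1, 0, 0) hz rfl
      rw [hu] at this
      simpa [Pi.single_apply] using this.symm
    exact Prod.ext (funext hq) (Prod.ext (funext hp) hz)
  have hfin : Module.finrank ℝ (StdContactSpace n) = Module.finrank ℝ E := by
    rw [hE]
    simp [StdContactSpace]
    ring
  let M : StdContactSpace n ≃L[ℝ] E :=
    (LinearMap.linearEquivOfInjective L hLinj hfin).toContinuousLinearEquiv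
  have hM : ∀ u, M u = L u := fun u => rfl
  refine ⟨M, fun a => ?_, fun c => ?_, fun u => by rw [hM, hLθ], fun u v hu hv => by
    rw [hM, hM, hLη u v hu hv]⟩
  · rw [hM, hL]; simp
  · rw [hM, hL]; simp

/-- Near a boundary point, the tangent map of a Legendrian half space is isotropic. -/
theorem dForm_eq_zero_of_halfSpace [NeZero n] {F : (Fin n → ℝ) → E} {O : Set (Fin n → ℝ)}
    (hO : IsOpen O) (hO0 : (0 : Fin n → ℝ) ∈ O) (hF : ContDiffOn ℝ ∞ F O) {β : E → E →L[ℝ] ℝ}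
    {U : Set E} (hU : IsOpen U) (hFU : F 0 ∈ U) (hβ : ContDiffOn ℝ ∞ β U)
    (h : ∀ u ∈ O, 0 ≤ u 0 → ∀ v, β (F u) (fderiv ℝ F u v) = 0) (v w : Fin n → ℝ) :
    dForm β (F 0) (fderiv ℝ F 0 v) (fderiv ℝ F 0 w) = 0 := by
  have hF0 : ContDiffAt ℝ ∞ F 0 := hF.contDiffAt (hO.mem_nhds hO0)
  have hdF : HasFDerivAt F (fderiv ℝ F 0) 0 := (hF0.differentiableAt (by simp)).hasFDerivAt
  have hddF : HasFDerivAt (fderiv ℝ F) (fderiv ℝ (fderiv ℝ F) 0) 0 :=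
    ((hF0.fderiv_right (m := ∞) (by simp)).differentiableAt (by simp)).hasFDerivAt
  have hdβ : HasFDerivAt β (fderiv ℝ β (F 0)) (F 0) :=
    ((hβ.contDiffAt (hU.mem_nhds hFU)).differentiableAt (by simp)).hasFDerivAt
  have hsymm : ∀ v w, fderiv ℝ (fderiv ℝ F) 0 v w = fderiv ℝ (fderiv ℝ F) 0 w v := fun v w =>
    hF0.isSymmSndFDerivAt (by simpa using WithTop.coe_le_coe.2 (le_top (a := (2 : ℕ∞)))) v w
  let S : Set (Fin n → ℝ) := {u | 0 ≤ u 0}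
  -- Tangency is known on the half space only, but derivatives within it are unique at the boundary
  -- point, so the identity can be differentiated there in every direction.
  have hS : UniqueDiffWithinAt ℝ S 0 := by
    refine uniqueDiffOn_convex ?_ ⟨fun _ => (1 : ℝ), ?_⟩ (0 : Fin n → ℝ) (le_refl (0 : ℝ))
    · intro x hx y hy a b ha hb _
      change 0 ≤ a * x 0 + b * y 0
      exact add_nonneg (mul_nonneg ha hx) (mul_nonneg hb hy)
    · have h1 : IsOpen {u : Fin n → ℝ | 0 < u 0} := isOpen_lt continuous_const (continuous_apply 0)
      have h2 : {u : Fin n → ℝ | 0 < u 0} ⊆ S := fun u (hu : 0 < u 0) =>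
        show 0 ≤ u 0 from hu.le
      exact interior_maximal h2 h1 (zero_lt_one (α := ℝ))
  have key : ∀ v w, fderiv ℝ β (F 0) (fderiv ℝ F 0 v) (fderiv ℝ F 0 w) +
      β (F 0) (fderiv ℝ (fderiv ℝ F) 0 v w) = 0 := by
    intro v w
    have h1 := (hdβ.comp 0 hdF).clm_apply (hddF.clm_apply (hasFDerivAt_const w 0))
    have h2 : HasFDerivWithinAt (fun u => (β ∘ F) u (fderiv ℝ F u w))
        (0 : (Fin n → ℝ) →L[ℝ] ℝ) S 0 := by
      refine (hasFDerivWithinAt_const (0 : ℝ) 0 S).congr_of_eventuallyEq ?_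
        (h 0 hO0 (le_refl (0 : ℝ)) w)
      filter_upwards [self_mem_nhdsWithin, mem_nhdsWithin_of_mem_nhds (hO.mem_nhds hO0)]
        with u hu hu'
      exact h u hu' hu w
    have h3 := congrArg (fun l : (Fin n → ℝ) →L[ℝ] ℝ => l v) (hS.eq h1.hasFDerivWithinAt h2)
    simp at h3
    linarith
  -- Antisymmetrising `key` removes the second derivative of `F`, which is symmetric.
  rw [dForm_apply]
  have h1 := key v w
  have h2 := key w v
  rw [hsymm w v] at h2
  linarith

/-- The symmetric part of the standard contact form. -/
noncomputable def polarBilin (n : ℕ) : StdContactSpace n →L[ℝ] StdContactSpace n →L[ℝ] ℝ :=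
  ∑ i, (1 / 2 : ℝ) • ((qCoord n i).smulRight (pCoord n i) - (pCoord n i).smulRight (qCoord n i))

/-- The contact form `dz + ∑ i, (q i dp i - p i dq i) / 2`. -/
noncomputable def polarForm (n : ℕ) (u : StdContactSpace n) : StdContactSpace n →L[ℝ] ℝ :=
  zCoord n + polarBilin n u

theorem polarBilin_apply (u v : StdContactSpace n) :
    polarBilin n u v = 1 / 2 * ∑ i, (u.1 i * v.2.1 i - u.2.1 i * v.1 i) := by
  simp only [polarBilin, _root_.sum_apply, _root_.smul_apply, _root_.sub_apply,
    ContinuousLinearMap.smulRight_apply, qCoord_apply, pCoord_apply, smul_eq_mul, Finset.mul_sum]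

theorem polarForm_apply (u v : StdContactSpace n) :
    polarForm n u v = v.2.2 + 1 / 2 * ∑ i, (u.1 i * v.2.1 i - u.2.1 i * v.1 i) := by
  simp [polarForm, polarBilin_apply]

theorem contDiff_polarForm : ContDiff ℝ ∞ (polarForm n) :=
  contDiff_const.add (polarBilin n).contDiff

theorem dForm_polarForm (x u v : StdContactSpace n) :
    dForm (polarForm n) x u v = ∑ i, (u.1 i * v.2.1 i - u.2.1 i * v.1 i) := by
  have h1 : fderiv ℝ (polarForm n) x = polarBilin n :=
    ((polarBilin n).hasFDerivAt.const_add (zCoord n)).fderiv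
  rw [dForm_apply, h1, polarBilin_apply, polarBilin_apply, ← mul_sub, ← Finset.sum_sub_distrib,
    Finset.mul_sum]
  exact Finset.sum_congr rfl fun i _ => by ring

theorem finrank_stdContactSpace : Module.finrank ℝ (StdContactSpace n) = 2 * n + 1 := by
  simp [StdContactSpace]; ring

/-- The nondegenerate bilinear form `dα + α ⊗ α` at the origin, for the polar contact form. -/
theorem exists_polarForm_equiv :
    ∃ M₀ : StdContactSpace n ≃L[ℝ] (StdContactSpace n →L[ℝ] ℝ),
      ∀ v w, M₀ v w = dForm (polarForm n) 0 v w + polarForm n 0 v * polarForm n 0 w := by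
  let A : StdContactSpace n →L[ℝ] StdContactSpace n →L[ℝ] ℝ :=
    dForm (polarForm n) 0 + (polarForm n 0).smulRight (polarForm n 0)
  have hA : ∀ v w, A v w = dForm (polarForm n) 0 v w + polarForm n 0 v * polarForm n 0 w :=
    fun v w => by simp [A]
  have hA' : ∀ v w, A v w = ∑ i, (v.1 i * w.2.1 i - v.2.1 i * w.1 i) + v.2.2 * w.2.2 :=
    fun v w => by rw [hA, dForm_polarForm, polarForm_apply, polarForm_apply]; simp
  have hinj : Function.Injective A := by
    rw [injective_iff_map_eq_zero]
    intro v hv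
    have h : ∀ w : StdContactSpace n, ∑ i, (v.1 i * w.2.1 i - v.2.1 i * w.1 i) + v.2.2 * w.2.2 = 0 := fun w => by
      rw [← hA', hv]; rfl
    have hq : ∀ i, v.1 i = 0 := fun i => by
      simpa [Pi.single_apply] using h (0, Pi.single i 1, 0)
    have hp : ∀ i, v.2.1 i = 0 := fun i => by
      simpa [Pi.single_apply] using h (Pi.single i 1, 0, 0)
    have hz : v.2.2 = 0 := by simpa using h (0, 0, 1)
    exact Prod.ext (funext hq) (Prod.ext (funext hp) hz)
  have hfin : Module.finrank ℝ (StdContactSpace n) =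
      Module.finrank ℝ (StdContactSpace n →L[ℝ] ℝ) := by
    rw [← (LinearMap.toContinuousLinearMap (𝕜 := ℝ) (E := StdContactSpace n)
      (F' := ℝ)).finrank_eq]
    exact (Subspace.dual_finrank_eq (K := ℝ) (V := StdContactSpace n)).symm
  exact ⟨(LinearMap.linearEquivOfInjective (A : StdContactSpace n →ₗ[ℝ]
    (StdContactSpace n →L[ℝ] ℝ)) hinj hfin).toContinuousLinearEquiv, fun v w => hA v w⟩

/-- **Darboux's theorem** for a contact form, at a point where an isotropic subspace of half the
dimension of the contact hyperplane is given. -/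
theorem exists_darbouxChart [FiniteDimensional ℝ E] (hE : Module.finrank ℝ E = 2 * n + 1)
    {α : E → E →L[ℝ] ℝ} {U : Set E} (hU : IsOpen U) {a : E} (ha : a ∈ U)
    (hα : ContDiffOn ℝ ∞ α U) (hα0 : α a ≠ 0)
    (hnd : ∀ v, α a v = 0 → (∀ w, α a w = 0 → dForm α a v w = 0) → v = 0)
    {ι : (Fin n → ℝ) →L[ℝ] E} (hι : Function.Injective ι) (hθι : ∀ b, α a (ι b) = 0)
    (hηι : ∀ b c, dForm α a (ι b) (ι c) = 0) :
    ∃ ψ : OpenPartialHomeomorph (StdContactSpace n) E, 0 ∈ ψ.source ∧ ψ 0 = a ∧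
      IsContactChart (polarForm n) α ψ := by
  obtain ⟨R, hR, hR'⟩ := exists_reebVector (dForm_swap α a) hα0 hnd
  obtain ⟨M, -, hMR, hMθ, hMη⟩ := exists_adaptedFrame hE (dForm_swap α a) hnd hι hθι hηι hR
  let φ : StdContactSpace n ≃ E := M.toEquiv.trans (Equiv.addLeft a)
  have hφ : ∀ u, φ u = a + M u := fun _ => rfl
  have hφd : ∀ u, HasFDerivAt φ (M : StdContactSpace n →L[ℝ] E) u := fun u =>
    (M : StdContactSpace n →L[ℝ] E).hasFDerivAt.const_add a
  let β : StdContactSpace n → StdContactSpace n →L[ℝ] ℝ := fun u =>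
    (α (φ u)).comp (M : StdContactSpace n →L[ℝ] E)
  have hφs : ContDiff ℝ ∞ φ := contDiff_const.add M.contDiff
  have hφe : IsContactEquiv β α φ :=
    ⟨hφs, M.symm.contDiff.comp (contDiff_const.add contDiff_id), fun u =>
      ⟨1, one_ne_zero, fun v => by rw [(hφd u).fderiv, one_mul]; rfl⟩⟩
  let U' : Set (StdContactSpace n) := φ ⁻¹' U
  have hU' : IsOpen U' := hU.preimage hφs.continuous
  have hφ0 : φ 0 = a := by simp [hφ]
  have hU'0 : (0 : StdContactSpace n) ∈ U' := by rw [mem_preimage, hφ0]; exact ha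
  have hβ : ContDiffOn ℝ ∞ β U' :=
    (hα.comp hφs.contDiffOn fun _ h => h).clm_comp contDiffOn_const
  have h0 : polarForm n 0 = β 0 := by
    refine ContinuousLinearMap.ext fun v => ?_
    have : β 0 v = v.2.2 := by simp only [β, hφ0]; exact hMθ v
    rw [this, polarForm_apply]
    simp
  have hβd : ∀ v w, dForm β 0 v w = dForm α a (M v) (M w) := by
    intro v w
    have h1 : HasFDerivAt α (fderiv ℝ α a) (φ 0) := by
      rw [hφ0]
      exact ((hα.contDiffAt (hU.mem_nhds ha)).differentiableAt (by simp)).hasFDerivAt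
    have h2 : HasFDerivAt β _ 0 := (h1.comp 0 (hφd 0)).clm_comp
      (hasFDerivAt_const (M : StdContactSpace n →L[ℝ] E) 0)
    rw [dForm_apply, h2.fderiv, dForm_apply]
    simp
  have hd : dForm (polarForm n) 0 = dForm β 0 := by
    refine ContinuousLinearMap.ext fun v => ContinuousLinearMap.ext fun w => ?_
    have hsplit : ∀ u : StdContactSpace n, M u = M (u.1, u.2.1, 0) + u.2.2 • R := fun u => by
      rw [← hMR, ← map_add]; simp
    have hRl : ∀ x, dForm α a x R = 0 := fun x => by rw [dForm_swap, hR']; simp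
    rw [hβd, dForm_polarForm, hsplit v, hsplit w]
    simp only [map_add, map_smul, hR', hRl, smul_zero, add_zero]
    rw [hMη _ _ rfl rfl]
  obtain ⟨M₀, hM₀⟩ := exists_polarForm_equiv (n := n)
  obtain ⟨ψ, hψ0, hψ00, hψ⟩ := contactGermEquiv_of_dForm_eq hU' hU'0
    contDiff_polarForm.contDiffOn hβ h0 hd M₀ hM₀ (R₀ := (0, 0, 1))
    (by rw [polarForm_apply]; simp) (ContinuousLinearMap.ext fun v => by rw [dForm_polarForm]; simp)
  obtain ⟨Φ, hΦs, -, hΦ, -, hΦc⟩ := hφe.exists_isContactChart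
  refine ⟨ψ.trans Φ, ?_, ?_, hψ.trans hΦc⟩
  · rw [OpenPartialHomeomorph.trans_source, hΦs]
    exact ⟨hψ0, mem_univ _⟩
  · rw [OpenPartialHomeomorph.coe_trans, Function.comp_apply, hψ00, hΦ, hφ0]

end Darboux

/-! ### Legendrian charts at a boundary point -/

section LegendrianChart

open Set Filter Topology

variable {n : ℕ} {E F : Type*} [NormedAddCommGroup E] [NormedSpace ℝ E]
  [NormedAddCommGroup F] [NormedSpace ℝ F]

theorem exists_isContactChart_of_injective [FiniteDimensional ℝ E] {α β : E → E →L[ℝ] ℝ}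
    {ψ : E → E} {U : Set E} (hU : IsOpen U) (hψ : ContDiffOn ℝ ∞ ψ U) {a : E} (ha : a ∈ U)
    (hinj : Function.Injective (fderiv ℝ ψ a))
    (hker : ∀ x ∈ U, ∀ v, β (ψ x) (fderiv ℝ ψ x v) = 0 ↔ α x v = 0) :
    ∃ Ψ : OpenPartialHomeomorph E E, a ∈ Ψ.source ∧ Ψ.source ⊆ U ∧ (∀ x, Ψ x = ψ x) ∧
      IsContactChart α β Ψ := by
  let A : E ≃L[ℝ] E :=
    (LinearEquiv.ofInjectiveEndo (fderiv ℝ ψ a : E →ₗ[ℝ] E) hinj).toContinuousLinearEquiv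
  have hA : (A : E →L[ℝ] E) = fderiv ℝ ψ a := by ext v; rfl
  refine exists_isContactChart hU hψ ha (ψ' := A) ?_ hker
  rw [hA]
  exact ((hψ.contDiffAt (hU.mem_nhds ha)).differentiableAt (by simp)).hasFDerivAt

theorem IsContactChart.apply_fderiv_comp_eq_zero_iff {X : Type*} [NormedAddCommGroup X]
    [NormedSpace ℝ X] {α : E → E →L[ℝ] ℝ} {β : F → F →L[ℝ] ℝ} {ψ : OpenPartialHomeomorph E F}
    (h : IsContactChart α β ψ) {f : X → E} {u : X} (hf : DifferentiableAt ℝ f u)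
    (hu : f u ∈ ψ.source) (v : X) :
    β (ψ (f u)) (fderiv ℝ (ψ ∘ f) u v) = 0 ↔ α (f u) (fderiv ℝ f u v) = 0 := by
  rw [← h.kernel _ hu, fderiv_comp u (h.differentiableAt hu) hf]
  rfl

/-- A Legendrian half space through the origin that is graphical over the `q`-plane to first order
is straightened by a local contactomorphism of the standard contact space. -/
theorem exists_straightening [NeZero n] {F : (Fin n → ℝ) → StdContactSpace n}
    {O : Set (Fin n → ℝ)} (hO : IsOpen O) (hO0 : 0 ∈ O) (hF : ContDiffOn ℝ ∞ F O) (hF0 : F 0 = 0)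
    (hF1 : ∀ v, (fderiv ℝ F 0 v).1 = v)
    (htan : ∀ u ∈ O, 0 ≤ u 0 → ∀ v, stdForm n (F u) (fderiv ℝ F u v) = 0) :
    ∃ K : OpenPartialHomeomorph (StdContactSpace n) (StdContactSpace n),
      0 ∈ K.source ∧ K 0 = 0 ∧ IsContactChart (stdForm n) (stdForm n) K ∧
      ∀ᶠ u in 𝓝 (0 : Fin n → ℝ), 0 ≤ u 0 → (u, 0, 0) ∈ K.source ∧ K (u, 0, 0) = F u := by
  let W : Set (StdContactSpace n) := Prod.fst ⁻¹' O
  have hW : IsOpen W := hO.preimage continuous_fst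
  have hW0 : (0 : StdContactSpace n) ∈ W := hO0
  have hFW : ContDiffOn ℝ ∞ (fun x : StdContactSpace n => F x.1) W :=
    hF.comp contDiff_fst.contDiffOn fun _ h => h
  have hdFW : ContDiffOn ℝ ∞ (fun x : StdContactSpace n => fderiv ℝ F x.1) W :=
    (hF.fderiv_of_isOpen hO (by simp)).comp contDiff_fst.contDiffOn fun _ h => h
  have hdF : ∀ u ∈ O, HasFDerivAt F (fderiv ℝ F u) u := fun u hu =>
    ((hF.contDiffAt (hO.mem_nhds hu)).differentiableAt (by simp)).hasFDerivAt
  have hstd : ∀ x y : StdContactSpace n, x.2.1 = y.2.1 → stdForm n x = stdForm n y :=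
    fun x y h => by ext v <;> simp [stdForm, h]
  have hz0 : ∀ v, (fderiv ℝ F 0 v).2.2 = 0 := fun v => by
    have := htan 0 hO0 (le_refl (0 : ℝ)) v
    rw [hF0, stdForm_apply] at this
    simpa using this
  -- Write `F = (Q, P, Z)`. The maps `S(q, p, z) = (Q(q), p, z + Z(q))` and `T(q, p, z) = (q, r,
  -- z)`, with `r i = ∑ p j ∂ᵢ(Q j) - ∂ᵢ Z`, both pull the standard form back to `lam = dz + dZ - ∑
  -- p j d(Q j)`. Hence `S ∘ T⁻¹` is a contactomorphism, whether or not the extension of `F` beyond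
  -- the half space is Legendrian.
  let lam : StdContactSpace n → StdContactSpace n →L[ℝ] ℝ := fun x =>
    zCoord n + (stdForm n x).comp ((fderiv ℝ F x.1).comp (ContinuousLinearMap.fst ℝ _ _))
  have hlam : ∀ x v, lam x v = v.2.2 + stdForm n x (fderiv ℝ F x.1 v.1) := fun x v => rfl
  let S : StdContactSpace n → StdContactSpace n := fun x => ((F x.1).1, x.2.1, x.2.2 + (F x.1).2.2)
  have hS : ContDiffOn ℝ ∞ S W := by
    have h2 : ContDiff ℝ ∞ (fun x : StdContactSpace n => x.2.2) := by fun_prop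
    have h1 : ContDiff ℝ ∞ (fun x : StdContactSpace n => x.2.1) := by fun_prop
    exact hFW.fst.prodMk (h1.contDiffOn.prodMk (h2.contDiffOn.add hFW.snd.snd))
  have hdS : ∀ x ∈ W, ∀ v, fderiv ℝ S x v =
      ((fderiv ℝ F x.1 v.1).1, v.2.1, v.2.2 + (fderiv ℝ F x.1 v.1).2.2) := by
    intro x hx v
    have h0 : HasFDerivAt (fun x : StdContactSpace n => F x.1) _ x :=
      (hdF x.1 hx).comp x hasFDerivAt_fst
    have h1 : HasFDerivAt S _ x := h0.fst.prodMk (hasFDerivAt_snd.fst.prodMk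
      (hasFDerivAt_snd.snd.add h0.snd.snd))
    rw [h1.fderiv]
    rfl
  obtain ⟨Sh, hSh0, -, hSh, hShc⟩ := exists_isContactChart_of_injective (α := lam)
    (β := stdForm n) hW hS hW0 (by
      rw [injective_iff_map_eq_zero]
      intro v hv
      rw [hdS 0 hW0] at hv
      have h1 : v.1 = 0 := by rw [← hF1 v.1]; exact congrArg Prod.fst hv
      have h2 : v.2.1 = 0 := congrArg (fun y : StdContactSpace n => y.2.1) hv
      have h3 : v.2.2 + (fderiv ℝ F 0 v.1).2.2 = 0 :=
        congrArg (fun y : StdContactSpace n => y.2.2) hv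
      rw [hz0, add_zero] at h3
      exact Prod.ext h1 (Prod.ext h2 h3)) (fun x hx v => by
      have : stdForm n (S x) (fderiv ℝ S x v) = lam x v := by
        rw [hlam, hdS x hx, stdForm_apply, stdForm_apply]
        simp only [S]
        ring
      rw [this])
  let r : StdContactSpace n → Fin n → ℝ := fun x i =>
    -stdForm n x (fderiv ℝ F x.1 (Pi.single i 1))
  let T : StdContactSpace n → StdContactSpace n := fun x => (x.1, r x, x.2.2)
  have hstdc : ContDiff ℝ ∞ (stdForm n) := by
    have : ∀ i, ContDiff ℝ ∞ (fun u : StdContactSpace n => u.2.1 i • qCoord n i) := fun i =>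
      (pCoord n i).contDiff.smul contDiff_const
    exact contDiff_const.sub (ContDiff.sum fun i _ => this i)
  have hr : ContDiffOn ℝ ∞ r W := contDiffOn_pi.2 fun i =>
    (hstdc.contDiffOn.clm_apply (hdFW.clm_apply contDiffOn_const)).neg
  have hT : ContDiffOn ℝ ∞ T W := by
    have h2 : ContDiff ℝ ∞ (fun x : StdContactSpace n => x.2.2) := by fun_prop
    exact contDiff_fst.contDiffOn.prodMk (hr.prodMk h2.contDiffOn)
  have hdT : ∀ x ∈ W, (∀ v, (fderiv ℝ T x v).1 = v.1) ∧ ∀ v, (fderiv ℝ T x v).2.2 = v.2.2 := by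
    intro x hx
    have h0 : HasFDerivAt r (fderiv ℝ r x) x :=
      ((hr.contDiffAt (hW.mem_nhds hx)).differentiableAt (by simp)).hasFDerivAt
    have h1 : HasFDerivAt T _ x := hasFDerivAt_fst.prodMk (h0.prodMk hasFDerivAt_snd.snd)
    rw [h1.fderiv]
    exact ⟨fun v => rfl, fun v => rfl⟩
  have hTp : ∀ p, T (0, p, 0) = (0, p, 0) := fun p => by
    refine Prod.ext rfl (Prod.ext (funext fun i => ?_) rfl)
    change -stdForm n (0, p, 0) (fderiv ℝ F 0 (Pi.single i 1)) = p i
    rw [stdForm_apply, hz0, hF1]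
    simp [Pi.single_apply]
  have hdTp : ∀ p, fderiv ℝ T 0 (0, p, 0) = (0, p, 0) := fun p => by
    let L : (Fin n → ℝ) →L[ℝ] StdContactSpace n :=
      (ContinuousLinearMap.inr ℝ _ _).comp (ContinuousLinearMap.inl ℝ _ _)
    have hTd : HasFDerivAt T (fderiv ℝ T 0) (L 0) := by
      rw [map_zero]
      exact ((hT.contDiffAt (hW.mem_nhds hW0)).differentiableAt (by simp)).hasFDerivAt
    have h2 : HasFDerivAt (T ∘ L) L 0 := by
      have : T ∘ L = L := funext hTp
      rw [this]; exact L.hasFDerivAt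
    exact congrArg (fun A : (Fin n → ℝ) →L[ℝ] StdContactSpace n => A p)
      ((hTd.comp 0 L.hasFDerivAt).unique h2)
  obtain ⟨Th, hTh0, -, hTh, hThc⟩ := exists_isContactChart_of_injective (α := lam)
    (β := stdForm n) hW hT hW0 (by
      rw [injective_iff_map_eq_zero]
      intro v hv
      have h1 : v.1 = 0 := by rw [← (hdT 0 hW0).1 v, hv]; rfl
      have h3 : v.2.2 = 0 := by rw [← (hdT 0 hW0).2 v, hv]; rfl
      have h2 : v = (0, v.2.1, 0) := Prod.ext h1 (Prod.ext rfl h3)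
      rw [← hv, h2, hdTp]) (fun x hx v => by
      have : stdForm n (T x) (fderiv ℝ T x v) = lam x v := by
        rw [hlam, stdForm_apply, (hdT x hx).1, (hdT x hx).2, sub_eq_add_neg,
          ← Finset.sum_neg_distrib]
        congr 1
        conv_rhs => rw [pi_eq_sum_univ' v.1]
        simp only [map_sum, map_smul, T, r, smul_eq_mul]
        exact Finset.sum_congr rfl fun i _ => by ring_nf
      rw [this])
  have hT0 : T 0 = 0 := hTp 0
  have hS0 : S 0 = 0 := by simp [S, hF0]
  have hThs : Th.symm 0 = 0 := by
    have := Th.left_inv hTh0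
    rwa [hTh, hT0] at this
  refine ⟨Th.symm.trans Sh, ?_, ?_, hThc.symm.trans hShc, ?_⟩
  · rw [OpenPartialHomeomorph.trans_source]
    refine ⟨?_, by rw [mem_preimage, hThs]; exact hSh0⟩
    have := Th.map_source hTh0
    rwa [hTh, hT0] at this
  · rw [OpenPartialHomeomorph.coe_trans, Function.comp_apply, hThs, hSh, hS0]
  -- The point `(u, P(u), 0)` is sent to `F u` by `S`. It is sent to `(u, 0, 0)` by `T` when `F` is
  -- tangent at `u`, since `r i` is then minus the form at `F u` evaluated on `∂ᵢF`.
  · let j : (Fin n → ℝ) → StdContactSpace n := fun u => (u, (F u).2.1, 0)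
    have hFc : ContinuousAt F 0 := (hdF 0 hO0).continuousAt
    have hj : ContinuousAt j 0 :=
      continuousAt_id.prodMk (hFc.snd.fst.prodMk continuousAt_const)
    have hj0 : j 0 = 0 := by simp [j, hF0]
    have h1 : ∀ᶠ u in 𝓝 (0 : Fin n → ℝ), j u ∈ Th.source ∩ Sh.source :=
      hj.eventually_mem (by
        rw [hj0]
        exact (Th.open_source.inter Sh.open_source).mem_nhds ⟨hTh0, hSh0⟩)
    filter_upwards [h1, hO.mem_nhds hO0] with u hu huO hu0
    have hTj : Th (j u) = (u, 0, 0) := by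
      rw [hTh]
      refine Prod.ext rfl (Prod.ext (funext fun i => ?_) rfl)
      change -stdForm n (j u) (fderiv ℝ F u (Pi.single i 1)) = 0
      rw [hstd (j u) (F u) rfl, htan u huO hu0, neg_zero]
    have hTs : Th.symm (u, 0, 0) = j u := by rw [← hTj]; exact Th.left_inv hu.1
    refine ⟨?_, ?_⟩
    · rw [OpenPartialHomeomorph.trans_source]
      refine ⟨?_, by rw [mem_preimage, hTs]; exact hu.2⟩
      rw [← hTj]; exact Th.map_source hu.1
    · rw [OpenPartialHomeomorph.coe_trans, Function.comp_apply, hTs, hSh]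
      simp [S, j]

/-- The shear that identifies the polar with the standard contact form. -/
theorem exists_isContactEquiv_stdForm_polarForm :
    ∃ g : StdContactSpace n ≃ StdContactSpace n, IsContactEquiv (stdForm n) (polarForm n) g ∧
      g 0 = 0 ∧ ∀ u, (g.symm u).1 = u.1 := by
  let g : StdContactSpace n ≃ StdContactSpace n :=
    { toFun := fun u => (u.1, u.2.1, u.2.2 - 1 / 2 * ∑ i, u.2.1 i * u.1 i)
      invFun := fun u => (u.1, u.2.1, u.2.2 + 1 / 2 * ∑ i, u.2.1 i * u.1 i)
      left_inv := fun u => by simp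
      right_inv := fun u => by simp }
  have hs : ContDiff ℝ ∞ (fun u : StdContactSpace n => ∑ i, u.2.1 i * u.1 i) :=
    ContDiff.sum fun i _ => (pCoord n i).contDiff.mul (qCoord n i).contDiff
  have h1 : ContDiff ℝ ∞ (fun x : StdContactSpace n => x.2.1) := by fun_prop
  have h2 : ContDiff ℝ ∞ (fun x : StdContactSpace n => x.2.2) := by fun_prop
  refine ⟨g, ⟨contDiff_fst.prodMk (h1.prodMk (h2.sub (contDiff_const.mul hs))),
    contDiff_fst.prodMk (h1.prodMk (h2.add (contDiff_const.mul hs))), fun x =>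
    ⟨1, one_ne_zero, fun v => ?_⟩⟩, by ext <;> simp [g], fun u => rfl⟩
  have hsd : HasFDerivAt (fun u : StdContactSpace n => ∑ i, u.2.1 i * u.1 i)
      (∑ i, (x.2.1 i • qCoord n i + x.1 i • pCoord n i)) x :=
    HasFDerivAt.fun_sum fun i _ => (pCoord n i).hasFDerivAt.mul (qCoord n i).hasFDerivAt
  have hg : HasFDerivAt g _ x := hasFDerivAt_fst.prodMk (hasFDerivAt_snd.fst.prodMk
    (hasFDerivAt_snd.snd.sub (hsd.const_mul (1 / 2))))
  rw [hg.fderiv, polarForm_apply, stdForm_apply]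
  simp [g, Finset.sum_add_distrib, Finset.sum_sub_distrib]
  ring

/-- A linear isomorphism that preserves the polar contact form and moves the `q`-plane to a given
isotropic subspace of the contact hyperplane at the origin. -/
theorem exists_polarFrame {ι : (Fin n → ℝ) →L[ℝ] StdContactSpace n} (hι : Function.Injective ι)
    (hθ : ∀ a, polarForm n 0 (ι a) = 0) (hη : ∀ a b, dForm (polarForm n) 0 (ι a) (ι b) = 0) :
    ∃ M : StdContactSpace n ≃L[ℝ] StdContactSpace n, (∀ a, M (a, 0, 0) = ι a) ∧
      IsContactEquiv (polarForm n) (polarForm n) M.toEquiv := by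
  have hp0 : ∀ v, polarForm n 0 v = v.2.2 := fun v => by rw [polarForm_apply]; simp
  have hnd : ∀ v, polarForm n 0 v = 0 →
      (∀ w, polarForm n 0 w = 0 → dForm (polarForm n) 0 v w = 0) → v = 0 := fun v hv h => by
    have h' : ∀ w : StdContactSpace n, w.2.2 = 0 →
        ∑ i, (v.1 i * w.2.1 i - v.2.1 i * w.1 i) = 0 := fun w hw => by
      rw [← dForm_polarForm 0]; exact h w (by rw [hp0, hw])
    have hq : ∀ i, v.1 i = 0 := fun i => by
      simpa [Pi.single_apply] using h' (0, Pi.single i 1, 0) rfl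
    have hp : ∀ i, v.2.1 i = 0 := fun i => by
      simpa [Pi.single_apply] using h' (Pi.single i 1, 0, 0) rfl
    exact Prod.ext (funext hq) (Prod.ext (funext hp) (by rw [← hp0, hv]; rfl))
  obtain ⟨M, hMι, hMR, hMθ, hMη⟩ := exists_adaptedFrame (finrank_stdContactSpace (n := n))
    (dForm_swap (polarForm n) 0) hnd hι hθ hη (R := (0, 0, 1)) (by rw [hp0])
  refine ⟨M, hMι, M.contDiff, M.symm.contDiff, fun x => ⟨1, one_ne_zero, fun v => ?_⟩⟩
  have hM : fderiv ℝ M.toEquiv x = M := M.fderiv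
  have hsplit : ∀ u : StdContactSpace n, M u = M (u.1, u.2.1, 0) + u.2.2 • (0, 0, 1) :=
    fun u => by rw [← hMR, ← map_add]; simp
  -- Linear symplectic maps preserve this sum, hence the polar form, but in general not `dz - ∑ p i
  -- dq i`. This is why the polar form is used as an intermediate.
  have hd : ∀ u v : StdContactSpace n, ∑ i, ((M u).1 i * (M v).2.1 i - (M u).2.1 i * (M v).1 i) =
      ∑ i, (u.1 i * v.2.1 i - u.2.1 i * v.1 i) := fun u v => by
    rw [← hMη (u.1, u.2.1, 0) (v.1, v.2.1, 0) rfl rfl, dForm_polarForm, hsplit u, hsplit v]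
    simp
  have hz : (M v).2.2 = v.2.2 := (hp0 (M v)).symm.trans (hMθ v)
  rw [hM, polarForm_apply, polarForm_apply, one_mul, ← hd x v]
  exact congrArg (· + 1 / 2 * ∑ i, ((M x).1 i * (M v).2.1 i - (M x).2.1 i * (M v).1 i)) hz

/-- **The Legendrian neighbourhood theorem** at a boundary point of a Legendrian. -/
theorem exists_legendrianChart [NeZero n] [FiniteDimensional ℝ E]
    (hE : Module.finrank ℝ E = 2 * n + 1) {α : E → E →L[ℝ] ℝ} {U : Set E} (hU : IsOpen U)
    (hα : IsContactForm U α) {F : (Fin n → ℝ) → E} {O : Set (Fin n → ℝ)} (hO : IsOpen O)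
    (hO0 : 0 ∈ O) (hF : ContDiffOn ℝ ∞ F O) (hF0 : F 0 ∈ U)
    (hinj : Function.Injective (fderiv ℝ F 0))
    (htan : ∀ u ∈ O, 0 ≤ u 0 → ∀ v, α (F u) (fderiv ℝ F u v) = 0) :
    ∃ D : OpenPartialHomeomorph (StdContactSpace n) E, 0 ∈ D.source ∧ D 0 = F 0 ∧
      IsContactChart (stdForm n) α D ∧
      ∀ᶠ u in 𝓝 (0 : Fin n → ℝ), 0 ≤ u 0 → (u, 0, 0) ∈ D.source ∧ D (u, 0, 0) = F u := by
  have hdF : ∀ u ∈ O, DifferentiableAt ℝ F u := fun u hu =>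
    (hF.contDiffAt (hO.mem_nhds hu)).differentiableAt (by simp)
  obtain ⟨ψ, hψ0, hψ00, hψ⟩ := exists_darbouxChart hE hU hF0 hα.1 (hα.2 _ hF0).1 (hα.2 _ hF0).2
    hinj (htan 0 hO0 (le_refl (0 : ℝ))) (dForm_eq_zero_of_halfSpace hO hO0 hF hU hF0 hα.1 htan)
  have hFψ : F 0 ∈ ψ.target := by rw [← hψ00]; exact ψ.map_source hψ0
  have hψs : ψ.symm (F 0) = 0 := by rw [← hψ00]; exact ψ.left_inv hψ0
  let O' : Set (Fin n → ℝ) := O ∩ F ⁻¹' ψ.target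
  have hO' : IsOpen O' := hF.continuousOn.isOpen_inter_preimage hO ψ.open_target
  have hO'0 : 0 ∈ O' := ⟨hO0, hFψ⟩
  have hF1 : ContDiffOn ℝ ∞ (ψ.symm ∘ F) O' :=
    hψ.contDiffOn_symm.comp (hF.mono inter_subset_left) fun _ h => h.2
  have htan1 : ∀ u ∈ O', 0 ≤ u 0 → ∀ v,
      polarForm n ((ψ.symm ∘ F) u) (fderiv ℝ (ψ.symm ∘ F) u v) = 0 := fun u hu h0 v =>
    (hψ.symm.apply_fderiv_comp_eq_zero_iff (hdF u hu.1) hu.2 v).2 (htan u hu.1 h0 v)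
  have hF10 : (ψ.symm ∘ F) 0 = 0 := hψs
  have hinj1 : Function.Injective (fderiv ℝ (ψ.symm ∘ F) 0) := by
    rw [fderiv_comp 0 (hψ.differentiableAt_symm hFψ) (hdF 0 hO0)]
    refine Function.Injective.comp (g := fderiv ℝ ψ.symm (F 0)) (fun v w h => ?_) hinj
    rw [← hψ.fderiv_fderiv_symm hFψ v, h, hψ.fderiv_fderiv_symm hFψ]
  obtain ⟨M, hMι, hM⟩ := exists_polarFrame hinj1
    (fun a => by have := htan1 0 hO'0 (le_refl (0 : ℝ)) a; rwa [hF10] at this)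
    (fun a b => by
      have := dForm_eq_zero_of_halfSpace hO' hO'0 hF1 isOpen_univ (mem_univ _)
        contDiff_polarForm.contDiffOn htan1 a b
      rwa [hF10] at this)
  obtain ⟨g, hg, hg0, hgs⟩ := exists_isContactEquiv_stdForm_polarForm (n := n)
  obtain ⟨G, hGs, hGt, hG, hG', hGc⟩ := (hg.trans hM).exists_isContactChart
  have hG0 : G 0 = 0 := by rw [hG]; simp [hg0]
  -- In this chart `F` is tangent to the `q`-plane at the origin, with identity `q`-component to
  -- first order: `M` aligns the tangent space, and `g` passes to the polar form without changing
  -- `q`.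
  let Ψ := G.trans ψ
  have hΨ : IsContactChart (stdForm n) α Ψ := hGc.trans hψ
  have hΨt : Ψ.target = ψ.target := by
    rw [OpenPartialHomeomorph.trans_target, hGt]; simp
  have hF2 : ContDiffOn ℝ ∞ (Ψ.symm ∘ F) O' :=
    hΨ.contDiffOn_symm.comp (hF.mono inter_subset_left) fun u h => by
      rw [hΨt]; exact h.2
  have hF20 : (Ψ.symm ∘ F) 0 = 0 := by
    change G.symm (ψ.symm (F 0)) = 0
    rw [hψs]
    nth_rw 1 [← hG0]
    exact G.left_inv (by rw [hGs]; trivial)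
  have htan2 : ∀ u ∈ O', 0 ≤ u 0 → ∀ v,
      stdForm n ((Ψ.symm ∘ F) u) (fderiv ℝ (Ψ.symm ∘ F) u v) = 0 := fun u hu h0 v =>
    (hΨ.symm.apply_fderiv_comp_eq_zero_iff (hdF u hu.1)
      (show F u ∈ Ψ.target by rw [hΨt]; exact hu.2) v).2 (htan u hu.1 h0 v)
  have hF21 : ∀ v, (fderiv ℝ (Ψ.symm ∘ F) 0 v).1 = v := fun v => by
    have h1 : (fun u => ((Ψ.symm ∘ F) u).1) = fun u => (M.symm ((ψ.symm ∘ F) u)).1 := by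
      funext u
      change (G.symm (ψ.symm (F u))).1 = _
      rw [hG']
      exact hgs _
    have hd1 : HasFDerivAt (ψ.symm ∘ F) (fderiv ℝ (ψ.symm ∘ F) 0) 0 :=
      ((hF1.contDiffAt (hO'.mem_nhds hO'0)).differentiableAt (by simp)).hasFDerivAt
    have hd2 : HasFDerivAt (Ψ.symm ∘ F) (fderiv ℝ (Ψ.symm ∘ F) 0) 0 :=
      ((hF2.contDiffAt (hO'.mem_nhds hO'0)).differentiableAt (by simp)).hasFDerivAt
    have h2 : HasFDerivAt (fun u => (M.symm ((ψ.symm ∘ F) u)).1) _ 0 :=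
      ((M.symm : StdContactSpace n →L[ℝ] StdContactSpace n).hasFDerivAt.comp 0 hd1).fst
    have h3 := hd2.fst
    rw [h1] at h3
    have h4 := congrArg (fun A : (Fin n → ℝ) →L[ℝ] (Fin n → ℝ) => A v) (h3.unique h2)
    refine h4.trans ?_
    change (M.symm (fderiv ℝ (ψ.symm ∘ F) 0 v)).1 = v
    rw [← hMι, M.symm_apply_apply]
  obtain ⟨K, hK0, hK00, hK, hKF⟩ := exists_straightening hO' hO'0 hF2 hF20 hF21 htan2
  have hΨ0 : (0 : StdContactSpace n) ∈ Ψ.source := by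
    rw [← hF20]; exact Ψ.map_target (by rw [hΨt]; exact hFψ)
  have hΨ00 : Ψ 0 = F 0 := by
    rw [← hF20]; exact Ψ.right_inv (by rw [hΨt]; exact hFψ)
  refine ⟨K.trans Ψ, ?_, ?_, hK.trans hΨ, ?_⟩
  · rw [OpenPartialHomeomorph.trans_source]
    exact ⟨hK0, by rw [mem_preimage, hK00]; exact hΨ0⟩
  · rw [OpenPartialHomeomorph.coe_trans, Function.comp_apply, hK00, hΨ00]
  · filter_upwards [hKF, hO'.mem_nhds hO'0] with u hu huO hu0
    obtain ⟨h1, h2⟩ := hu hu0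
    have hut : F u ∈ Ψ.target := by rw [hΨt]; exact huO.2
    rw [OpenPartialHomeomorph.trans_source, OpenPartialHomeomorph.coe_trans, Function.comp_apply,
      h2]
    exact ⟨⟨h1, by rw [mem_preimage, h2]; exact Ψ.map_target hut⟩, Ψ.right_inv hut⟩

end LegendrianChart

/-! ### Charts of a Legendrian submanifold -/

section Param

open Set Filter Topology

variable {n : ℕ}
  {Y : Type*} [TopologicalSpace Y] [ChartedSpace (EuclideanSpace ℝ (Fin (2 * n + 1))) Y]

/-- The boundary is defined through preferred charts; its invariance under local diffeomorphisms
allows any chart of the maximal atlas. -/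
theorem mem_boundary_iff_of_mem_maximalAtlas [NeZero n]
    {L : Type*} [TopologicalSpace L] [ChartedSpace (EuclideanHalfSpace n) L] [IsManifold (𝓡∂ n) ∞ L]
    {d : OpenPartialHomeomorph L (EuclideanHalfSpace n)}
    (hd : d ∈ IsManifold.maximalAtlas (𝓡∂ n) ∞ L) {x : L} (hx : x ∈ d.source) :
    x ∈ (𝓡∂ n).boundary L ↔ (d x).1 0 = 0 := by
  let D : PartialDiffeomorph (𝓡∂ n) (𝓡∂ n) L (EuclideanHalfSpace n) ∞ :=
    { toPartialEquiv := d.toPartialEquiv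
      open_source := d.open_source
      open_target := d.open_target
      contMDiffOn_toFun := contMDiffOn_of_mem_maximalAtlas hd
      contMDiffOn_invFun := contMDiffOn_symm_of_mem_maximalAtlas hd }
  have h1 : IsLocalDiffeomorphAt (𝓡∂ n) (𝓡∂ n) ∞ d x := ⟨D, hx, fun _ _ => rfl⟩
  have h2 := h1.isBoundaryPoint_iff (by simp)
  refine h2.trans ?_
  rw [ModelWithCorners.isBoundaryPoint_iff, frontier_range_modelWithCornersEuclideanHalfSpace]
  exact eq_comm

theorem exists_transition [IsManifold (𝓡 (2 * n + 1)) ∞ Y]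
    {k e : OpenPartialHomeomorph Y (EuclideanSpace ℝ (Fin (2 * n + 1)))}
    (hk : k ∈ IsManifold.maximalAtlas (𝓡 (2 * n + 1)) ∞ Y)
    (he : e ∈ IsManifold.maximalAtlas (𝓡 (2 * n + 1)) ∞ Y) :
    ContDiffOn ℝ ∞ (k.symm.trans e) (k.symm.trans e).source := by
  have h1 := (contMDiffOn_of_mem_maximalAtlas he).comp
    ((contMDiffOn_symm_of_mem_maximalAtlas hk).mono inter_subset_left)
    (show k.symm.source ∩ k.symm ⁻¹' e.source ⊆ k.symm ⁻¹' e.source from inter_subset_right)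
  exact contMDiffOn_iff_contDiffOn.1 h1

/-- A Legendrian submanifold is parametrised, near a boundary point, by the restriction to a half
space of an immersion in a given chart. -/
theorem IsLegendrianEmbedding.exists_param [NeZero n] [IsManifold (𝓡 (2 * n + 1)) ∞ Y]
    {L : Type*} [TopologicalSpace L] [ChartedSpace (EuclideanHalfSpace n) L]
    [IsManifold (𝓡∂ n) ∞ L]
    {ξ : ∀ y : Y, Submodule ℝ (TangentSpace (𝓡 (2 * n + 1)) y)} {f : L → Y}
    (hf : IsLegendrianEmbedding ξ f) {x₀ : L} (hx₀ : x₀ ∈ (𝓡∂ n).boundary L)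
    {e : OpenPartialHomeomorph Y (EuclideanSpace ℝ (Fin (2 * n + 1)))}
    (he : e ∈ IsManifold.maximalAtlas (𝓡 (2 * n + 1)) ∞ Y) (hfx₀ : f x₀ ∈ e.source)
    {α : EuclideanSpace ℝ (Fin (2 * n + 1)) → EuclideanSpace ℝ (Fin (2 * n + 1)) →L[ℝ] ℝ}
    (hα : ∀ y ∈ e.source, ∀ v : TangentSpace (𝓡 (2 * n + 1)) y,
      v ∈ ξ y ↔
        α (e y) (mfderiv (𝓡 (2 * n + 1)) 𝓘(ℝ, EuclideanSpace ℝ (Fin (2 * n + 1))) e y v) = 0) :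
    ∃ (F : (Fin n → ℝ) → EuclideanSpace ℝ (Fin (2 * n + 1))) (O : Set (Fin n → ℝ))
      (γ : (Fin n → ℝ) → L) (χ : L → Fin n → ℝ), IsOpen O ∧ 0 ∈ O ∧ ContDiffOn ℝ ∞ F O ∧
      Function.Injective (fderiv ℝ F 0) ∧
      (∀ u ∈ O, 0 ≤ u 0 → (∀ v, α (F u) (fderiv ℝ F u v) = 0) ∧ f (γ u) ∈ e.source ∧
        e (f (γ u)) = F u) ∧
      χ x₀ = 0 ∧ ContinuousAt χ x₀ ∧
      ∀ᶠ x in 𝓝 x₀, γ (χ x) = x ∧ 0 ≤ χ x 0 ∧ (x ∈ (𝓡∂ n).boundary L → χ x 0 = 0) := by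
  -- In the charts `d` and `k` of the immersion normal form, `f` is the linear map `y ↦ ε (y, 0)`,
  -- which makes sense beyond the half space. This yields `F` on a full neighbourhood of `0`. The
  -- translation by `c` respects the half space because `c 0 = 0` at a boundary point.
  have h := hf.isSmoothEmbedding.isImmersion.isImmersionAt x₀
  let d := h.domChart
  let k := h.codChart
  have hd : d ∈ IsManifold.maximalAtlas (𝓡∂ n) ∞ L := h.domChart_mem_maximalAtlas
  have hk : k ∈ IsManifold.maximalAtlas (𝓡 (2 * n + 1)) ∞ Y := h.codChart_mem_maximalAtlas
  have hx₀d : x₀ ∈ d.source := h.mem_domChart_source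
  have hdk : ∀ x ∈ d.source, f x ∈ k.source := fun x hx => h.source_subset_preimage_source hx
  let σ := d.extend (𝓡∂ n)
  let c := σ x₀
  have hσs : σ.source = d.source := d.extend_source
  have hσt : σ.target = (𝓡∂ n).symm ⁻¹' d.target ∩ range (𝓡∂ n) := d.extend_target
  have hσ : ∀ x, σ x = (d x).1 := fun x => rfl
  have hc : c 0 = 0 := (mem_boundary_iff_of_mem_maximalAtlas hd hx₀d).1 hx₀
  let ε := h.equiv
  have hε : ∀ y ∈ σ.target, k (f (σ.symm y)) = ε (y, 0) := fun y hy => h.writtenInCharts hy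
  let E := EuclideanSpace.equiv (Fin n) ℝ
  let A : (Fin n → ℝ) → EuclideanSpace ℝ (Fin n) := fun u => E.symm u + c
  have hAd : ∀ u, HasFDerivAt A (E.symm : (Fin n → ℝ) →L[ℝ] EuclideanSpace ℝ (Fin n)) u :=
    fun u => (E.symm : (Fin n → ℝ) →L[ℝ] EuclideanSpace ℝ (Fin n)).hasFDerivAt.add_const c
  have hAc : ContDiff ℝ ∞ A := E.symm.contDiff.add contDiff_const
  have hA0 : A 0 = c := by simp [A]
  let j : EuclideanSpace ℝ (Fin n) →L[ℝ] EuclideanSpace ℝ (Fin (2 * n + 1)) :=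
    (ε : EuclideanSpace ℝ (Fin n) × h.complement →L[ℝ] EuclideanSpace ℝ (Fin (2 * n + 1))).comp (ContinuousLinearMap.inl ℝ _ _)
  have hj : ∀ y, j y = ε (y, 0) := fun y => rfl
  have hjinj : Function.Injective j := fun y z hyz => congrArg Prod.fst (ε.injective hyz)
  let τ := k.symm.trans e
  have hτ : ContDiffOn ℝ ∞ τ τ.source := exists_transition hk he
  -- The source form is the pullback by definition, so the kernel condition is empty; only the
  -- derivative identities for `τ` and its inverse are wanted.
  have hτ' : IsContactChart (fun x => (α (τ x)).comp (fderiv ℝ τ x)) α τ :=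
    ⟨hτ, by simpa [τ] using exists_transition he hk, fun x _ v => Iff.rfl⟩
  let O : Set (Fin n → ℝ) := A ⁻¹' ((𝓡∂ n).symm ⁻¹' d.target ∩ j ⁻¹' τ.source)
  have hO : IsOpen O := ((d.open_target.preimage (𝓡∂ n).continuous_symm).inter
    (τ.open_source.preimage j.continuous)).preimage hAc.continuous
  have hx₀σ : x₀ ∈ σ.source := by rw [hσs]; exact hx₀d
  have hcσ : c ∈ σ.target := σ.map_source hx₀σ
  have hσc : σ.symm c = x₀ := σ.left_inv hx₀σ
  have hjc : j c = k (f x₀) := by rw [hj, ← hε c hcσ, hσc]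
  have hkc : k.symm (j c) = f x₀ := by rw [hjc]; exact k.left_inv (hdk _ hx₀d)
  have hO0 : (0 : Fin n → ℝ) ∈ O := by
    change A 0 ∈ (𝓡∂ n).symm ⁻¹' d.target ∩ j ⁻¹' τ.source
    rw [hA0]
    refine ⟨?_, ?_⟩
    · rw [hσt] at hcσ; exact hcσ.1
    · rw [mem_preimage, OpenPartialHomeomorph.trans_source]
      refine ⟨?_, by rw [mem_preimage, hkc]; exact hfx₀⟩
      rw [hjc]; exact k.map_source (hdk _ hx₀d)
  let G : EuclideanSpace ℝ (Fin n) → EuclideanSpace ℝ (Fin (2 * n + 1)) := fun y => τ (j y)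
  have hGd : ∀ y, j y ∈ τ.source → HasFDerivAt G ((fderiv ℝ τ (j y)).comp j) y := fun y hy =>
    (hτ'.differentiableAt hy).hasFDerivAt.comp y j.hasFDerivAt
  have hGs : ∀ y ∈ σ.target, j y ∈ τ.source →
      f (σ.symm y) ∈ e.source ∧ e (f (σ.symm y)) = G y := by
    intro y hy hys
    have h1 : k.symm (j y) = f (σ.symm y) := by
      rw [hj, ← hε y hy]
      refine k.left_inv (hdk _ ?_)
      rw [← hσs]; exact σ.map_target hy
    rw [OpenPartialHomeomorph.trans_source] at hys
    refine ⟨?_, ?_⟩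
    · rw [← h1]; exact hys.2
    · rw [← h1]; rfl
  have hAσ : ∀ u ∈ O, 0 ≤ u 0 → A u ∈ σ.target := by
    intro u hu hu0
    rw [hσt]
    refine ⟨hu.1, ?_⟩
    rw [range_modelWithCornersEuclideanHalfSpace]
    change 0 ≤ u 0 + c 0
    rw [hc, add_zero]; exact hu0
  have hFd : ∀ u ∈ O, HasFDerivAt (G ∘ A) (((fderiv ℝ τ (j (A u))).comp j).comp
      (E.symm : (Fin n → ℝ) →L[ℝ] EuclideanSpace ℝ (Fin n))) u := fun u hu =>
    (hGd (A u) hu.2).comp u (hAd u)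
  refine ⟨G ∘ A, O, σ.symm ∘ A, fun x => E (σ x - c), hO, hO0, ?_, ?_, fun u hu hu0 => ?_, ?_,
    ?_, ?_⟩
  · exact hτ.comp (j.contDiff.comp hAc).contDiffOn fun u hu => hu.2
  · rw [(hFd 0 hO0).fderiv]
    have h1 : Function.Injective (fderiv ℝ τ (j (A 0))) := fun v w hvw => by
      rw [← hτ'.fderiv_symm_fderiv hO0.2 v, hvw, hτ'.fderiv_symm_fderiv hO0.2]
    exact (h1.comp hjinj).comp E.symm.injective
  · have hy := hAσ u hu hu0
    obtain ⟨h1, h2⟩ := hGs _ hy hu.2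
    refine ⟨fun v => ?_, h1, h2⟩
    set y := A u with hydef
    set x := σ.symm y with hxdef
    -- Within `σ.target` the extension `G` coincides with `f` read in charts. Uniqueness of
    -- derivatives there transfers the tangency of `f` to `F`, also at boundary points.
    have hs : UniqueDiffWithinAt ℝ σ.target y := by
      rw [hσt, inter_comm]
      rw [hσt] at hy
      exact (𝓡∂ n).uniqueDiffOn.inter (d.open_target.preimage (𝓡∂ n).continuous_symm) _
        ⟨hy.2, hy.1⟩
    have hσm : MDifferentiableWithinAt 𝓘(ℝ, EuclideanSpace ℝ (Fin n)) (𝓡∂ n) σ.symm σ.target y := by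
      have h3 := contMDiffOn_extend_symm hd
      rw [← d.extend_target'] at h3
      exact (h3 y hy).mdifferentiableWithinAt (by simp)
    have hfm : MDifferentiableAt (𝓡∂ n) (𝓡 (2 * n + 1)) f x :=
      hf.isSmoothEmbedding.contMDiff.mdifferentiable (by simp) x
    have hem : MDifferentiableAt (𝓡 (2 * n + 1)) 𝓘(ℝ, EuclideanSpace ℝ (Fin (2 * n + 1))) e (f x) :=
      ((contMDiffOn_of_mem_maximalAtlas he).contMDiffAt
        (e.open_source.mem_nhds h1)).mdifferentiableAt (by simp)
    have h3 := (hem.hasMFDerivAt.comp x hfm.hasMFDerivAt).comp_hasMFDerivWithinAt y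
      hσm.hasMFDerivWithinAt
    have h4 := (hasMFDerivWithinAt_iff_hasFDerivWithinAt.1 h3)
    have h5 : HasFDerivWithinAt G _ σ.target y := h4.congr_of_eventuallyEq (by
      filter_upwards [self_mem_nhdsWithin, mem_nhdsWithin_of_mem_nhds
        ((τ.open_source.preimage j.continuous).mem_nhds hu.2)] with z hz hz'
      exact (hGs z hz hz').2.symm) h2.symm
    have h6 := hs.eq (hGd y hu.2).hasFDerivWithinAt h5
    rw [(hFd u hu).fderiv, h6, Function.comp_apply, ← hydef, ← h2]
    exact (hα _ h1 _).1 (hf.tangent x _)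
  · simp [c]
  · have h1 : ContinuousAt σ x₀ := d.continuousAt_extend hx₀d
    exact E.continuous.continuousAt.comp (h1.sub continuousAt_const)
  · filter_upwards [d.open_source.mem_nhds hx₀d] with x hx
    have h0 : E (σ x - c) 0 = (d x).1 0 := by
      change (σ x) 0 - c 0 = _
      rw [hc, sub_zero]; rfl
    refine ⟨?_, ?_, fun hxb => ?_⟩
    · have h1 : A (E (σ x - c)) = σ x := by simp [A]
      rw [Function.comp_apply, h1]
      exact σ.left_inv (by rw [hσs]; exact hx)
    · rw [h0]; exact (d x).2
    · rw [h0]; exact (mem_boundary_iff_of_mem_maximalAtlas hd hx).1 hxb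

end Param

/-! ### Stabilisation charts at a boundary point -/

section NormalForm

open Set Filter Topology

variable {n : ℕ} [NeZero n]

/-- A chart that is matched with an embedding along a half space can be shrunk so that the image
of the embedding is exactly that half space. -/
theorem exists_open_nhds_mem_range_iff {Y L : Type*} [TopologicalSpace Y] [TopologicalSpace L]
    {f : L → Y} (hf : IsEmbedding f) {x₀ : L} {C B : Set L} (hC : C ∈ 𝓝 x₀)
    {Φ : OpenPartialHomeomorph (StdContactSpace n) Y} (hΦ0 : 0 ∈ Φ.source) (hΦ : Φ 0 = f x₀)
    {γ : (Fin n → ℝ) → L} {χ : L → Fin n → ℝ} (hχ0 : χ x₀ = 0) (hχ : ContinuousAt χ x₀)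
    (hγχ : ∀ᶠ x in 𝓝 x₀, γ (χ x) = x ∧ 0 ≤ χ x 0 ∧ (x ∈ B → χ x 0 = 0))
    (hγ : ∀ᶠ u in 𝓝 (0 : Fin n → ℝ), 0 ≤ u 0 →
      (u, 0, 0) ∈ Φ.source ∧ Φ (u, 0, 0) = f (γ u)) :
    ∃ N : Set (StdContactSpace n), IsOpen N ∧ 0 ∈ N ∧ N ⊆ Φ.source ∧
      (∀ v ∈ N, Φ v ∈ range f ↔ v ∈ stdHalfLegendrian n) ∧
      ∀ v ∈ N, ∀ x, f x = Φ v → x ∈ C ∧ (x ∈ B → v.1 0 = 0) := by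
  have h1 : ∀ᶠ x in 𝓝 x₀, 0 ≤ χ x 0 →
      (χ x, 0, 0) ∈ Φ.source ∧ Φ (χ x, 0, 0) = f (γ (χ x)) :=
    (hχ0 ▸ hχ.tendsto : Tendsto χ (𝓝 x₀) (𝓝 0)).eventually hγ
  obtain ⟨V, hV, hVo, hxV⟩ := eventually_nhds_iff.1 ((hγχ.and h1).and hC)
  -- The embedding hypothesis enters here: points of `L` whose image is in `W` lie in `V`, so no
  -- other sheet of the Legendrian returns into the chart.
  obtain ⟨W, hW, hWV⟩ := hf.isInducing.isOpen_iff.1 hVo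
  obtain ⟨P, hP, hPo, hP0⟩ := eventually_nhds_iff.1 hγ
  have hkey : ∀ v ∈ Φ.source, Φ v ∈ W → ∀ x, f x = Φ v →
      x ∈ V ∧ v = (χ x, 0, 0) := by
    intro v hv hvW x hx
    have hxV' : x ∈ V := by rw [← hWV, mem_preimage, hx]; exact hvW
    obtain ⟨⟨⟨h2, h3, -⟩, h4⟩, -⟩ := hV x hxV'
    obtain ⟨h5, h6⟩ := h4 h3
    refine ⟨hxV', Φ.injOn hv h5 ?_⟩
    rw [h6, h2, hx]
  refine ⟨(Φ.source ∩ Φ ⁻¹' W) ∩ Prod.fst ⁻¹' P,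
    (Φ.isOpen_inter_preimage hW).inter (hPo.preimage continuous_fst),
    ⟨⟨hΦ0, ?_⟩, hP0⟩, fun v hv => hv.1.1, fun v hv => ⟨?_, ?_⟩, fun v hv x hx => ?_⟩
  · rw [mem_preimage, hΦ]
    have : x₀ ∈ f ⁻¹' W := by rw [hWV]; exact hxV
    exact this
  · rintro ⟨x, hx⟩
    obtain ⟨hxV', hv'⟩ := hkey v hv.1.1 hv.1.2 x hx
    rw [hv']
    exact ⟨(hV x hxV').1.1.2.1, rfl⟩
  · rintro ⟨h2, h3⟩
    have h4 : v = (v.1, 0, 0) := Prod.ext rfl h3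
    rw [h4, (hP v.1 hv.2 h2).2]
    exact mem_range_self _
  · obtain ⟨hxV', hv'⟩ := hkey v hv.1.1 hv.1.2 x hx
    refine ⟨(hV x hxV').2, fun hB => ?_⟩
    rw [hv']
    exact (hV x hxV').1.1.2.2 hB

/-- A standard chart of a contact manifold in which a Legendrian submanifold is, near a boundary
point, the half space `q 0 ≥ 0` of the zero section. -/
theorem IsLegendrianEmbedding.exists_boundaryChart
    {Y : Type*} [TopologicalSpace Y] [ChartedSpace (EuclideanSpace ℝ (Fin (2 * n + 1))) Y]
    [IsManifold (𝓡 (2 * n + 1)) ∞ Y]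
    {L : Type*} [TopologicalSpace L] [ChartedSpace (EuclideanHalfSpace n) L]
    [IsManifold (𝓡∂ n) ∞ L]
    {ξ : ∀ y : Y, Submodule ℝ (TangentSpace (𝓡 (2 * n + 1)) y)} (hξ : IsContactStructure n ξ)
    {f : L → Y} (hf : IsLegendrianEmbedding ξ f) {x₀ : L} (hx₀ : x₀ ∈ (𝓡∂ n).boundary L) :
    ∃ Φ : OpenPartialHomeomorph (StdContactSpace n) Y, 0 ∈ Φ.source ∧
      ContMDiffOn 𝓘(ℝ, StdContactSpace n) (𝓡 (2 * n + 1)) ∞ Φ Φ.source ∧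
      ContMDiffOn (𝓡 (2 * n + 1)) 𝓘(ℝ, StdContactSpace n) ∞ Φ.symm Φ.target ∧
      (∀ u ∈ Φ.source, ∀ v : StdContactSpace n,
        mfderiv 𝓘(ℝ, StdContactSpace n) (𝓡 (2 * n + 1)) Φ u v ∈ ξ (Φ u) ↔ stdForm n u v = 0) ∧
      (∀ v ∈ Φ.source, Φ v ∈ range f ↔ v ∈ stdHalfLegendrian n) ∧
      ∀ v ∈ Φ.source, ∀ x, f x = Φ v →
        x ∈ connectedComponent x₀ ∧ (x ∈ (𝓡∂ n).boundary L → v.1 0 = 0) := by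
  obtain ⟨e, he, hfx₀, α, hα, hξα⟩ := hξ (f x₀)
  obtain ⟨F, O, γ, χ, hO, hO0, hF, hFinj, hFO, hχ0, hχ, hγχ⟩ :=
    hf.exists_param hx₀ he hfx₀ hξα
  have hγ0 : γ 0 = x₀ := by rw [← hχ0]; exact hγχ.self_of_nhds.1
  have hF0 : F 0 = e (f x₀) := by
    rw [← hγ0]; exact (hFO 0 hO0 (le_refl (0 : ℝ))).2.2.symm
  obtain ⟨D, hD0, hD00, hD, hDF⟩ := exists_legendrianChart (n := n) (by simp) e.open_target hα hO
    hO0 hF (by rw [hF0]; exact e.map_source hfx₀) hFinj fun u hu hu0 => (hFO u hu hu0).1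
  let Ψ := D.trans e.symm
  have hΨs : ∀ v, v ∈ Ψ.source ↔ v ∈ D.source ∧ D v ∈ e.target := fun v => by
    simp only [Ψ, OpenPartialHomeomorph.trans_source]; rfl
  have hΨ : ∀ v, Ψ v = e.symm (D v) := fun v => rfl
  have hΨc : ContMDiffOn 𝓘(ℝ, StdContactSpace n) (𝓡 (2 * n + 1)) ∞ Ψ Ψ.source :=
    (contMDiffOn_symm_of_mem_maximalAtlas he).comp
      ((contMDiffOn_iff_contDiffOn.2 hD.contDiffOn).mono fun v hv => ((hΨs v).1 hv).1)
      fun v hv => ((hΨs v).1 hv).2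
  have hΨc' : ContMDiffOn (𝓡 (2 * n + 1)) 𝓘(ℝ, StdContactSpace n) ∞ Ψ.symm Ψ.target := by
    have ht : ∀ y ∈ Ψ.target, y ∈ e.source ∧ e y ∈ D.target := fun y hy => by
      rw [OpenPartialHomeomorph.trans_target] at hy; exact hy
    exact (contMDiffOn_iff_contDiffOn.2 hD.contDiffOn_symm).comp
      ((contMDiffOn_of_mem_maximalAtlas he).mono fun y hy => (ht y hy).1) fun y hy => (ht y hy).2
  have hkey : ∀ u ∈ Ψ.source, ∀ v : StdContactSpace n,
      mfderiv 𝓘(ℝ, StdContactSpace n) (𝓡 (2 * n + 1)) Ψ u v ∈ ξ (Ψ u) ↔ stdForm n u v = 0 := by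
    intro u hu v
    obtain ⟨hu1, hu2⟩ := (hΨs u).1 hu
    have hes : Ψ u ∈ e.source := e.map_target hu2
    have hem : MDifferentiableAt (𝓡 (2 * n + 1)) 𝓘(ℝ, EuclideanSpace ℝ (Fin (2 * n + 1))) e (Ψ u) :=
      ((contMDiffOn_of_mem_maximalAtlas he).contMDiffAt
        (e.open_source.mem_nhds hes)).mdifferentiableAt (by simp)
    have hΨm : MDifferentiableAt 𝓘(ℝ, StdContactSpace n) (𝓡 (2 * n + 1)) Ψ u :=
      (hΨc.contMDiffAt (Ψ.open_source.mem_nhds hu)).mdifferentiableAt (by simp)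
    have h2 : HasFDerivAt (e ∘ Ψ) (fderiv ℝ D u) u := by
      refine (hD.differentiableAt hu1).hasFDerivAt.congr_of_eventuallyEq ?_
      filter_upwards [Ψ.open_source.mem_nhds hu] with w hw
      exact e.right_inv ((hΨs w).1 hw).2
    have h3 : e (Ψ u) = D u := e.right_inv hu2
    have h4 : mfderiv 𝓘(ℝ, StdContactSpace n) 𝓘(ℝ, EuclideanSpace ℝ (Fin (2 * n + 1))) (e ∘ Ψ) u v =
        fderiv ℝ D u v := by rw [mfderiv_eq_fderiv, h2.fderiv]; rfl
    rw [mfderiv_comp u hem hΨm] at h4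
    rw [hξα _ hes, h3, ← hD.kernel u hu1 v, ← h4]
    rfl
  have hDe : ∀ u : Fin n → ℝ, e.symm (e (f (γ u))) = f (γ u) → D (u, 0, 0) = e (f (γ u)) →
      Ψ (u, 0, 0) = f (γ u) := fun u h1 h2 => by rw [hΨ, h2, h1]
  have hγ : ∀ᶠ u in 𝓝 (0 : Fin n → ℝ), 0 ≤ u 0 →
      (u, 0, 0) ∈ Ψ.source ∧ Ψ (u, 0, 0) = f (γ u) := by
    filter_upwards [hDF, hO.mem_nhds hO0] with u hu huO hu0
    obtain ⟨h1, h2⟩ := hu hu0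
    obtain ⟨-, h3, h4⟩ := hFO u huO hu0
    rw [← h4] at h2
    exact ⟨(hΨs _).2 ⟨h1, by rw [h2]; exact e.map_source h3⟩, hDe u (e.left_inv h3) h2⟩
  have hΨ0 : (0 : StdContactSpace n) ∈ Ψ.source :=
    (hΨs 0).2 ⟨hD0, by rw [hD00, hF0]; exact e.map_source hfx₀⟩
  have hΨ00 : Ψ 0 = f x₀ := by rw [hΨ, hD00, hF0]; exact e.left_inv hfx₀
  have hloc : LocallyConnectedSpace L := ChartedSpace.locallyConnectedSpace (EuclideanHalfSpace n) L
  -- Components of a manifold are open, so the chart can be shrunk until it meets only that of `x₀`.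
  have hC : connectedComponent x₀ ∈ 𝓝 x₀ :=
    isOpen_connectedComponent.mem_nhds mem_connectedComponent
  obtain ⟨N, hN, hN0, hNs, hN1, hN2⟩ := exists_open_nhds_mem_range_iff
    hf.isSmoothEmbedding.isEmbedding hC hΨ0 hΨ00 hχ0 hχ hγχ hγ
  have hs : (Ψ.restrOpen N hN).source = N := by
    rw [OpenPartialHomeomorph.restrOpen_source]; exact inter_eq_right.2 hNs
  refine ⟨Ψ.restrOpen N hN, ?_, ?_, ?_, ?_, ?_, ?_⟩
  · rw [hs]; exact hN0
  · rw [hs]; exact hΨc.mono hNs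
  · exact hΨc'.mono fun y hy => hy.1
  · rw [hs]; exact fun u hu => hkey u (hNs hu)
  · rw [hs]; exact hN1
  · rw [hs]; exact hN2

/-- A Legendrian submanifold admits a stabilisation near each of its boundary points. -/
theorem IsLegendrianEmbedding.exists_isStabilisationChart
    {Y : Type*} [TopologicalSpace Y] [ChartedSpace (EuclideanSpace ℝ (Fin (2 * n + 1))) Y]
    [IsManifold (𝓡 (2 * n + 1)) ∞ Y]
    {L : Type*} [TopologicalSpace L] [ChartedSpace (EuclideanHalfSpace n) L]
    [IsManifold (𝓡∂ n) ∞ L]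
    {ξ : ∀ y : Y, Submodule ℝ (TangentSpace (𝓡 (2 * n + 1)) y)} (hξ : IsContactStructure n ξ)
    {f : L → Y} (hf : IsLegendrianEmbedding ξ f) {x₀ : L} (hx₀ : x₀ ∈ (𝓡∂ n).boundary L) (ρ : ℝ) :
    ∃ φ : OpenPartialHomeomorph (StdContactSpace n) Y,
      IsStabilisationChart ξ f (connectedComponent x₀) ρ φ := by
  obtain ⟨Φ, hΦ0, hΦ, hΦ', hΦξ, hΦf, hΦx⟩ := hf.exists_boundaryChart hξ hx₀
  obtain ⟨e, he, heU, hem⟩ := exists_contactEquiv_stabilisedModel (n := n) ρ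
    (Φ.open_source.mem_nhds hΦ0)
  obtain ⟨Θ, hΘs, -, hΘ, -, hΘc⟩ := he.exists_isContactChart
  -- The image of the whole box lies in the domain of `Φ`, so composing does not shrink the source.
  let φ := (Θ.restrOpen _ (isOpen_stabilisationBox (n := n) ρ)).trans Φ
  have hs : φ.source = stabilisationBox n ρ := by
    rw [OpenPartialHomeomorph.trans_source, OpenPartialHomeomorph.restrOpen_source, hΘs, univ_inter]
    refine inter_eq_left.2 fun u hu => ?_
    change Θ u ∈ Φ.source
    rw [hΘ]; exact heU hu
  have hφ : ∀ u, φ u = Φ (Θ u) := fun u => rfl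
  have hΘU : ∀ u ∈ stabilisationBox n ρ, Θ u ∈ Φ.source := fun u hu => by
    rw [hΘ]; exact heU hu
  have hΘm : ∀ u, Θ u ∈ Φ.source → u ∈ stabilisationBox n ρ →
      (φ u ∈ range f ↔ u ∈ stabilisedModel n) := fun u h1 h2 => by
    rw [hφ, hΦf _ h1, hΘ]; exact (hem u h2).1
  have hφc : ContMDiffOn 𝓘(ℝ, StdContactSpace n) (𝓡 (2 * n + 1)) ∞ φ φ.source := by
    rw [hs]
    exact hΦ.comp ((contMDiffOn_iff_contDiffOn.2 hΘc.contDiffOn).mono fun u _ => by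
      rw [hΘs]; trivial) hΘU
  have ht : ∀ y ∈ φ.target, y ∈ Φ.target ∧ ∃ u ∈ stabilisationBox n ρ, φ u = y := fun y hy => by
    refine ⟨?_, φ.symm y, by rw [← hs]; exact φ.map_target hy, φ.right_inv hy⟩
    rw [OpenPartialHomeomorph.trans_target] at hy; exact hy.1
  refine ⟨φ, hs, hφc, ?_, fun u hu v => ?_, ?_, fun x hx hxb => ?_, fun x hx => ?_⟩
  · refine ContMDiffOn.comp (t := Θ.target) (contMDiffOn_iff_contDiffOn.2 hΘc.contDiffOn_symm)
      (hΦ'.mono fun y hy => (ht y hy).1) fun y hy => ?_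
    rw [OpenPartialHomeomorph.trans_target] at hy
    exact hy.2.1
  · rw [hs] at hu
    have hΘd : HasFDerivAt Θ (fderiv ℝ Θ u) u :=
      (hΘc.differentiableAt (by rw [hΘs]; trivial)).hasFDerivAt
    have hΦm : MDifferentiableAt 𝓘(ℝ, StdContactSpace n) (𝓡 (2 * n + 1)) Φ (Θ u) :=
      (hΦ.contMDiffAt (Φ.open_source.mem_nhds (hΘU u hu))).mdifferentiableAt (by simp)
    have h1 := hΦm.hasMFDerivAt.comp u (hasMFDerivAt_iff_hasFDerivAt.2 hΘd)
    have h2 : mfderiv 𝓘(ℝ, StdContactSpace n) (𝓡 (2 * n + 1)) φ u = _ := h1.mfderiv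
    rw [h2, ← stdForm_eq, ← hΘc.kernel u (by rw [hΘs]; trivial) v]
    exact hΦξ _ (hΘU u hu) _
  · ext y
    constructor
    · rintro ⟨hy, hyf⟩
      obtain ⟨-, u, hu, rfl⟩ := ht y hy
      exact ⟨u, ⟨hu, (hΘm u (hΘU u hu) hu).1 hyf⟩, rfl⟩
    · rintro ⟨u, ⟨hu, hum⟩, rfl⟩
      exact ⟨φ.map_source (by rw [hs]; exact hu), (hΘm u (hΘU u hu) hu).2 hum⟩
  · obtain ⟨-, u, hu, hux⟩ := ht _ hx
    have h1 : Θ u ∈ stdHalfLegendrian n := by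
      rw [← hΦf _ (hΘU u hu)]; exact ⟨x, hux.symm⟩
    have h2 := (hΦx _ (hΘU u hu) x hux.symm).2 hxb
    rw [hΘ] at h1 h2
    exact (hem u hu).2 h1 h2
  · obtain ⟨-, u, hu, hux⟩ := ht _ hx
    exact (hΦx _ (hΘU u hu) x hux.symm).1

theorem IsStabilisationChart.mono
    {Y : Type*} [TopologicalSpace Y] [ChartedSpace (EuclideanSpace ℝ (Fin (2 * n + 1))) Y]
    {L : Type*} [TopologicalSpace L] [ChartedSpace (EuclideanHalfSpace n) L]
    {ξ : ∀ y : Y, Submodule ℝ (TangentSpace (𝓡 (2 * n + 1)) y)} {f : L → Y} {S T : Set L}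
    (hST : S ⊆ T) {ρ : ℝ} {φ : OpenPartialHomeomorph (StdContactSpace n) Y}
    (h : IsStabilisationChart ξ f S ρ φ) : IsStabilisationChart ξ f T ρ φ :=
  ⟨h.source_eq, h.contMDiffOn, h.contMDiffOn_symm, h.contact, h.legendrian, h.disjoint_boundary,
    fun x hx => hST (h.subset x hx)⟩

end NormalForm

theorem mainTheorem12 {n : ℕ} [NeZero n]
    {Y : Type*} [TopologicalSpace Y] [T2Space Y] [SecondCountableTopology Y]
    [ChartedSpace (EuclideanSpace ℝ (Fin (2 * n + 1))) Y] [IsManifold (𝓡 (2 * n + 1)) ∞ Y]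
    {L : Type*} [TopologicalSpace L]
    [ChartedSpace (EuclideanHalfSpace n) L] [IsManifold (𝓡∂ n) ∞ L]
    (ξ : ∀ y : Y, Submodule ℝ (TangentSpace (𝓡 (2 * n + 1)) y)) (hξ : IsContactStructure n ξ)
    (f : L → Y) (hf : IsLegendrianEmbedding ξ f)
    (hL : ((𝓡∂ n).boundary L).Nonempty) :
    (AdmitsStabilisation ξ f ∧ (3 < 2 * n + 1 → IsLoose ξ f)) ∧
    ∀ x ∈ (𝓡∂ n).boundary L,
      AdmitsStabilisationAlong ξ f (connectedComponent x) ∧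
        (3 < 2 * n + 1 → IsLooseAlong ξ f (connectedComponent x)) := by
  refine ⟨?_, fun x hx => ?_⟩
  · obtain ⟨x, hx⟩ := hL
    -- Every `ρ` is available; `2` is a choice above `1`.
    obtain ⟨φ, hφ⟩ := hf.exists_isStabilisationChart hξ hx 2
    have hφ' := hφ.mono (Set.subset_univ _)
    exact ⟨⟨2, one_lt_two, φ, hφ'⟩, fun h => ⟨by omega, 2, one_lt_two, φ, hφ'⟩⟩
  · obtain ⟨φ, hφ⟩ := hf.exists_isStabilisationChart hξ hx 2
    exact ⟨⟨2, one_lt_two, φ, hφ⟩, fun h => ⟨by omega, 2, one_lt_two, φ, hφ⟩⟩
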